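/- **Setting.** Let $V=\mathcal R\sqcup\bar{\mathcal R}$ be a finite set of fermionic modes with annihilation operators $c_i$. For coefficients $\epsilon_{ij}=\overline{\epsilon_{ji}}$ and $\lambda_{ijkl}=\overline{\lambda_{lkji}}$ of arbitrary size and sign let $$H=\sum_{ij}\epsilon_{ij}c_i^\dagger c_j-\sum_{ijkl}\lambda_{ijkl}\,c_i^\dagger c_jc_k^\dagger c_l ,\qquad H_\varphi=\sum_{ij}\epsilon_{ij}c_i^\dagger c_j-\sum_{ijkl}\lambda_{ijkl}\bigl(\varphi_{ij}c_k^\dagger c_l+\varphi_{kl}c_i^\dagger c_j-\varphi_{ij}\varphi_{kl}\bigr),$$ so that $H_\varphi=H+\sum\lambda_{ijkl}(\varphi_{ij}-c_i^\dagger c_j)(\varphi_{kl}-c_k^\dagger c_l)$. The Hubbard–Stratonovich (HS) decoupling of $e^{-wH}$ ($w=\beta$ or $w=\pm it$) with $L\ge1$ time slices is the integral of $W_w(\varphi)=\prod_{l=1}^{L}e^{-(w/L)H_{\varphi_l}}$ over the fields $\varphi_1,\dots,\varphi_L$, on a contour $\varphi_l=Ty_l$ ($y_l$ real, $T$ a complex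 matrix) which spans all interaction channels and on which the Gaussian weight $e^{-a(\varphi)}$, $a(\varphi)=\frac wL\sum_l\sum\lambda_{ijkl}\varphi_{l,ij}\varphi_{l,kl}$, equals $e^{-|y|^2}$ ($L=1$ is a static field). *Keeping Gaussian fluctuations* of relative strength $\eta>0$ around $\varphi_0$ means: write $W_w(\varphi_0+\phi)=e^{-a(\phi)}F(\phi)$, replace the fermionic operator $F$ by its Taylor polynomial of order two at $\phi=0$, and average it with the normalized weight $e^{-a(\phi)/\eta}$ on the contour ($\eta=1$ is the weight of the decoupling itself; $\eta$ counts the order in the fluctuations). Denote the result by $E_w(\varphi_0,\eta)$. Consider either of the following families of density matrices $\rho_\eta$, with density matrix $\Gamma_0$ at the saddle point. * *(thermal)* $\rho_\eta=E_\beta(\varphi_0,\eta)/\operatorname{Tr}E_\beta(\varphi_0,\eta)$, $\beta>0$, and $\Gamma_0=W_\beta(\varphi_0)/\operatorname{Tr}W_\beta(\varphi_0)$, for a static $\varphi_0$ with $\varphi_{0,ij}=\overline{\varphi_{0,ji}}$; here $Z_{\rm eff}(\varphi)=\operatorname{Tr}W_\beta(\varphi)$. * *(non-equilibrium)* the decoupled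 form of $e^{-iHt}e^{-S}e^{iHt}/Z$, where $H$ and $S$ are both operators of the above form: $\rho_\eta=E^{H}_{it}(\varphi_1,\eta)\,E^{S}_{1}(\varphi_3,\eta)\,E^{H}_{-it}(\varphi_2,\eta)/\operatorname{Tr}(\cdots)$, $\Gamma_0=W^H_{it}(\varphi_1)W^S_1(\varphi_3)W^H_{-it}(\varphi_2)/\operatorname{Tr}(\cdots)$, with $\varphi_3$ static and $\varphi_{3,ij}=\overline{\varphi_{3,ji}}$, and with $\varphi_2$ (and its contour) adjoint to $\varphi_1$ (and its contour), so that the third factor is the adjoint of the first; here $Z_{\rm eff}$ is the trace of the product of the three $W$'s as a function of the three fields. In both cases assume that the point is a stable saddle point: the derivative of $Z_{\rm eff}$ with respect to all fields vanishes there, and the second derivative of the effective action $-\log Z_{\rm eff}$ along every non-zero direction of the contour has positive real part. **Theorem.** There are an orthonormal basis of single-particle states of $\mathcal R$ with occupation numbers $n_i$, real numbers $s_i$, and constants $C$ and $\delta>0$, all depending only on $\Gamma_0$ and the partition, such that for every such family $\rho_\eta$ there are charge-conserving operators $G'_\eta=O(\eta)$ $(\eta\downarrow0)$ on the Fock space of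 $\mathcal R$ with $$\rho_{\mathcal R}:=\operatorname{Tr}_{\bar{\mathcal R}}\rho_\eta=\frac1{Z_{\mathcal R}}\,e^{-\sum_is_in_i}\,(1+G'_\eta)\qquad(\eta>0),\qquad Z_{\mathcal R}=\operatorname{Tr}\bigl[e^{-\sum_is_in_i}(1+G'_\eta)\bigr].$$ With $M^{ij}_{\mathcal R}=\operatorname{Tr}(\rho_{\mathcal R}c_i^\dagger c_j)$ the correlation matrix of the interacting state and $S_{\mathcal R}=-\operatorname{Tr}\rho_{\mathcal R}\log\rho_{\mathcal R}$, the free-fermion formula holds up to leading order in the fluctuations: $$S_{\mathcal R}=-\operatorname{Tr}\bigl[(1-M_{\mathcal R})\log(1-M_{\mathcal R})+M_{\mathcal R}\log M_{\mathcal R}\bigr]+O(\eta^2)\qquad(\eta\downarrow0).$$ Moreover, for every $\eta>0$ and $r\le\delta$ such that all matrix elements of $G'_\eta$ in the occupation-number basis have modulus at most $r$, $\rho_{\mathcal R}$ is positive definite with trace one, and the two sides of the formula differ by at most $Cr^2$. -/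

import Mathlib

open scoped Matrix ComplexOrder

noncomputable section

/-! ### Fermionic Fock space -/

/-- Operators on the fermionic Fock space with single-particle modes `V`, written in the
occupation-number basis: the basis vector with label `S` is the Slater determinant in which exactly
the modes in `S` are occupied (creation operators applied in increasing order of the modes). -/
abbrev FockOp (V : Type*) := Matrix (Finset V) (Finset V) ℂ

/-- The annihilation operator `c_i` (with the Jordan-Wigner sign). -/
def annihilate {V : Type*} [LinearOrder V] (i : V) : FockOp V :=
  Matrix.of fun S T =>
    if i ∈ T ∧ S = T.erase i then (-1 : ℂ) ^ (T.filter (fun j => j < i)).card else 0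

/-- The one-body operator `c_i† c_j`, for the pair `p = (i, j)`. -/
def hop {V : Type*} [Fintype V] [LinearOrder V] (p : V × V) : FockOp V :=
  (annihilate p.1)ᴴ * annihilate p.2

/-- The total charge `∑ᵢ c_i† c_i`. -/
def totalNumber (V : Type*) [Fintype V] [LinearOrder V] : FockOp V :=
  ∑ i, hop (i, i)

/-- The annihilation operator `∑ⱼ U i j c_j` of the `i`-th single-particle state of the orthonormal
basis described by `U`. -/
def rotatedMode {V : Type*} [Fintype V] [LinearOrder V] (U : Matrix V V ℂ) (i : V) : FockOp V :=
  ∑ j, U i j • annihilate j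

/-- The operator `exp (- ∑ᵢ s_i n_i)`, where `n_i` is the occupation number of the `i`-th state of
the orthonormal basis described by `U`. -/
def freeExp {V : Type*} [Fintype V] [LinearOrder V] (U : Matrix V V ℂ) (s : V → ℝ) : FockOp V :=
  NormedSpace.exp (-∑ i, (s i : ℂ) • ((rotatedMode U i)ᴴ * rotatedMode U i))

/-- Division by the trace. -/
def normalizeTrace {n : Type*} [Fintype n] (X : Matrix n n ℂ) : Matrix n n ℂ :=
  X.trace⁻¹ • X

/-! ### Subsystems, reduced states, entropies

The modes of the whole system are `A ⊕ₗ B`: those of the region, and those of its complement.  In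
the Jordan-Wigner order the modes of the region come first, so that the Fock space is the tensor
product of the Fock spaces of `A` and of `B`, and the operator `c_a` of the system is `c_a ⊗ 1`. -/

/-- The occupation of the whole system with occupation `S` in `A` and `T` in `B`. -/
def joinOcc {A B : Type*} (S : Finset A) (T : Finset B) : Finset (A ⊕ₗ B) :=
  (S.disjSum T).map toLex.toEmbedding

/-- The trace over the Fock space of `B`. -/
def traceOut {A B : Type*} [Fintype B] (X : FockOp (A ⊕ₗ B)) : FockOp A :=
  Matrix.of fun S S' => ∑ T : Finset B, X (joinOcc S T) (joinOcc S' T)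

/-- The correlation matrix `M i j = Tr (ρ c_i† c_j)`. -/
def corrMatrix {V : Type*} [Fintype V] [LinearOrder V] (ρ : FockOp V) : Matrix V V ℂ :=
  Matrix.of fun i j => (ρ * hop (i, j)).trace

/-- The logarithm of a Hermitian matrix. -/
def matLog {n : Type*} [Fintype n] [DecidableEq n] (X : Matrix n n ℂ) : Matrix n n ℂ :=
  cfc Real.log X

/-- The von Neumann entropy `- Tr (ρ log ρ)`. -/
def vnEntropy {n : Type*} [Fintype n] [DecidableEq n] (ρ : Matrix n n ℂ) : ℝ :=
  -(ρ * matLog ρ).trace.re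

/-- The free-fermion formula `- Tr [(1 - M) log (1 - M) + M log M]`. -/
def freeFermionEntropy {n : Type*} [Fintype n] [DecidableEq n] (M : Matrix n n ℂ) : ℝ :=
  -((1 - M) * matLog (1 - M) + M * matLog M).trace.re

/-! ### Quartic systems and their Hubbard-Stratonovich decoupling -/

/-- The coefficients of a Hermitian, charge-conserving operator
`∑ ε_ij c_i† c_j - ∑ λ_ijkl c_i† c_j c_k† c_l`; here `lam (i, j) (k, l)` is `λ_ijkl`. There is no
restriction on the size or the sign of the interaction. -/
structure QuarticSystem (V : Type*) where
  eps : Matrix V V ℂ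
  lam : Matrix (V × V) (V × V) ℂ
  eps_herm : ∀ i j, star (eps i j) = eps j i
  lam_herm : ∀ i j k l, star (lam (i, j) (k, l)) = lam (l, k) (j, i)

namespace QuarticSystem

variable {V : Type*} [Fintype V] [LinearOrder V] (Q : QuarticSystem V)

/-- The operator `∑ ε_ij c_i† c_j - ∑ λ_ijkl c_i† c_j c_k† c_l`. -/
def hamiltonian : FockOp V :=
  (∑ p : V × V, Q.eps p.1 p.2 • hop p) - ∑ p : V × V, ∑ q : V × V, Q.lam p q • (hop p * hop q)

/-- The decoupled operator at the value `φ` of the bosonic field,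
`∑ ε_ij c_i† c_j - ∑ λ_ijkl (φ_ij c_k† c_l + φ_kl c_i† c_j - φ_ij φ_kl)`. -/
def decoupled (φ : V × V → ℂ) : FockOp V :=
  (∑ p : V × V, Q.eps p.1 p.2 • hop p) -
    ∑ p : V × V, ∑ q : V × V, Q.lam p q • (φ p • hop q + φ q • hop p - (φ p * φ q) • (1 : FockOp V))

/-- The Hubbard-Stratonovich step: the decoupled operator is the quartic one plus the quadratic form
of the boson shifted by the fermion bilinears. -/
theorem decoupled_eq (φ : V × V → ℂ) :
    Q.decoupled φ = Q.hamiltonian +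
      ∑ p : V × V, ∑ q : V × V, Q.lam p q •
        ((φ p • (1 : FockOp V) - hop p) * (φ q • (1 : FockOp V) - hop q)) := by
  have key : ∀ p q : V × V,
      Q.lam p q • (φ p • hop q + φ q • hop p - (φ p * φ q) • (1 : FockOp V)) =
        Q.lam p q • (hop p * hop q) - Q.lam p q •
          ((φ p • (1 : FockOp V) - hop p) * (φ q • (1 : FockOp V) - hop q)) := by
    intro p q
    rw [← smul_sub]
    congr 1
    simp only [sub_mul, mul_sub, smul_mul_assoc, mul_smul_comm, one_mul, mul_one, smul_sub,
      smul_smul]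
    rw [mul_comm (φ q) (φ p)]
    abel
  simp only [decoupled, hamiltonian, key, Finset.sum_sub_distrib]
  abel

/-- The integrand of the Hubbard-Stratonovich functional integral for `exp (- w H)`, with `L` slices
of the (real or imaginary) time `w` and one field per slice: the time-ordered product of the factors
`exp (- (w / L) (decoupled operator at φ l))`. For `L = 1` the field is static. -/
def hsIntegrand (w : ℂ) {L : ℕ} (φ : Fin L → V × V → ℂ) : FockOp V :=
  (List.ofFn fun l => NormedSpace.exp (-(w / L) • Q.decoupled (φ l))).prod

/-- The quadratic action `w ∑ λ_ijkl φ_ij φ_kl` of the boson (averaged over the slices). -/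
def bosonAction (w : ℂ) {L : ℕ} (φ : Fin L → V × V → ℂ) : ℂ :=
  w / L * ∑ l, ∑ p, ∑ q, Q.lam p q * φ l p * φ l q

/-- The columns of `T` span (over the reals) an integration contour for the fields of one slice on
which the Gaussian weight is `exp (- |y|²)`, and which contains a field for every interaction
channel. The contour is real for attractive channels, imaginary for repulsive ones, and rotated by
an eighth of a turn for real time. -/
def IsContour (w : ℂ) (L : ℕ) {k : ℕ} (T : Matrix (V × V) (Fin k) ℂ) : Prop :=
  let Λ : Matrix (V × V) (V × V) ℂ := (w / L / 2) • (Q.lam + Q.lamᵀ)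
  Tᵀ * Λ * T = 1 ∧ Λ * (T * Tᵀ) * Λ = Λ

end QuarticSystem

/-- The fields on the contour, one real coordinate vector for each slice. -/
def contourField {V : Type*} {L k : ℕ} (T : Matrix (V × V) (Fin k) ℂ) (y : Fin L → Fin k → ℝ) :
    Fin L → V × V → ℂ :=
  fun l => T *ᵥ fun a => (y l a : ℂ)

/-- The Taylor polynomial of order two of `f` at `0`, evaluated at `1`. -/
def taylorTwo (f : ℝ → ℂ) : ℂ :=
  f 0 + deriv f 0 + iteratedDeriv 2 f 0 / 2

/-- The Hubbard-Stratonovich integral for `exp (- w H)`, with the Gaussian fluctuations around `φ₀`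
kept. With `φ` the fluctuation, the integrand at `φ₀ + φ` is the boson's Gaussian weight
`exp (- w ∑ λ φ φ)` times a fermionic operator; this operator is expanded to second order in `φ` and
then averaged with the normalized weight over the contour. The parameter `η` multiplies the
variance of the fluctuations (`η = 1` is the weight of the decoupling itself). -/
def QuarticSystem.gaussianIntegral {V : Type*} [Fintype V] [LinearOrder V] (Q : QuarticSystem V)
    (w : ℂ) {L k : ℕ} (T : Matrix (V × V) (Fin k) ℂ) (φ₀ : Fin L → V × V → ℂ) (η : ℝ) : FockOp V :=
  let weight : (Fin L → Fin k → ℝ) → ℂ := fun y =>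
    Complex.exp (-Q.bosonAction w (contourField T y) / η)
  let fermionic : (Fin L → V × V → ℂ) → FockOp V := fun φ =>
    Complex.exp (Q.bosonAction w φ) • Q.hsIntegrand w (φ₀ + φ)
  Matrix.of fun S S' =>
    (∫ y, weight y * taylorTwo fun x => fermionic (x • contourField T y) S S') / ∫ y, weight y

/-- Positivity of the second derivative, at `φ₀` in the direction `φ`, of the effective action
`- log Z` of the boson (`φ₀` being a critical point of `Z`). -/
def StableAlong {E : Type*} [AddCommGroup E] [Module ℝ E] (Z : E → ℂ) (φ₀ φ : E) : Prop :=
  0 < (-iteratedDeriv 2 (fun x : ℝ => Z (φ₀ + x • φ)) 0 / Z φ₀).re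

/-! ### Thermal states -/

/-- `ρ η` is the thermal density matrix `exp (- β H) / Z` of a quartic system, decoupled and expanded
to Gaussian order around a static stable saddle point with fluctuations of relative strength `η`, and
`Γ₀` is the density matrix at the saddle point itself. -/
def IsThermalFluctuationState {V : Type*} [Fintype V] [LinearOrder V]
    (Γ₀ : FockOp V) (ρ : ℝ → FockOp V) : Prop :=
  ∃ (Q : QuarticSystem V) (β : ℝ) (L k : ℕ) (T : Matrix (V × V) (Fin k) ℂ) (φ₀ : V × V → ℂ),
    let Zeff : (Fin L → V × V → ℂ) → ℂ := fun φ => (Q.hsIntegrand β φ).trace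
    let saddle : Fin L → V × V → ℂ := fun _ => φ₀
    0 < β ∧ 0 < L ∧ Q.IsContour β L T ∧
    (∀ i j, star (φ₀ (i, j)) = φ₀ (j, i)) ∧
    HasFDerivAt Zeff (0 : (Fin L → V × V → ℂ) →L[ℂ] ℂ) saddle ∧
    (∀ y : Fin L → Fin k → ℝ, y ≠ 0 → StableAlong Zeff saddle (contourField T y)) ∧
    Γ₀ = normalizeTrace (Q.hsIntegrand β saddle) ∧
    ∀ η, ρ η = normalizeTrace (Q.gaussianIntegral β T saddle η)

/-! ### Non-equilibrium evolution -/

/-- The field whose backward evolution operator is adjoint to the forward one with field `φ`. -/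
def adjField {V : Type*} {L : ℕ} (φ : Fin L → V × V → ℂ) : Fin L → V × V → ℂ :=
  fun l p => star (φ l.rev p.swap)

/-- The contour of the fields of the backward evolution. -/
def adjContour {V : Type*} {k : ℕ} (T : Matrix (V × V) (Fin k) ℂ) : Matrix (V × V) (Fin k) ℂ :=
  Matrix.of fun p a => star (T p.swap a)

/-- `ρ η` is the density matrix `exp (- i H t) exp (- S) exp (i H t) / Z`, where the Hamiltonian `H`
(coefficients `Q`) and the action `S` of the initial state (coefficients `Q₀`) are both quartic, each
of the three exponentials being decoupled by a field of its own and expanded to Gaussian order around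
a joint stable saddle point, with fluctuations of relative strength `η`; `Γ₀` is the density matrix at
the saddle point itself. -/
def IsEvolvedFluctuationState {V : Type*} [Fintype V] [LinearOrder V]
    (Γ₀ : FockOp V) (ρ : ℝ → FockOp V) : Prop :=
  ∃ (Q Q₀ : QuarticSystem V) (t : ℝ) (L L₀ k k₀ : ℕ)
    (T : Matrix (V × V) (Fin k) ℂ) (T₀ : Matrix (V × V) (Fin k₀) ℂ)
    (φ₁ : Fin L → V × V → ℂ) (φ₃ : V × V → ℂ),
    let w : ℂ := Complex.I * t
    let E := (Fin L → V × V → ℂ) × (Fin L₀ → V × V → ℂ) × (Fin L → V × V → ℂ)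
    let integrand : E → FockOp V := fun φ =>
      Q.hsIntegrand w φ.1 * Q₀.hsIntegrand 1 φ.2.1 * Q.hsIntegrand (-w) φ.2.2
    let Zeff : E → ℂ := fun φ => (integrand φ).trace
    let saddle : E := (φ₁, fun _ => φ₃, adjField φ₁)
    0 < L ∧ 0 < L₀ ∧ Q.IsContour w L T ∧ Q₀.IsContour 1 L₀ T₀ ∧
    (∀ i j, star (φ₃ (i, j)) = φ₃ (j, i)) ∧
    HasFDerivAt Zeff (0 : E →L[ℂ] ℂ) saddle ∧
    (∀ (y₁ y₂ : Fin L → Fin k → ℝ) (y₃ : Fin L₀ → Fin k₀ → ℝ), ¬(y₁ = 0 ∧ y₂ = 0 ∧ y₃ = 0) →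
      StableAlong Zeff saddle
        (contourField T y₁, contourField T₀ y₃, contourField (adjContour T) y₂)) ∧
    Γ₀ = normalizeTrace (integrand saddle) ∧
    ∀ η, ρ η = normalizeTrace
      (Q.gaussianIntegral w T φ₁ η * Q₀.gaussianIntegral 1 T₀ (fun _ : Fin L₀ => φ₃) η *
        Q.gaussianIntegral (-w) (adjContour T) (adjField φ₁) η)

end

/-!
# The free-fermion entropy formula with Gaussian fluctuations of the Hubbard-Stratonovich field

At a fixed value of the bosonic field the decoupled operator is quadratic in the fermions, so that
the saddle point operator is a product of exponentials of quadratic operators. Such an operator `W`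
acts linearly on the modes, `c_i W = W ∑ⱼ K i j c_j` (`Implements`), with a matrix `K` which is
positive definite in both families of states. This property survives the trace over the complement
(`exists_implements_traceOut`): with the help of charge conservation, the modes of the complement
drop out of the relation between the expectation values of `c_v Y` and `Y c_v`. A positive operator
with this property is a multiple of `exp (- ∑ s_i n_i)` for the eigenbasis of its matrix, because
the Fock representation is irreducible (`Implements.exists_eq_smul_freeExp`). Hence the reduced
state of `Γ₀` is free, and `U`, `s` are determined by it.

The average of a Taylor polynomial of order two with a Gaussian weight of variance proportional to
`η` is `W + η R` (`QuarticSystem.IsContour.gaussianIntegral_apply`). The fermionic factor depends on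
the fluctuation only through its image under the coupling matrix, and the covariance of this image
is the coupling matrix itself. Therefore `R` does not depend on the contour. Taking the adjoint
amounts to passing to the adjoint field and contour (`QuarticSystem.gaussianIntegral_adj`). A static
Hermitian field is its own adjoint, so a thermal factor is Hermitian; the two factors of the time
evolution are adjoint to each other; hence the operators with fluctuations are Hermitian. They
conserve the charge, and so `G'`, which is `exp (∑ s_i n_i)` times the reduced perturbation, up to
normalization, is of order `η` and conserves the charge as well.

For the entropy formula, let `σ` be a state close to the free state `σ₀`, and let `M`, `M₀` be their
correlation matrices. The operator `log σ₀` is quadratic in the fermions, and therefore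
`Tr σ log σ₀ = Tr [(1 - M) log (1 - M₀) + M log M₀]` for every `σ` (`trace_mul_matLog_freeExp`); this
uses the Fermi-Dirac form of `M₀`, from the Kubo-Martin-Schwinger condition, and the partition
function of free fermions. The difference of the two sides of the entropy formula is thus a
combination of the relative entropies of `σ`, `M`, `1 - M` with respect to `σ₀`, `M₀`, `1 - M₀`, and
each is at most quadratic in the distance (`exists_relative_entropy_bound`). The constants depend
only on `σ₀`. Smallness of `G'` is needed only to keep the perturbed operator positive and its
trace away from zero.
-/

noncomputable section

/-! ### Canonical anticommutation relations -/

section CAR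

variable {V : Type*} [LinearOrder V]

/-- The Jordan-Wigner sign `(-1) ^ #{j ∈ S | j < i}`. -/
def jwSign (i : V) (S : Finset V) : ℂ := (-1) ^ (S.filter (fun j => j < i)).card

theorem jwSign_mul_self (i : V) (S : Finset V) : jwSign i S * jwSign i S = 1 := by
  rw [jwSign, ← mul_pow]; norm_num

theorem star_jwSign (i : V) (S : Finset V) : star (jwSign i S) = jwSign i S := by
  simp [jwSign]

theorem jwSign_insert {i j : V} {S : Finset V} (h : j ∉ S) :
    jwSign i (insert j S) = if j < i then -jwSign i S else jwSign i S := by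
  unfold jwSign
  rw [Finset.filter_insert]
  split_ifs with hji
  · rw [Finset.card_insert_of_notMem (by simp [h]), pow_succ]; ring
  · rfl

theorem jwSign_erase {i j : V} {S : Finset V} (h : j ∈ S) :
    jwSign i (S.erase j) = if j < i then -jwSign i S else jwSign i S := by
  conv_rhs => rw [← Finset.insert_erase h, jwSign_insert (Finset.notMem_erase j S)]
  split_ifs <;> simp

theorem jwSign_erase_self (i : V) (S : Finset V) : jwSign i (S.erase i) = jwSign i S := by
  by_cases h : i ∈ S
  · simp [jwSign_erase h]
  · rw [Finset.erase_eq_of_notMem h]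

variable [Fintype V]

/-- Left multiplication by `c_i` in the occupation-number basis. -/
theorem annihilate_mul_apply {n : Type*} (i : V) (X : Matrix (Finset V) n ℂ) (S : Finset V)
    (T : n) : (annihilate i * X) S T =
      if i ∈ S then 0 else jwSign i S * X (insert i S) T := by
  rw [Matrix.mul_apply]
  split_ifs with h
  · refine Finset.sum_eq_zero fun T' _ => ?_
    rw [annihilate, Matrix.of_apply, if_neg, zero_mul]
    rintro ⟨-, rfl⟩
    simp at h
  · rw [Finset.sum_eq_single (insert i S)]
    · rw [annihilate, Matrix.of_apply, if_pos ⟨by simp, by simp [h]⟩]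
      change jwSign i (insert i S) * _ = _
      rw [jwSign_insert h, if_neg (lt_irrefl i)]
    · intro T' _ hT'
      rw [annihilate, Matrix.of_apply, if_neg, zero_mul]
      rintro ⟨h1, rfl⟩
      exact hT' (by simp [h1])
    · simp

theorem annihilate_conjTranspose_mul_apply {n : Type*} (i : V) (X : Matrix (Finset V) n ℂ)
    (S : Finset V) (T : n) : ((annihilate i)ᴴ * X) S T =
      if i ∈ S then jwSign i S * X (S.erase i) T else 0 := by
  rw [Matrix.mul_apply]
  split_ifs with h
  · rw [Finset.sum_eq_single (S.erase i)]
    · rw [Matrix.conjTranspose_apply, annihilate, Matrix.of_apply, if_pos ⟨h, rfl⟩]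
      change star (jwSign i S) * _ = _
      rw [star_jwSign]
    · intro T' _ hT'
      rw [Matrix.conjTranspose_apply, annihilate, Matrix.of_apply, if_neg (by tauto), star_zero,
        zero_mul]
    · simp
  · refine Finset.sum_eq_zero fun T' _ => ?_
    rw [Matrix.conjTranspose_apply, annihilate, Matrix.of_apply, if_neg (by tauto), star_zero,
        zero_mul]

theorem mul_annihilate_apply {n : Type*} (i : V) (X : Matrix n (Finset V) ℂ) (S : n)
    (T : Finset V) : (X * annihilate i) S T =
      if i ∈ T then X S (T.erase i) * jwSign i T else 0 := by
  have := annihilate_conjTranspose_mul_apply i Xᴴ T S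
  rw [← Matrix.conjTranspose_mul, Matrix.conjTranspose_apply] at this
  rw [← star_star ((X * annihilate i) S T), this]
  split_ifs <;> simp [star_jwSign, mul_comm]

/-- The canonical anticommutation relations for a family of operators. -/
structure IsCAR {ι n : Type*} [DecidableEq ι] [Fintype n] [DecidableEq n]
    (a : ι → Matrix n n ℂ) : Prop where
  anticomm : ∀ i j, a i * a j + a j * a i = 0
  anticomm_adj : ∀ i j, a i * (a j)ᴴ + (a j)ᴴ * a i = if i = j then 1 else 0

theorem isCAR_annihilate : IsCAR (annihilate : V → FockOp V) where
  anticomm i j := by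
    -- entries of products are read off by multiplying the last factor by `1`
    ext S T
    simp only [Matrix.add_apply, annihilate_mul_apply, Matrix.zero_apply]
    rw [← mul_one (annihilate j), ← mul_one (annihilate i)]
    simp only [annihilate_mul_apply, Finset.mem_insert]
    rcases eq_or_ne i j with rfl | hij
    · simp
    by_cases hi : i ∈ S
    · simp [hi]
    by_cases hj : j ∈ S
    · simp [hj]
    simp only [hi, hj, hij, hij.symm, or_self, if_false, jwSign_insert hi, jwSign_insert hj]
    rw [Finset.insert_comm i j S]
    rcases lt_or_gt_of_ne hij with h | h
    · rw [if_pos h, if_neg h.not_gt]; ring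
    · rw [if_pos h, if_neg h.not_gt]; ring
  anticomm_adj i j := by
    ext S T
    simp only [Matrix.add_apply, annihilate_mul_apply, annihilate_conjTranspose_mul_apply]
    rw [← mul_one ((annihilate j)ᴴ), ← mul_one (annihilate i)]
    simp only [annihilate_mul_apply, annihilate_conjTranspose_mul_apply, Finset.mem_insert,
      Finset.mem_erase]
    rcases eq_or_ne i j with rfl | hij
    · by_cases hi : i ∈ S
      · simp [hi, jwSign_erase_self, ← mul_assoc, jwSign_mul_self]
        rw [Finset.insert_erase hi]
      · simp [hi, jwSign_insert hi, ← mul_assoc, jwSign_mul_self]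
        rw [Finset.erase_insert hi]
    by_cases hi : i ∈ S
    · simp [hi, hij]
    by_cases hj : j ∈ S
    swap
    · simp [hj, hij.symm, hij]
    simp only [hi, hj, hij, hij.symm, or_true, if_false, if_true, jwSign_insert hi,
      jwSign_erase hj, and_false, Matrix.zero_apply]
    rw [Finset.erase_insert_of_ne hij]
    rcases lt_or_gt_of_ne hij with h | h
    · rw [if_pos h, if_neg h.not_gt]; ring
    · rw [if_pos h, if_neg h.not_gt]; ring

/-- Orthonormal changes of the single-particle basis preserve the canonical anticommutation
relations. -/
theorem isCAR_rotatedMode {U : Matrix V V ℂ} (hU : U ∈ Matrix.unitaryGroup V ℂ) :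
    IsCAR (rotatedMode U) where
  anticomm i j := by
    simp only [rotatedMode, Finset.sum_mul_sum, smul_mul_smul_comm]
    rw [Finset.sum_comm (s := Finset.univ) (t := Finset.univ), ← Finset.sum_add_distrib]
    refine Finset.sum_eq_zero fun k _ => ?_
    rw [← Finset.sum_add_distrib]
    refine Finset.sum_eq_zero fun l _ => ?_
    rw [mul_comm (U j k), ← smul_add, isCAR_annihilate.anticomm, smul_zero]
  anticomm_adj i j := by
    simp only [rotatedMode, Matrix.conjTranspose_sum, Matrix.conjTranspose_smul,
      Finset.sum_mul_sum, smul_mul_smul_comm]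
    rw [Finset.sum_comm (s := Finset.univ) (t := Finset.univ), ← Finset.sum_add_distrib]
    have : ∀ k : V, (∑ l, (U i l * star (U j k)) • (annihilate l * (annihilate k)ᴴ)) +
        ∑ l, (star (U j k) * U i l) • ((annihilate k)ᴴ * annihilate l) =
        (U i k * star (U j k)) • (1 : FockOp V) := by
      intro k
      rw [← Finset.sum_add_distrib, Finset.sum_eq_single k]
      · rw [mul_comm (star (U j k)), ← smul_add, isCAR_annihilate.anticomm_adj, if_pos rfl]
      · intro l _ hl
        rw [mul_comm (star (U j k)), ← smul_add, isCAR_annihilate.anticomm_adj, if_neg hl,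
          smul_zero]
      · simp
    rw [Finset.sum_congr rfl fun k _ => this k, ← Finset.sum_smul]
    have h := congrFun (congrFun (Matrix.mem_unitaryGroup_iff.1 hU) i) j
    rw [Matrix.mul_apply, Matrix.one_apply] at h
    simp only [Matrix.star_apply] at h
    rw [h]
    split_ifs <;> simp

end CAR

section CARFamily

variable {ι n : Type*} [DecidableEq ι] [Fintype n] [DecidableEq n] {a : ι → Matrix n n ℂ}

theorem IsCAR.commutator (ha : IsCAR a) (i j k : ι) :
    a i * ((a j)ᴴ * a k) - (a j)ᴴ * a k * a i = if i = j then a k else 0 := by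
  have h1 := ha.anticomm_adj i j
  have h2 := ha.anticomm i k
  have : a i * ((a j)ᴴ * a k) - (a j)ᴴ * a k * a i =
      (a i * (a j)ᴴ + (a j)ᴴ * a i) * a k - (a j)ᴴ * (a i * a k + a k * a i) := by noncomm_ring
  rw [this, h1, h2]
  split_ifs <;> simp

/-- A quadratic operator acts on the annihilation operators, by commutation, through its
coefficient matrix. -/
theorem IsCAR.commutator_sum [Fintype ι] (ha : IsCAR a) (h : Matrix ι ι ℂ) (i : ι) :
    a i * (∑ j, ∑ k, h j k • ((a j)ᴴ * a k)) - (∑ j, ∑ k, h j k • ((a j)ᴴ * a k)) * a i =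
      ∑ k, h i k • a k := by
  simp only [Finset.mul_sum, Finset.sum_mul, ← Finset.sum_sub_distrib, mul_smul_comm,
    smul_mul_assoc, ← smul_sub, ha.commutator]
  rw [Finset.sum_eq_single i]
  · simp
  · intro j _ hj
    simp [hj.symm]
  · simp

end CARFamily

/-! ### Exponentials of quadratic operators -/

section Implements

variable {ι n : Type*} [Fintype ι] [Fintype n]

/-- Conjugation by the operator `W` acts on the family `a` through the matrix `K`:
`a i * W = W * ∑ j, K i j • a j`. For a density matrix `W` of free fermions with one-body
Hamiltonian `h` this holds with `K = exp (-h)`, and it is the form of Gaussianity used here; unlike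
the exponential form it is visibly stable under products. -/
def Implements (a : ι → Matrix n n ℂ) (W : Matrix n n ℂ) (K : Matrix ι ι ℂ) : Prop :=
  ∀ i, a i * W = W * ∑ j, K i j • a j

theorem Implements.one [DecidableEq ι] [DecidableEq n] (a : ι → Matrix n n ℂ) :
    Implements a 1 1 := by
  intro i
  simp [Matrix.one_apply]

theorem Implements.mul {a : ι → Matrix n n ℂ} {W W' : Matrix n n ℂ} {K K' : Matrix ι ι ℂ}
    (h : Implements a W K) (h' : Implements a W' K') : Implements a (W * W') (K * K') := by
  intro i
  rw [← mul_assoc, h i, mul_assoc, Finset.sum_mul, mul_assoc]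
  congr 1
  simp only [smul_mul_assoc, h' _, Matrix.mul_apply, Finset.sum_smul, ← mul_smul_comm,
    ← Finset.mul_sum]
  congr 1
  simp only [Finset.smul_sum, smul_smul]
  rw [Finset.sum_comm]

theorem Implements.smul {a : ι → Matrix n n ℂ} {W : Matrix n n ℂ} {K : Matrix ι ι ℂ}
    (h : Implements a W K) (c : ℂ) : Implements a (c • W) K := by
  intro i
  rw [mul_smul_comm, h i, smul_mul_assoc]

theorem Implements.pow [DecidableEq ι] [DecidableEq n] {a : ι → Matrix n n ℂ} {W : Matrix n n ℂ}
    {K : Matrix ι ι ℂ} (h : Implements a W K) (m : ℕ) : Implements a (W ^ m) (K ^ m) := by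
  induction m with
  | zero => simpa using Implements.one a
  | succ m ih => rw [pow_succ, pow_succ]; exact ih.mul h

end Implements

section Exponential

/-- A solution of the Heisenberg equation `Y' = [Y, H]` is evolved by conjugation with the
exponential of `H`. -/
theorem exp_mul_eq_mul_exp_of_hasDerivAt {𝔸 : Type*} [NormedRing 𝔸] [NormedAlgebra ℝ 𝔸]
    [CompleteSpace 𝔸] {H : 𝔸} {Y : ℝ → 𝔸} (hY : ∀ x, HasDerivAt Y (Y x * H - H * Y x) x) :
    NormedSpace.exp H * Y 1 = Y 0 * NormedSpace.exp H := by
  let +nondep : NormedAlgebra ℚ 𝔸 := .restrictScalars ℚ ℝ 𝔸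
  let g : ℝ → 𝔸 := fun x => NormedSpace.exp (x • H) * Y x * NormedSpace.exp (x • (-H))
  have hg : ∀ x, HasDerivAt g 0 x := by
    intro x
    refine (((hasDerivAt_exp_smul_const H x).fun_mul (hY x)).fun_mul
      (hasDerivAt_exp_smul_const' (-H) x)).congr_deriv ?_
    simp only [neg_mul, mul_neg, mul_sub, sub_mul, add_mul, mul_assoc]
    abel
  have h01 : g 1 = g 0 :=
    is_const_of_deriv_eq_zero (fun x => (hg x).differentiableAt) (fun x => (hg x).deriv) 1 0
  simp only [g, one_smul, zero_smul, NormedSpace.exp_zero, one_mul, mul_one] at h01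
  rw [← h01, mul_assoc, ← NormedSpace.exp_add_of_commute (Commute.neg_left (Commute.refl H)),
    neg_add_cancel, NormedSpace.exp_zero, mul_one]

theorem hasDerivAt_exp_smul_apply {n : Type*} [Fintype n] [DecidableEq n] (H : Matrix n n ℂ)
    (x : ℝ) (i j : n) : HasDerivAt (fun u : ℝ => NormedSpace.exp (u • H) i j)
      ((NormedSpace.exp (x • H) * H) i j) x := by
  let := Matrix.linftyOpNormedRing (n := n) (α := ℂ)
  let := Matrix.linftyOpNormedAlgebra (n := n) (R := ℝ) (α := ℂ)
  exact hasDerivAt_pi.1 (hasDerivAt_pi.1 (hasDerivAt_exp_smul_const H x) i) j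

/-- The exponential of an operator that acts on the modes, by commutation, through the matrix `h`
acts on them, by conjugation, through `exp h`. -/
theorem Implements.exp {ι n : Type*} [Fintype ι] [DecidableEq ι] [Fintype n] [DecidableEq n]
    {a : ι → Matrix n n ℂ} {H : Matrix n n ℂ} {h : Matrix ι ι ℂ}
    (hH : ∀ i, a i * H - H * a i = ∑ j, h i j • a j) :
    Implements a (NormedSpace.exp H) (NormedSpace.exp h) := by
  intro i
  let := Matrix.linftyOpNormedRing (n := n) (α := ℂ)
  let := Matrix.linftyOpNormedAlgebra (n := n) (R := ℝ) (α := ℂ)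
  let Y : ℝ → Matrix n n ℂ := fun x => ∑ j, NormedSpace.exp (x • h) i j • a j
  have hY : ∀ x, HasDerivAt Y (Y x * H - H * Y x) x := by
    intro x
    have e : Y x * H - H * Y x = ∑ j, (NormedSpace.exp (x • h) * h) i j • a j := by
      simp only [Y, Finset.sum_mul, Finset.mul_sum, ← Finset.sum_sub_distrib, smul_mul_assoc,
        mul_smul_comm, ← smul_sub, hH, Matrix.mul_apply, Finset.sum_smul, Finset.smul_sum,
        smul_smul]
      rw [Finset.sum_comm]
    rw [e]
    refine hasDerivAt_pi.2 fun S => hasDerivAt_pi.2 fun T => ?_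
    simp only [Y, Matrix.sum_apply, Matrix.smul_apply, smul_eq_mul]
    exact HasDerivAt.fun_sum fun j _ => (hasDerivAt_exp_smul_apply h x i j).mul_const _
  have key : NormedSpace.exp H * Y 1 = Y 0 * NormedSpace.exp H :=
    exp_mul_eq_mul_exp_of_hasDerivAt (𝔸 := Matrix n n ℂ) (H := H) (Y := Y) hY
  simp only [Y, one_smul, zero_smul, NormedSpace.exp_zero] at key
  have h0 : (∑ j, (1 : Matrix ι ι ℂ) i j • a j) = a i := by simp [Matrix.one_apply]
  rw [h0] at key
  exact key.symm

end Exponential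

/-! ### Thermal expectation values of free modes -/

section FreeState

variable {ι n : Type*} [Fintype ι] [Fintype n]

/-- The operator `-∑ i, s i n_i` for the occupation numbers of a family of modes. -/
def numberSum (a : ι → Matrix n n ℂ) (s : ι → ℝ) : Matrix n n ℂ :=
  -∑ i, (s i : ℂ) • ((a i)ᴴ * a i)

theorem numberSum_isHermitian (a : ι → Matrix n n ℂ) (s : ι → ℝ) :
    (numberSum a s).IsHermitian := by
  unfold numberSum
  rw [Matrix.IsHermitian, Matrix.conjTranspose_neg, Matrix.conjTranspose_sum]
  congr 1
  refine Finset.sum_congr rfl fun i _ => ?_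
  rw [Matrix.conjTranspose_smul, Matrix.conjTranspose_mul, Matrix.conjTranspose_conjTranspose]
  simp

theorem smul_numberSum (a : ι → Matrix n n ℂ) (s : ι → ℝ) (x : ℝ) :
    x • numberSum a s = numberSum a (x • s) := by
  simp only [numberSum, smul_neg, Finset.smul_sum, Pi.smul_apply, smul_eq_mul, Complex.ofReal_mul,
    mul_smul, Complex.coe_smul]

variable [DecidableEq ι] [DecidableEq n] {a : ι → Matrix n n ℂ}

theorem IsCAR.mul_exp_numberSum (ha : IsCAR a) (s : ι → ℝ) (i : ι) :
    a i * NormedSpace.exp (numberSum a s) =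
      (Real.exp (-s i) : ℂ) • (NormedSpace.exp (numberSum a s) * a i) := by
  have hH : ∀ i, a i * numberSum a s - numberSum a s * a i =
      ∑ j, Matrix.diagonal (fun j => -(s j : ℂ)) i j • a j := by
    intro i
    have := ha.commutator_sum (Matrix.diagonal (fun j => -(s j : ℂ))) i
    rw [← this]
    simp [numberSum, Matrix.diagonal_apply, ite_smul]
  have h := Implements.exp hH i
  rw [Matrix.exp_diagonal] at h
  rw [h]
  simp [Matrix.diagonal_apply, ite_smul, Pi.coe_exp, Complex.exp_eq_exp_ℂ]

/-- Correlations in a free state from the Kubo-Martin-Schwinger condition. -/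
theorem IsCAR.trace_exp_numberSum_mul (ha : IsCAR a) (s : ι → ℝ) (i j : ι) :
    (NormedSpace.exp (numberSum a s) * ((a i)ᴴ * a j)).trace =
      if i = j then ((1 + Real.exp (s i))⁻¹ : ℝ) * (NormedSpace.exp (numberSum a s)).trace
      else 0 := by
  set X := NormedSpace.exp (numberSum a s)
  -- moving `a j` once around the trace gives the boundary condition, and the anticommutator gives
  -- a second linear relation between the same two traces
  have h1 : (X * ((a i)ᴴ * a j)).trace = (Real.exp (-s j) : ℂ) * (X * (a j * (a i)ᴴ)).trace := by
    rw [← mul_assoc, Matrix.trace_mul_comm, ← mul_assoc, ha.mul_exp_numberSum]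
    rw [smul_mul_assoc, Matrix.trace_smul, smul_eq_mul, mul_assoc]
  have h2 : (X * (a j * (a i)ᴴ)).trace + (X * ((a i)ᴴ * a j)).trace =
      if i = j then X.trace else 0 := by
    rw [← Matrix.trace_add, ← mul_add, ha.anticomm_adj]
    rcases eq_or_ne i j with rfl | h
    · simp
    · simp [h, h.symm]
  have hpos : (1 + Real.exp (-s j) : ℂ) ≠ 0 := by
    have : (0 : ℝ) < 1 + Real.exp (-s j) := by positivity
    exact_mod_cast this.ne'
  have h3 : (1 + Real.exp (-s j) : ℂ) * (X * ((a i)ᴴ * a j)).trace =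
      (Real.exp (-s j) : ℂ) * if i = j then X.trace else 0 := by
    rw [← h2, add_mul, one_mul, mul_add, ← h1]
  split_ifs at h3 ⊢ with h
  · subst h
    have e : ((1 + Real.exp (s i))⁻¹ : ℝ) = Real.exp (-s i) / (1 + Real.exp (-s i)) := by
      rw [Real.exp_neg]
      have := Real.exp_pos (s i)
      field_simp
      ring
    rw [e]
    push_cast
    field_simp
    push_cast at h3 hpos
    rw [← h3]
    field_simp
  · rw [mul_zero] at h3
    exact (mul_eq_zero.1 h3).resolve_left hpos

/-- The partition function of free fermions. As a function of the scale `x` of the energies it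
solves a linear differential equation, whose coefficient is minus the mean energy and whose initial
value is the dimension. On the Fock space of the modes the dimension cancels the factors `1 / 2`. -/
theorem IsCAR.trace_exp_numberSum (ha : IsCAR a) (s : ι → ℝ) :
    (NormedSpace.exp (numberSum a s)).trace =
      ((Fintype.card n : ℝ) * ∏ i, ((1 + Real.exp (-s i)) / 2) : ℝ) := by
  let Z : ℝ → ℂ := fun x => (NormedSpace.exp (x • numberSum a s)).trace
  let m : ℝ → ℝ := fun x => ∑ i, -s i * (1 + Real.exp (x * s i))⁻¹
  have hZ : ∀ x, HasDerivAt Z (m x * Z x) x := by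
    intro x
    have h : HasDerivAt Z ((NormedSpace.exp (x • numberSum a s) * numberSum a s).trace) x :=
      HasDerivAt.fun_sum fun S _ => hasDerivAt_exp_smul_apply _ x S S
    convert h using 1
    rw [numberSum, mul_neg, Matrix.trace_neg, Finset.mul_sum, Matrix.trace_sum, ← numberSum]
    simp only [m, Z, mul_smul_comm, Matrix.trace_smul, smul_numberSum, ha.trace_exp_numberSum_mul,
      if_true, Pi.smul_apply, smul_eq_mul]
    push_cast
    rw [Finset.sum_mul, ← Finset.sum_neg_distrib]
    refine Finset.sum_congr rfl fun i _ => ?_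
    ring
  let P : ℝ → ℝ := fun x => ∑ i, -Real.log (1 + Real.exp (-(x * s i)))
  have hP : ∀ x, HasDerivAt P (-m x) x := by
    intro x
    simp only [m, ← Finset.sum_neg_distrib]
    refine HasDerivAt.fun_sum fun i _ => ?_
    have hne : 1 + Real.exp (-(x * s i)) ≠ 0 := by positivity
    have h1 : HasDerivAt (fun y : ℝ => -(y * s i)) (-s i) x := by
      simpa using ((hasDerivAt_id x).mul_const (s i)).fun_neg
    refine (((h1.exp).const_add 1).log hne).fun_neg.congr_deriv ?_
    rw [Real.exp_neg]
    have := Real.exp_pos (x * s i)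
    field_simp
    ring
  have hc : ∀ x, HasDerivAt (fun x => Z x * ((Real.exp (P x) : ℝ) : ℂ)) 0 x := by
    intro x
    refine ((hZ x).fun_mul ((hP x).exp.ofReal_comp)).congr_deriv ?_
    push_cast
    ring
  have h01 := is_const_of_deriv_eq_zero (fun x => (hc x).differentiableAt)
    (fun x => (hc x).deriv) 1 0
  have hexp : ∀ x, Real.exp (P x) = (∏ i, (1 + Real.exp (-(x * s i))))⁻¹ := by
    intro x
    rw [Real.exp_sum, ← Finset.prod_inv_distrib]
    refine Finset.prod_congr rfl fun i _ => ?_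
    rw [Real.exp_neg, Real.exp_log (by positivity)]
  simp only [hexp, Z, zero_smul, one_smul, NormedSpace.exp_zero, Matrix.trace_one, one_mul,
    zero_mul, neg_zero, Real.exp_zero] at h01
  have hne : (∏ i, (1 + Real.exp (-s i))) ≠ 0 := Finset.prod_ne_zero_iff.2 fun i _ => by positivity
  rw [Complex.ofReal_inv, mul_inv_eq_iff_eq_mul₀ (by exact_mod_cast hne)] at h01
  rw [h01, Finset.prod_div_distrib]
  push_cast
  rw [Finset.prod_const, Finset.prod_const, one_add_one_eq_two, div_eq_mul_inv]
  ring

end FreeState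

/-! ### Irreducibility, charge and parity -/

section Charge

variable {V : Type*} [Fintype V] [LinearOrder V]

theorem hop_self_apply (i : V) (S T : Finset V) :
    hop (i, i) S T = if i ∈ S ∧ S = T then 1 else 0 := by
  rw [hop, annihilate_conjTranspose_mul_apply]
  rw [← mul_one (annihilate (i, i).2), annihilate_mul_apply]
  by_cases h : i ∈ S
  · simp [h, jwSign_erase_self, ← mul_assoc, jwSign_mul_self]
    rw [Finset.insert_erase h, Matrix.one_apply]
  · simp [h]

theorem hop_self_eq_diagonal (i : V) :
    hop (i, i) = Matrix.diagonal fun S : Finset V => if i ∈ S then (1 : ℂ) else 0 := by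
  ext S T
  rw [hop_self_apply, Matrix.diagonal_apply]
  by_cases h : S = T <;> simp [h]

theorem totalNumber_eq_diagonal :
    totalNumber V = Matrix.diagonal fun S : Finset V => (S.card : ℂ) := by
  ext S T
  simp only [totalNumber, Matrix.sum_apply, hop_self_apply, Matrix.diagonal_apply]
  by_cases h : S = T <;> simp [h]

/-- The Fock representation is irreducible: an operator commuting with all creation and annihilation
operators commutes with the occupation numbers, so it is diagonal, and with `c_i`, so that adding a
particle does not change its diagonal entries. -/
theorem eq_smul_one_of_commute_annihilate {Y : FockOp V} (h : ∀ i, Commute Y (annihilate i))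
    (h' : ∀ i, Commute Y (annihilate i)ᴴ) : ∃ c : ℂ, Y = c • 1 := by
  have hdiag : ∀ S T : Finset V, S ≠ T → Y S T = 0 := by
    intro S T hST
    obtain ⟨i, hi⟩ : ∃ i, ¬(i ∈ S ↔ i ∈ T) := by
      by_contra! hc
      exact hST (Finset.ext hc)
    have hc : Y * hop (i, i) = hop (i, i) * Y := (h' i).mul_right (h i)
    have he := congrFun (congrFun hc S) T
    rw [hop_self_eq_diagonal, Matrix.mul_diagonal, Matrix.diagonal_mul] at he
    by_cases h1 : i ∈ S <;> by_cases h2 : i ∈ T <;> simp_all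
  have hconst : ∀ S : Finset V, Y S S = Y ∅ ∅ := by
    intro S
    induction S using Finset.induction_on with
    | empty => rfl
    | insert i S hi ih =>
      have he := congrFun (congrFun (h i).eq S) (insert i S)
      rw [mul_annihilate_apply, annihilate_mul_apply, if_pos (Finset.mem_insert_self i S),
        if_neg hi, Finset.erase_insert hi, jwSign_insert hi, if_neg (lt_irrefl i), mul_comm] at he
      have hne : jwSign i S ≠ 0 := left_ne_zero_of_mul_eq_one (jwSign_mul_self i S)
      rw [← ih]
      exact (mul_left_cancel₀ hne he).symm
  refine ⟨Y ∅ ∅, ?_⟩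
  ext S T
  rw [Matrix.smul_apply, Matrix.one_apply]
  split_ifs with hST
  · rw [← hST, hconst S]; simp
  · rw [hdiag S T hST]; simp

/-- Charge conservation says that matrix elements between occupations with different numbers of
particles vanish. -/
theorem commute_totalNumber_iff {X : FockOp V} :
    Commute X (totalNumber V) ↔ ∀ S T : Finset V, S.card ≠ T.card → X S T = 0 := by
  rw [totalNumber_eq_diagonal, commute_iff_eq, ← Matrix.ext_iff]
  simp only [Matrix.mul_diagonal, Matrix.diagonal_mul]
  refine forall₂_congr fun S T => ?_
  rw [mul_comm, mul_eq_mul_right_iff, Nat.cast_inj]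
  constructor
  · rintro (h | h) h'
    · exact absurd h.symm h'
    · exact h
  · intro h
    by_cases h' : S.card = T.card
    · exact Or.inl h'.symm
    · exact Or.inr (h h')

/-- The fermion parity `(-1) ^ N`, with `N` the total particle number. -/
def fermionParity (V : Type*) [LinearOrder V] : FockOp V :=
  Matrix.diagonal fun S => (-1) ^ S.card

theorem fermionParity_mul_self : fermionParity V * fermionParity V = 1 := by
  rw [fermionParity, Matrix.diagonal_mul_diagonal, ← Matrix.diagonal_one]
  congr 1
  ext S
  rw [← mul_pow]; norm_num

theorem annihilate_mul_fermionParity (i : V) :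
    annihilate i * fermionParity V = -(fermionParity V * annihilate i) := by
  ext S T
  rw [Matrix.neg_apply, fermionParity, Matrix.mul_diagonal, Matrix.diagonal_mul, annihilate,
    Matrix.of_apply]
  split_ifs with h
  · obtain ⟨hi, rfl⟩ := h
    have := Finset.card_erase_add_one hi
    rw [← this, pow_succ]; ring
  · simp

theorem Commute.fermionParity {X : FockOp V} (h : Commute X (totalNumber V)) :
    Commute X (fermionParity V) := by
  rw [commute_totalNumber_iff] at h
  rw [_root_.fermionParity, commute_iff_eq]
  ext S T
  rw [Matrix.mul_diagonal, Matrix.diagonal_mul]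
  by_cases hST : S.card = T.card
  · rw [hST, mul_comm]
  · simp [h S T hST]

theorem commute_hop_totalNumber (p : V × V) : Commute (hop p) (totalNumber V) := by
  rw [commute_totalNumber_iff]
  intro S T hST
  rw [hop, annihilate_conjTranspose_mul_apply]
  split_ifs with h
  · rw [annihilate, Matrix.of_apply, if_neg, mul_zero]
    rintro ⟨hT, he⟩
    apply hST
    rw [← Finset.card_erase_add_one h, ← Finset.card_erase_add_one hT, he]
  · rfl

end Charge

/-! ### The subsystem -/

section Subsystem

variable {A B : Type*}

theorem mem_joinOcc {S : Finset A} {T : Finset B} {x : A ⊕ B} :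
    toLex x ∈ joinOcc S T ↔ x ∈ S.disjSum T := by
  simp [joinOcc]

theorem inl_mem_joinOcc {S : Finset A} {T : Finset B} {a : A} :
    toLex (Sum.inl a) ∈ joinOcc S T ↔ a ∈ S := by
  rw [mem_joinOcc]; simp

theorem inr_mem_joinOcc {S : Finset A} {T : Finset B} {b : B} :
    toLex (Sum.inr b) ∈ joinOcc S T ↔ b ∈ T := by
  rw [mem_joinOcc]; simp

theorem card_joinOcc (S : Finset A) (T : Finset B) :
    (joinOcc S T).card = S.card + T.card := by
  simp [joinOcc]

theorem joinOcc_insert_left [DecidableEq A] [DecidableEq (A ⊕ₗ B)] (a : A) (S : Finset A)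
    (T : Finset B) :
    insert (toLex (Sum.inl a)) (joinOcc S T) = joinOcc (insert a S) T := by
  ext x
  obtain ⟨x, rfl⟩ := toLex.surjective x
  rcases x with a' | b
  · rw [Finset.mem_insert, inl_mem_joinOcc, inl_mem_joinOcc]; simp
  · rw [Finset.mem_insert, inr_mem_joinOcc, inr_mem_joinOcc]; simp

theorem joinOcc_insert_right [DecidableEq B] [DecidableEq (A ⊕ₗ B)] (b : B) (S : Finset A)
    (T : Finset B) :
    insert (toLex (Sum.inr b)) (joinOcc S T) = joinOcc S (insert b T) := by
  ext x
  obtain ⟨x, rfl⟩ := toLex.surjective x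
  rcases x with a' | b
  · rw [Finset.mem_insert, inl_mem_joinOcc, inl_mem_joinOcc]; simp
  · rw [Finset.mem_insert, inr_mem_joinOcc, inr_mem_joinOcc]; simp

theorem joinOcc_erase_right [DecidableEq B] [DecidableEq (A ⊕ₗ B)] (b : B) (S : Finset A)
    (T : Finset B) :
    (joinOcc S T).erase (toLex (Sum.inr b)) = joinOcc S (T.erase b) := by
  ext x
  obtain ⟨x, rfl⟩ := toLex.surjective x
  rcases x with a' | b
  · rw [Finset.mem_erase, inl_mem_joinOcc, inl_mem_joinOcc]; simp
  · rw [Finset.mem_erase, inr_mem_joinOcc, inr_mem_joinOcc]; simp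

section Order

variable [LinearOrder A] [LinearOrder B]

theorem jwSign_inl (a : A) (S : Finset A) (T : Finset B) :
    jwSign (toLex (Sum.inl a)) (joinOcc S T) = jwSign a S := by
  have h : (joinOcc S T).filter (fun j => j < toLex (Sum.inl a)) =
      joinOcc (S.filter fun j => j < a) (∅ : Finset B) := by
    ext x
    obtain ⟨x, rfl⟩ := toLex.surjective x
    rcases x with a' | b
    · rw [Finset.mem_filter, inl_mem_joinOcc, inl_mem_joinOcc]; simp
    · rw [Finset.mem_filter, inr_mem_joinOcc, inr_mem_joinOcc]; simp
  rw [jwSign, h, card_joinOcc, Finset.card_empty, add_zero, jwSign]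

theorem jwSign_inr (b : B) (S : Finset A) (T : Finset B) :
    jwSign (toLex (Sum.inr b)) (joinOcc S T) = (-1) ^ S.card * jwSign b T := by
  have h : (joinOcc S T).filter (fun j => j < toLex (Sum.inr b)) =
      joinOcc S (T.filter fun j => j < b) := by
    ext x
    obtain ⟨x, rfl⟩ := toLex.surjective x
    rcases x with a' | b
    · rw [Finset.mem_filter, inl_mem_joinOcc, inl_mem_joinOcc]; simp
    · rw [Finset.mem_filter, inr_mem_joinOcc, inr_mem_joinOcc]; simp
  rw [jwSign, h, card_joinOcc, pow_add, jwSign]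

end Order

variable [Fintype A] [LinearOrder A] [Fintype B] [LinearOrder B]

/-- Occupations of the whole system are pairs of occupations of the two parts. -/
def joinOccEquiv (A B : Type*) [Fintype A] [LinearOrder A] [Fintype B] [LinearOrder B] :
    Finset A × Finset B ≃ Finset (A ⊕ₗ B) where
  toFun p := joinOcc p.1 p.2
  invFun U := (Finset.univ.filter fun a => toLex (Sum.inl a) ∈ U,
    Finset.univ.filter fun b => toLex (Sum.inr b) ∈ U)
  left_inv p := by
    ext x <;> simp [inl_mem_joinOcc, inr_mem_joinOcc]
  right_inv U := by
    ext x
    obtain ⟨x, rfl⟩ := toLex.surjective x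
    rcases x with a | b
    · rw [inl_mem_joinOcc]; simp
    · rw [inr_mem_joinOcc]; simp

/-- The operator `X ⊗ 1` of the whole system, for an operator `X` of the region. -/
def embedLeft (B : Type*) [Fintype B] [LinearOrder B] (X : FockOp A) : FockOp (A ⊕ₗ B) :=
  (Matrix.kroneckerMap (· * ·) X (1 : FockOp B)).submatrix (joinOccEquiv A B).symm
    (joinOccEquiv A B).symm

theorem embedLeft_apply (X : FockOp A) (S S' : Finset A) (T T' : Finset B) :
    embedLeft B X (joinOcc S T) (joinOcc S' T') = if T = T' then X S S' else 0 := by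
  have h : ∀ (S : Finset A) (T : Finset B), (joinOccEquiv A B).symm (joinOcc S T) = (S, T) :=
    fun S T => (joinOccEquiv A B).symm_apply_apply (S, T)
  rw [embedLeft, Matrix.submatrix_apply, h, h]
  simp [Matrix.kroneckerMap_apply, Matrix.one_apply]

theorem embedLeft_mul (X Y : FockOp A) : embedLeft B (X * Y) = embedLeft B X * embedLeft B Y := by
  rw [embedLeft, embedLeft, embedLeft, Matrix.submatrix_mul_equiv, ← Matrix.mul_kronecker_mul,
    mul_one]

theorem sum_joinOcc {M : Type*} [AddCommMonoid M] (f : Finset (A ⊕ₗ B) → M) :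
    ∑ U, f U = ∑ S, ∑ T, f (joinOcc S T) := by
  rw [← (joinOccEquiv A B).sum_comp, Fintype.sum_prod_type]
  rfl

theorem ext_joinOcc {X Y : FockOp (A ⊕ₗ B)}
    (h : ∀ S T S' T', X (joinOcc S T) (joinOcc S' T') = Y (joinOcc S T) (joinOcc S' T')) :
    X = Y := by
  ext U U'
  obtain ⟨⟨S, T⟩, rfl⟩ := (joinOccEquiv A B).surjective U
  obtain ⟨⟨S', T'⟩, rfl⟩ := (joinOccEquiv A B).surjective U'
  exact h S T S' T'

/-- The reduced state gives the expectation values of the operators of the region. -/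
theorem trace_mul_embedLeft (Γ : FockOp (A ⊕ₗ B)) (X : FockOp A) :
    (Γ * embedLeft B X).trace = (traceOut Γ * X).trace := by
  simp only [Matrix.trace, Matrix.diag_apply, Matrix.mul_apply, sum_joinOcc, embedLeft_apply,
    traceOut, Matrix.of_apply, mul_ite, mul_zero, Finset.sum_mul]
  refine Finset.sum_congr rfl fun S _ => ?_
  rw [Finset.sum_comm]
  refine Finset.sum_congr rfl fun S' _ => ?_
  refine Finset.sum_congr rfl fun T _ => ?_
  simp

theorem joinOcc_inj {S S' : Finset A} {T T' : Finset B} :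
    joinOcc S T = joinOcc S' T' ↔ S = S' ∧ T = T' := by
  have := (joinOccEquiv A B).injective.eq_iff (a := (S, T)) (b := (S', T'))
  rw [Prod.mk_inj] at this
  exact this

theorem embedLeft_annihilate (a : A) :
    embedLeft B (annihilate a) = annihilate (toLex (Sum.inl a)) := by
  refine ext_joinOcc fun S T S' T' => ?_
  rw [embedLeft_apply, ← mul_one (annihilate a), annihilate_mul_apply,
    ← mul_one (annihilate (toLex (Sum.inl a))), annihilate_mul_apply]
  simp only [inl_mem_joinOcc, joinOcc_insert_left, jwSign_inl, Matrix.one_apply, joinOcc_inj]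
  by_cases hT : T = T' <;> simp [hT]

/-- Modes of the complement commute with operators of the region up to the fermion parity. -/
theorem annihilate_inr_mul_embedLeft (b : B) (X : FockOp A) :
    annihilate (toLex (Sum.inr b)) * embedLeft B X =
      embedLeft B (fermionParity A * X * fermionParity A) * annihilate (toLex (Sum.inr b)) := by
  refine ext_joinOcc fun S T S' T' => ?_
  rw [annihilate_mul_apply, mul_annihilate_apply]
  simp only [inr_mem_joinOcc, joinOcc_insert_right, joinOcc_erase_right, embedLeft_apply,
    fermionParity, Matrix.mul_diagonal, Matrix.diagonal_mul, jwSign_inr]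
  have hsq : ((-1 : ℂ) ^ S'.card) * (-1) ^ S'.card = 1 := by rw [← mul_pow]; norm_num
  by_cases hT : b ∈ T
  · have hne : T ≠ T'.erase b := by
      rintro rfl
      exact Finset.notMem_erase b T' hT
    simp [hT, hne]
  · rw [if_neg hT]
    by_cases hT' : b ∈ T'
    · rw [if_pos hT']
      by_cases h : insert b T = T'
      · subst h
        rw [if_pos rfl, Finset.erase_insert hT, if_pos rfl, jwSign_insert hT,
          if_neg (lt_irrefl b)]
        linear_combination (-(-1 : ℂ) ^ S.card * X S S' * jwSign b T) * hsq
      · rw [if_neg h, if_neg]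
        · simp
        · rintro rfl
          exact h (Finset.insert_erase hT')
    · rw [if_neg hT', if_neg]
      · simp
      · rintro rfl
        exact hT' (Finset.mem_insert_self b T)

/-- Conjugation with the parity of the region or of the whole system agree on the operators of the
region. -/
theorem embedLeft_fermionParity_conj (X : FockOp A) :
    embedLeft B (fermionParity A * X * fermionParity A) =
      fermionParity (A ⊕ₗ B) * embedLeft B X * fermionParity (A ⊕ₗ B) := by
  refine ext_joinOcc fun S T S' T' => ?_
  simp only [fermionParity, Matrix.mul_diagonal, Matrix.diagonal_mul, embedLeft_apply,
    card_joinOcc, pow_add]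
  split_ifs with h
  · subst h
    have hsq : ((-1 : ℂ) ^ T.card) * (-1) ^ T.card = 1 := by rw [← mul_pow]; norm_num
    linear_combination (-(-1 : ℂ) ^ S.card * X S S' * (-1) ^ S'.card) * hsq
  · simp

theorem traceOut_posDef {Γ : FockOp (A ⊕ₗ B)} (h : Γ.PosDef) : (traceOut Γ).PosDef := by
  have e : traceOut Γ = ∑ T : Finset B, Γ.submatrix (fun S => joinOcc S T)
      (fun S => joinOcc S T) := by
    ext S S'
    simp [traceOut, Matrix.sum_apply]
  have hp : ∀ T : Finset B, (Γ.submatrix (fun S => joinOcc S T) (fun S => joinOcc S T)).PosDef :=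
    fun T => h.submatrix fun S S' hS => (joinOcc_inj.1 hS).1
  rw [e, ← Finset.add_sum_erase _ _ (Finset.mem_univ ∅)]
  exact (hp ∅).add_posSemidef (Matrix.posSemidef_sum _ fun T _ => (hp T).posSemidef)

theorem traceOut_commute_totalNumber {Γ : FockOp (A ⊕ₗ B)}
    (h : Commute Γ (totalNumber (A ⊕ₗ B))) : Commute (traceOut Γ) (totalNumber A) := by
  rw [commute_totalNumber_iff] at h ⊢
  intro S S' hS
  refine Finset.sum_eq_zero fun T _ => h _ _ ?_
  rw [card_joinOcc, card_joinOcc]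
  omega

end Subsystem

/-! ### Reduced states of free-fermion states -/

section Reduction

variable {A B : Type*} [Fintype A] [LinearOrder A] [Fintype B] [LinearOrder B]

theorem Matrix.ext_trace_mul {n : Type*} [Fintype n] [DecidableEq n] {X Y : Matrix n n ℂ}
    (h : ∀ Z : Matrix n n ℂ, (X * Z).trace = (Y * Z).trace) : X = Y := by
  ext i j
  have := h (Matrix.single j i 1)
  simpa [Matrix.trace_mul_single] using this

/-- Expectation values with an odd mode of the complement only see its anticommutation with the
operators of the region. -/
theorem trace_mul_embedLeft_inr {Γ : FockOp (A ⊕ₗ B)}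
    (hc : Commute Γ (totalNumber (A ⊕ₗ B))) (Y : FockOp A) (b : B) :
    (Γ * (annihilate (toLex (Sum.inr b)) * embedLeft B Y)).trace =
      -(Γ * (embedLeft B Y * annihilate (toLex (Sum.inr b)))).trace := by
  set P := fermionParity (A ⊕ₗ B)
  have hP : P * P = 1 := fermionParity_mul_self
  have hΓ : Γ * P = P * Γ := hc.fermionParity
  have hb : annihilate (toLex (Sum.inr b)) * P = -(P * annihilate (toLex (Sum.inr b))) :=
    annihilate_mul_fermionParity _
  rw [annihilate_inr_mul_embedLeft, embedLeft_fermionParity_conj]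
  set y := embedLeft B Y
  set c := annihilate (toLex (Sum.inr b) : A ⊕ₗ B)
  calc (Γ * (P * y * P * c)).trace = (P * (Γ * y * (P * c))).trace := by
        rw [mul_assoc P y P, mul_assoc P (y * P), ← mul_assoc Γ P, hΓ]; simp only [mul_assoc]
    _ = (Γ * y * (P * c) * P).trace := Matrix.trace_mul_comm _ _
    _ = -(Γ * y * (P * P * c)).trace := by
        rw [mul_assoc (Γ * y), mul_assoc P c P, hb]
        simp only [mul_neg, Matrix.trace_neg, mul_assoc]
    _ = -(Γ * (y * c)).trace := by rw [hP, one_mul, mul_assoc]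

/-- The reduced state of a free-fermion state is again a free-fermion state: the matrix
`(1 + K)⁻¹` of correlations is compressed to the region. The proof compares, for a fixed operator
`Y` of the region, the expectation values of `c_v Y` and of `Y c_v`; the modes `v` of the complement
drop out of their sum, because they anticommute with `Y` as far as charge-conserving states are
concerned. -/
theorem exists_implements_traceOut {Γ : FockOp (A ⊕ₗ B)}
    (hc : Commute Γ (totalNumber (A ⊕ₗ B))) {K : Matrix (A ⊕ₗ B) (A ⊕ₗ B) ℂ} (hK : K.PosDef)
    (h : Implements annihilate Γ K) :
    ∃ K' : Matrix A A ℂ, K'.IsHermitian ∧ Implements annihilate (traceOut Γ) K' := by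
  let e : A → A ⊕ₗ B := fun a => toLex (Sum.inl a)
  have he : Function.Injective e := fun a a' haa => Sum.inl_injective (toLex.injective haa)
  have h1K : (1 + K).PosDef := Matrix.PosDef.one.add hK
  have hNA : ((1 + K)⁻¹.submatrix e e).PosDef := h1K.inv.submatrix he
  set NA := (1 + K)⁻¹.submatrix e e
  have hNAi : IsUnit NA.det := (Matrix.isUnit_iff_isUnit_det _).1 hNA.isUnit
  refine ⟨NA⁻¹ - 1, hNA.inv.isHermitian.sub Matrix.isHermitian_one, fun i => ?_⟩
  refine Matrix.ext_trace_mul fun Y => ?_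
  let f : A ⊕ₗ B → ℂ := fun v => (Γ * (annihilate v * embedLeft B Y)).trace
  let g : A ⊕ₗ B → ℂ := fun v => (Γ * (embedLeft B Y * annihilate v)).trace
  -- the assumption on `Γ`, with cyclicity of the trace
  have hg : g = K *ᵥ f := by
    ext v
    have : g v = (annihilate v * Γ * embedLeft B Y).trace := by
      simp only [g]
      rw [← mul_assoc, Matrix.trace_mul_comm, mul_assoc]
    rw [this, h v]
    simp only [Matrix.mulVec, dotProduct, f, mul_assoc, Finset.sum_mul, Finset.mul_sum,
      Matrix.trace_sum, smul_mul_assoc, mul_smul_comm, Matrix.trace_smul, smul_eq_mul]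
  have hfg : f = (1 + K)⁻¹ *ᵥ (f + g) := by
    have : f + g = (1 + K) *ᵥ f := by rw [Matrix.add_mulVec, Matrix.one_mulVec, ← hg]
    rw [this, Matrix.mulVec_mulVec,
      Matrix.nonsing_inv_mul _ ((Matrix.isUnit_iff_isUnit_det _).1 h1K.isUnit), Matrix.one_mulVec]
  have hB : ∀ b : B, (f + g) (toLex (Sum.inr b)) = 0 := by
    intro b
    simp only [f, g, Pi.add_apply, trace_mul_embedLeft_inr hc]
    ring
  have hA : f ∘ e = NA *ᵥ ((f + g) ∘ e) := by
    ext a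
    rw [Function.comp_apply, hfg]
    simp only [Matrix.mulVec, dotProduct]
    rw [← toLex.sum_comp, Fintype.sum_sum_type]
    simp only [hB, mul_zero, Finset.sum_const_zero, add_zero, ← hfg]
    rfl
  have hgA : g ∘ e = (NA⁻¹ - 1) *ᵥ (f ∘ e) := by
    have : NA⁻¹ *ᵥ (f ∘ e) = f ∘ e + g ∘ e := by
      conv_lhs => rw [hA]
      rw [Matrix.mulVec_mulVec, Matrix.nonsing_inv_mul _ hNAi, Matrix.one_mulVec]
      rfl
    rw [Matrix.sub_mulVec, this, Matrix.one_mulVec, add_sub_cancel_left]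
  have hf' : ∀ a, f (e a) = (traceOut Γ * (annihilate a * Y)).trace := fun a => by
    rw [← trace_mul_embedLeft, embedLeft_mul, embedLeft_annihilate]
  have hg' : ∀ a, g (e a) = (traceOut Γ * (Y * annihilate a)).trace := fun a => by
    rw [← trace_mul_embedLeft, embedLeft_mul, embedLeft_annihilate]
  calc (annihilate i * traceOut Γ * Y).trace = (traceOut Γ * (Y * annihilate i)).trace := by
        rw [mul_assoc, Matrix.trace_mul_comm, mul_assoc]
    _ = ((NA⁻¹ - 1) *ᵥ (f ∘ e)) i := by rw [← hgA, ← hg']; rfl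
    _ = _ := by
        simp only [Matrix.mulVec, dotProduct, Function.comp_apply, hf', mul_assoc, Finset.sum_mul,
          Finset.mul_sum, Matrix.trace_sum, smul_mul_assoc, mul_smul_comm, Matrix.trace_smul,
          smul_eq_mul]

end Reduction

/-! ### Positive operators acting linearly on the modes -/

section FreeForm

variable {V : Type*} [Fintype V] [LinearOrder V]

theorem freeExp_eq (U : Matrix V V ℂ) (s : V → ℝ) :
    freeExp U s = NormedSpace.exp (numberSum (rotatedMode U) s) := rfl

theorem Matrix.IsHermitian.exp_posDef {n : Type*} [Fintype n] [DecidableEq n] {H : Matrix n n ℂ}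
    (hH : H.IsHermitian) : (NormedSpace.exp H).PosDef := by
  have h2 : NormedSpace.exp H = (NormedSpace.exp ((1 / 2 : ℝ) • H))ᴴ *
      NormedSpace.exp ((1 / 2 : ℝ) • H) := by
    have hh : ((1 / 2 : ℝ) • H).IsHermitian := by
      rw [Matrix.IsHermitian, Matrix.conjTranspose_smul, hH.eq]; simp
    rw [hh.exp.eq, ← Matrix.exp_add_of_commute _ _ (Commute.refl _), ← add_smul]
    norm_num
  rw [h2]
  exact Matrix.PosDef.conjTranspose_mul_self _
    (Matrix.mulVec_injective_of_isUnit (Matrix.isUnit_exp _))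

theorem freeExp_posDef (U : Matrix V V ℂ) (s : V → ℝ) : (freeExp U s).PosDef :=
  (numberSum_isHermitian _ _).exp_posDef

theorem annihilate_eq_sum_rotatedMode {U : Matrix V V ℂ} (hU : U ∈ Matrix.unitaryGroup V ℂ)
    (j : V) : annihilate j = ∑ i, star (U i j) • rotatedMode U i := by
  have h := Matrix.mem_unitaryGroup_iff'.1 hU
  simp only [rotatedMode, Finset.smul_sum, smul_smul]
  rw [Finset.sum_comm]
  have e : ∀ k, ∑ i, (star (U i j) * U i k) • (annihilate k : FockOp V) =
      (1 : Matrix V V ℂ) j k • annihilate k := by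
    intro k
    rw [← Finset.sum_smul, ← h, Matrix.mul_apply]
    simp only [Matrix.star_apply]
  rw [Finset.sum_congr rfl fun k _ => e k]
  simp [Matrix.one_apply]

/-- A positive operator that acts on the modes like a free-fermion state is a multiple of one:
diagonalize `K`; its eigenvalues are positive and are the weights `exp (-s i)` of a free state, and
the quotient of the two operators commutes with all modes. -/
theorem Implements.exists_eq_smul_freeExp {ρ : FockOp V} (hρ : ρ.PosDef) {K : Matrix V V ℂ}
    (hK : K.IsHermitian) (h : Implements annihilate ρ K) :
    ∃ U ∈ Matrix.unitaryGroup V ℂ, ∃ (s : V → ℝ) (z : ℝ), 0 < z ∧ ρ = (z : ℂ) • freeExp U s := by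
  set D : Matrix V V ℂ := Matrix.diagonal fun i => (hK.eigenvalues i : ℂ) with hD
  set U : Matrix V V ℂ := star (hK.eigenvectorUnitary : Matrix V V ℂ) with hUdef
  have hU : U ∈ Matrix.unitaryGroup V ℂ := Unitary.star_mem hK.eigenvectorUnitary.2
  have hUK : U * K = D * U := by
    have := hK.spectral_theorem
    rw [Unitary.conjStarAlgAut_apply] at this
    conv_lhs => rw [this]
    rw [← mul_assoc, ← mul_assoc, hUdef, Unitary.star_mul_self_of_mem hK.eigenvectorUnitary.2,
      one_mul]
    rfl
  have haρ : ∀ i, rotatedMode U i * ρ = (hK.eigenvalues i : ℂ) • (ρ * rotatedMode U i) := by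
    intro i
    have h1 : rotatedMode U i * ρ = ρ * ∑ k, (U * K) i k • annihilate k := by
      simp only [rotatedMode, Finset.sum_mul, smul_mul_assoc, h _, Matrix.mul_apply,
        Finset.sum_smul, ← mul_smul_comm, ← Finset.mul_sum, Finset.smul_sum, smul_smul]
      rw [Finset.sum_comm]
    rw [h1, hUK, rotatedMode, ← mul_smul_comm, Finset.smul_sum]
    simp only [D, Matrix.diagonal_mul, smul_smul]
  have hCAR := isCAR_rotatedMode hU
  have hκ : ∀ i, 0 < hK.eigenvalues i := by
    intro i
    -- the eigenvalue is the ratio of the occupation and the vacancy of the mode, both nonnegative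
    -- and not both zero
    set a := rotatedMode U i
    have hp1 : 0 ≤ (ρ * (aᴴ * a)).trace := by
      rw [← mul_assoc, Matrix.trace_mul_comm, ← mul_assoc]
      exact (hρ.posSemidef.mul_mul_conjTranspose_same a).trace_nonneg
    have hp2 : 0 ≤ (ρ * (a * aᴴ)).trace := by
      rw [← mul_assoc, Matrix.trace_mul_comm, ← mul_assoc]
      exact (hρ.posSemidef.conjTranspose_mul_mul_same a).trace_nonneg
    have hs : (ρ * (a * aᴴ)).trace + (ρ * (aᴴ * a)).trace = ρ.trace := by
      rw [← Matrix.trace_add, ← mul_add, hCAR.anticomm_adj, if_pos rfl, mul_one]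
    have hk : (ρ * (aᴴ * a)).trace = (hK.eigenvalues i : ℂ) * (ρ * (a * aᴴ)).trace := by
      rw [← mul_assoc, Matrix.trace_mul_comm, ← mul_assoc, haρ, smul_mul_assoc, Matrix.trace_smul,
        mul_assoc, smul_eq_mul]
    have hane : a ≠ 0 := by
      intro ha
      have := hCAR.anticomm_adj i i
      rw [show rotatedMode U i = 0 from ha] at this
      simp at this
    have hκ0 : hK.eigenvalues i ≠ 0 := by
      intro h0
      have h2 := haρ i
      rw [h0, Complex.ofReal_zero, zero_smul] at h2
      exact hane ((hρ.isUnit.mul_left_eq_zero).1 h2)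
    obtain ⟨x, hx0, hx⟩ : ∃ x : ℝ, 0 ≤ x ∧ (ρ * (aᴴ * a)).trace = x :=
      ⟨_, (Complex.nonneg_iff.1 hp1).1, Complex.eq_re_of_ofReal_le hp1⟩
    obtain ⟨y, hy0, hy⟩ : ∃ y : ℝ, 0 ≤ y ∧ (ρ * (a * aᴴ)).trace = y :=
      ⟨_, (Complex.nonneg_iff.1 hp2).1, Complex.eq_re_of_ofReal_le hp2⟩
    have hpos : 0 < ρ.trace := hρ.trace_pos
    rw [hx, hy] at hk
    rw [← hs, hx, hy] at hpos
    have hpos' : 0 < y + x := by exact_mod_cast hpos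
    have hk' : x = hK.eigenvalues i * y := by exact_mod_cast hk
    by_contra hneg
    have hlt : hK.eigenvalues i < 0 := lt_of_le_of_ne (not_lt.1 hneg) hκ0
    have hy' : y = 0 := by nlinarith
    rw [hy', mul_zero] at hk'
    linarith
  set s : V → ℝ := fun i => -Real.log (hK.eigenvalues i) with hs
  set X := freeExp U s with hX
  have hXpd : X.PosDef := freeExp_posDef U s
  have haX : ∀ i, rotatedMode U i * X = (hK.eigenvalues i : ℂ) • (X * rotatedMode U i) := by
    intro i
    rw [hX, freeExp_eq, hCAR.mul_exp_numberSum]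
    simp only [hs, neg_neg]
    rw [Real.exp_log (hκ i)]
  have hXi : X * X⁻¹ = 1 :=
    Matrix.mul_nonsing_inv _ ((Matrix.isUnit_iff_isUnit_det _).1 hXpd.isUnit)
  have hXi' : X⁻¹ * X = 1 :=
    Matrix.nonsing_inv_mul _ ((Matrix.isUnit_iff_isUnit_det _).1 hXpd.isUnit)
  have hcomm : ∀ i, Commute (ρ * X⁻¹) (rotatedMode U i) := by
    intro i
    have h1 : X⁻¹ * rotatedMode U i = (hK.eigenvalues i : ℂ) • (rotatedMode U i * X⁻¹) := by
      calc X⁻¹ * rotatedMode U i = X⁻¹ * (rotatedMode U i * X) * X⁻¹ := by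
            rw [mul_assoc, mul_assoc, hXi, mul_one]
        _ = _ := by rw [haX, mul_smul_comm, ← mul_assoc, hXi', one_mul, smul_mul_assoc]
    rw [commute_iff_eq, mul_assoc, h1, ← mul_assoc, haρ, mul_smul_comm, smul_mul_assoc, mul_assoc]
  have hne : ∀ i, (hK.eigenvalues i : ℂ) ≠ 0 := fun i => by exact_mod_cast (hκ i).ne'
  have hcomm' : ∀ i, Commute (ρ * X⁻¹) (rotatedMode U i)ᴴ := by
    intro i
    have h1 := congrArg Matrix.conjTranspose (haX i)
    have h2 := congrArg Matrix.conjTranspose (haρ i)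
    simp only [Matrix.conjTranspose_mul, Matrix.conjTranspose_smul, hXpd.isHermitian.eq,
      hρ.isHermitian.eq, RCLike.star_def, Complex.conj_ofReal] at h1 h2
    set b := (rotatedMode U i)ᴴ
    have h3 : (hK.eigenvalues i : ℂ) • (X⁻¹ * b) = b * X⁻¹ := by
      calc (hK.eigenvalues i : ℂ) • (X⁻¹ * b)
          = X⁻¹ * ((hK.eigenvalues i : ℂ) • (b * X)) * X⁻¹ := by
            rw [mul_smul_comm, smul_mul_assoc, mul_assoc, mul_assoc, hXi, mul_one]
        _ = _ := by rw [← h1, ← mul_assoc, hXi', one_mul]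
    have h4 : (hK.eigenvalues i : ℂ) • (ρ * X⁻¹ * b) =
        (hK.eigenvalues i : ℂ) • (b * (ρ * X⁻¹)) := by
      rw [mul_assoc, ← mul_smul_comm, h3, ← mul_assoc, h2, smul_mul_assoc, mul_assoc]
    exact smul_right_injective _ (hne i) h4
  obtain ⟨z, hz⟩ := eq_smul_one_of_commute_annihilate (Y := ρ * X⁻¹)
    (fun j => by
      rw [annihilate_eq_sum_rotatedMode hU j]
      exact Commute.sum_right _ _ _ fun i _ => (hcomm i).smul_right _)
    (fun j => by
      rw [annihilate_eq_sum_rotatedMode hU j, Matrix.conjTranspose_sum]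
      refine Commute.sum_right _ _ _ fun i _ => ?_
      rw [Matrix.conjTranspose_smul]
      exact (hcomm' i).smul_right _)
  have hρX : ρ = z • X := by
    calc ρ = ρ * X⁻¹ * X := by rw [mul_assoc, hXi', mul_one]
      _ = z • X := by rw [hz, smul_mul_assoc, one_mul]
  have htρ : 0 < ρ.trace := hρ.trace_pos
  have htX : 0 < X.trace := hXpd.trace_pos
  have hzpos : 0 < z := by
    rw [hρX, Matrix.trace_smul, smul_eq_mul] at htρ
    exact pos_of_mul_pos_left htρ htX.le
  refine ⟨U, hU, s, z.re, (Complex.pos_iff.1 hzpos).1, ?_⟩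
  rw [← Complex.eq_re_of_ofReal_le hzpos.le]
  exact hρX

end FreeForm

/-! ### Second-order expansion of matrix entropies -/

section Klein

variable {n : Type*} [Fintype n] [DecidableEq n]

/-- The trace of a product of functions of two Hermitian matrices is a positive combination of the
products of the values of the functions at the eigenvalues. -/
theorem trace_cfc_mul_cfc {X Y : Matrix n n ℂ} (hX : X.IsHermitian) (hY : Y.IsHermitian)
    (f g : ℝ → ℝ) :
    (cfc f Y * cfc g X).trace = ((∑ j, ∑ i, f (hY.eigenvalues j) * g (hX.eigenvalues i) *
      Complex.normSq ((star (hY.eigenvectorUnitary : Matrix n n ℂ) *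
        (hX.eigenvectorUnitary : Matrix n n ℂ)) j i) : ℝ) : ℂ) := by
  rw [hX.cfc_eq, hY.cfc_eq, Matrix.IsHermitian.cfc, Matrix.IsHermitian.cfc,
    Unitary.conjStarAlgAut_apply, Unitary.conjStarAlgAut_apply]
  set P := (hX.eigenvectorUnitary : Matrix n n ℂ)
  set R := (hY.eigenvectorUnitary : Matrix n n ℂ)
  have hW : star P * R = (star R * P)ᴴ := by
    rw [Matrix.conjTranspose_mul, Matrix.star_eq_conjTranspose, Matrix.star_eq_conjTranspose,
      Matrix.conjTranspose_conjTranspose]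
  have e : ∀ D E : Matrix n n ℂ, (R * D * star R * (P * E * star P)).trace =
      (D * (star R * P) * (E * (star R * P)ᴴ)).trace := by
    intro D E
    rw [← hW, mul_assoc R D, mul_assoc R, Matrix.trace_mul_comm]
    simp only [mul_assoc]
  rw [e, Matrix.trace]
  push_cast
  refine Finset.sum_congr rfl fun j _ => ?_
  rw [Matrix.diag_apply, Matrix.mul_apply]
  refine Finset.sum_congr rfl fun i _ => ?_
  rw [Matrix.diagonal_mul, Matrix.diagonal_mul, Matrix.conjTranspose_apply,
    ← Complex.mul_conj]
  simp only [Function.comp_apply, RCLike.star_def]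
  change (f _ : ℂ) * _ * ((g _ : ℂ) * _) = _
  ring

/-- The scalar relative entropy is nonnegative and at most quadratic. At `y = 0` the convention
`0 * log 0 = 0` is the right one. -/
theorem mul_log_sub_mul_log_sub_mem {x y : ℝ} (hx : 0 < x) (hy : 0 ≤ y) :
    0 ≤ y * Real.log y - y * Real.log x - (y - x) ∧
      y * Real.log y - y * Real.log x - (y - x) ≤ x⁻¹ * (y - x) ^ 2 := by
  rcases hy.eq_or_lt with rfl | hy
  · constructor
    · simp [hx.le]
    · have : x⁻¹ * (0 - x) ^ 2 = x := by field_simp; ring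
      rw [this]; simp
  have h1 := Real.log_le_sub_one_of_pos (div_pos hy hx)
  have h2 := Real.log_le_sub_one_of_pos (div_pos hx hy)
  rw [Real.log_div hy.ne' hx.ne'] at h1
  rw [Real.log_div hx.ne' hy.ne'] at h2
  have h1' := mul_le_mul_of_nonneg_left h1 hy.le
  have h2' := mul_le_mul_of_nonneg_left h2 hy.le
  have e2 : y * (x / y - 1) = x - y := by field_simp
  have e1 : y * (y / x - 1) - (y - x) = x⁻¹ * (y - x) ^ 2 := by field_simp
  constructor
  · linarith
  · linarith

theorem Matrix.IsHermitian.cfc_id_eq {X : Matrix n n ℂ} (hX : X.IsHermitian) :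
    cfc (fun x : ℝ => x) X = X :=
  cfc_id' ℝ X hX

/-- The quantum relative entropy (for arguments of arbitrary trace) is at most quadratic in the
difference of its arguments. All traces involved are averages of functions of pairs of eigenvalues,
with the same nonnegative weights `w`, so that the scalar bound can be applied termwise; `Y` need
not be invertible. -/
theorem exists_relative_entropy_bound {X : Matrix n n ℂ} (hX : X.PosDef) :
    ∃ c : ℝ, 0 ≤ c ∧ ∀ Y : Matrix n n ℂ, Y.PosSemidef →
      |(Y * matLog Y).trace.re - (Y * matLog X).trace.re - (Y - X).trace.re| ≤
        c * ∑ i, ∑ j, ‖(Y - X) i j‖ ^ 2 := by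
  have hXpos : ∀ i, 0 < hX.isHermitian.eigenvalues i := hX.eigenvalues_pos
  refine ⟨∑ i, (hX.isHermitian.eigenvalues i)⁻¹,
    Finset.sum_nonneg fun i _ => (inv_pos.2 (hXpos i)).le, fun Y hY => ?_⟩
  set c := ∑ i, (hX.isHermitian.eigenvalues i)⁻¹
  have hXh := hX.isHermitian
  have hYh := hY.isHermitian
  set x := hXh.eigenvalues
  set y := hYh.eigenvalues with hy
  let w : n → n → ℝ := fun j i => Complex.normSq ((star (hYh.eigenvectorUnitary : Matrix n n ℂ) *
        (hXh.eigenvectorUnitary : Matrix n n ℂ)) j i)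
  have key := fun f g => trace_cfc_mul_cfc hXh hYh f g
  have hXid := Matrix.IsHermitian.cfc_id_eq hXh
  have hYid := Matrix.IsHermitian.cfc_id_eq hYh
  have hone : ∀ Z : Matrix n n ℂ, Z.IsHermitian → cfc (fun _ : ℝ => (1 : ℝ)) Z = 1 :=
    fun Z hZ => cfc_const_one ℝ Z hZ
  have t1 : (Y * matLog Y).trace.re = ∑ j, ∑ i, y j * Real.log (y j) * w j i := by
    have e : Y * matLog Y = cfc (fun t => t * Real.log t) Y * cfc (fun _ : ℝ => (1 : ℝ)) X := by
      have hc : ∀ f : ℝ → ℝ, ContinuousOn f (spectrum ℝ Y) := fun f => by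
        rw [continuousOn_iff_continuous_domRestrict]; fun_prop
      rw [hone X hXh, mul_one]
      refine Eq.trans ?_ (cfc_mul (R := ℝ) (p := IsSelfAdjoint) (fun t => t) Real.log Y (hc _)
        (hc _)).symm
      rw [hYid]; rfl
    rw [e, key, Complex.ofReal_re]
    simp [w, y]
  have t2 : (Y * matLog X).trace.re = ∑ j, ∑ i, y j * Real.log (x i) * w j i := by
    have e : Y * matLog X = cfc (fun t : ℝ => t) Y * cfc Real.log X := by rw [hYid]; rfl
    rw [e, key, Complex.ofReal_re]
  have t3 : (Y - X).trace.re = ∑ j, ∑ i, (y j - x i) * w j i := by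
    have e : Y - X = cfc (fun t : ℝ => t) Y * cfc (fun _ : ℝ => (1 : ℝ)) X -
        cfc (fun _ : ℝ => (1 : ℝ)) Y * cfc (fun t : ℝ => t) X := by
      rw [hXid, hYid, hone X hXh, hone Y hYh, one_mul, mul_one]
    rw [e, Matrix.trace_sub, key, key, Complex.sub_re, Complex.ofReal_re, Complex.ofReal_re,
      ← Finset.sum_sub_distrib]
    refine Finset.sum_congr rfl fun j _ => ?_
    rw [← Finset.sum_sub_distrib]
    refine Finset.sum_congr rfl fun i _ => ?_
    simp only [w, x, y]; ring
  have t4 : ∑ i, ∑ j, ‖(Y - X) i j‖ ^ 2 = ∑ j, ∑ i, (y j - x i) ^ 2 * w j i := by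
    have e0 : ((Y - X) * (Y - X)).trace.re = ∑ i, ∑ j, ‖(Y - X) i j‖ ^ 2 := by
      have hd : (Y - X).IsHermitian := hYh.sub hXh
      simp only [Matrix.trace, Matrix.diag_apply, Matrix.mul_apply, Complex.re_sum]
      refine Finset.sum_congr rfl fun i _ => Finset.sum_congr rfl fun j _ => ?_
      rw [← hd.apply j i, RCLike.star_def, Complex.mul_conj, Complex.ofReal_re,
        Complex.normSq_eq_norm_sq]
    have hsq : ∀ Z : Matrix n n ℂ, Z.IsHermitian → cfc (fun t : ℝ => t ^ 2) Z = Z * Z := by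
      intro Z hZ
      exact (cfc_pow_id (R := ℝ) (p := IsSelfAdjoint) Z 2 hZ).trans (pow_two Z)
    have e : ((Y - X) * (Y - X)).trace =
        (cfc (fun t : ℝ => t ^ 2) Y * cfc (fun _ : ℝ => (1 : ℝ)) X).trace -
        2 * (cfc (fun t : ℝ => t) Y * cfc (fun t : ℝ => t) X).trace +
        (cfc (fun _ : ℝ => (1 : ℝ)) Y * cfc (fun t : ℝ => t ^ 2) X).trace := by
      rw [hXid, hYid, hone X hXh, hone Y hYh, one_mul, mul_one, hsq X hXh, hsq Y hYh,
        sub_mul, mul_sub, mul_sub]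
      simp only [Matrix.trace_sub]
      rw [Matrix.trace_mul_comm X Y]
      ring
    rw [← e0, e, key, key, key]
    rw [show ∀ a b c : ℝ, ((a : ℂ) - 2 * (b : ℂ) + (c : ℂ)).re = a - 2 * b + c by
      intro a b c; simp, Finset.mul_sum, ← Finset.sum_sub_distrib, ← Finset.sum_add_distrib]
    refine Finset.sum_congr rfl fun j _ => ?_
    rw [Finset.mul_sum, ← Finset.sum_sub_distrib, ← Finset.sum_add_distrib]
    refine Finset.sum_congr rfl fun i _ => ?_
    simp only [w, x, y]; ring
  have hw : ∀ j i, 0 ≤ w j i := fun j i => Complex.normSq_nonneg _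
  have hcomb : (Y * matLog Y).trace.re - (Y * matLog X).trace.re - (Y - X).trace.re =
      ∑ j, ∑ i, (y j * Real.log (y j) - y j * Real.log (x i) - (y j - x i)) * w j i := by
    rw [t1, t2, t3, ← Finset.sum_sub_distrib, ← Finset.sum_sub_distrib]
    refine Finset.sum_congr rfl fun j _ => ?_
    rw [← Finset.sum_sub_distrib, ← Finset.sum_sub_distrib]
    refine Finset.sum_congr rfl fun i _ => ?_
    ring
  have hb : ∀ j i, 0 ≤ y j * Real.log (y j) - y j * Real.log (x i) - (y j - x i) ∧
      y j * Real.log (y j) - y j * Real.log (x i) - (y j - x i) ≤ c * (y j - x i) ^ 2 := by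
    intro j i
    have h := mul_log_sub_mul_log_sub_mem (hXpos i) (hY.eigenvalues_nonneg j)
    refine ⟨h.1, h.2.trans (mul_le_mul_of_nonneg_right ?_ (sq_nonneg _))⟩
    exact Finset.single_le_sum (f := fun i => (x i)⁻¹) (fun i _ => (inv_pos.2 (hXpos i)).le)
      (Finset.mem_univ i)
  rw [hcomb, t4, abs_of_nonneg (Finset.sum_nonneg fun j _ => Finset.sum_nonneg fun i _ =>
    mul_nonneg (hb j i).1 (hw j i)), Finset.mul_sum]
  refine Finset.sum_le_sum fun j _ => ?_
  rw [Finset.mul_sum]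
  refine Finset.sum_le_sum fun i _ => ?_
  rw [← mul_assoc]
  exact mul_le_mul_of_nonneg_right (hb j i).2 (hw j i)

theorem Matrix.exp_unitary_conj {P : Matrix n n ℂ} (hP : P ∈ Matrix.unitaryGroup n ℂ)
    (D : Matrix n n ℂ) : NormedSpace.exp (P * D * star P) = P * NormedSpace.exp D * star P := by
  have hinv : P⁻¹ = star P := Matrix.inv_eq_right_inv (Matrix.mem_unitaryGroup_iff.1 hP)
  have hu : IsUnit P := ⟨⟨P, star P, Matrix.mem_unitaryGroup_iff.1 hP,
    Matrix.mem_unitaryGroup_iff'.1 hP⟩, rfl⟩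
  rw [← hinv, Matrix.exp_conj _ _ hu]

theorem matLog_exp {H : Matrix n n ℂ} (hH : H.IsHermitian) : matLog (NormedSpace.exp H) = H := by
  have hc : ∀ f : ℝ → ℝ, ContinuousOn f (spectrum ℝ H) := fun f => by
    rw [continuousOn_iff_continuous_domRestrict]; fun_prop
  have he : NormedSpace.exp H = cfc Real.exp H := by
    rw [hH.cfc_eq, Matrix.IsHermitian.cfc, Unitary.conjStarAlgAut_apply]
    conv_lhs => rw [hH.spectral_theorem, Unitary.conjStarAlgAut_apply]
    rw [Matrix.exp_unitary_conj hH.eigenvectorUnitary.2, Matrix.exp_diagonal]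
    congr 3
    ext i
    rw [Pi.coe_exp]
    simp [Complex.exp_eq_exp_ℂ]
  rw [matLog, he]
  refine (cfc_comp (R := ℝ) (p := IsSelfAdjoint) Real.log Real.exp H hH ?_ (hc _)).symm.trans ?_
  swap
  · have : Real.log ∘ Real.exp = fun x => x := by ext x; simp
    rw [this]
    exact Matrix.IsHermitian.cfc_id_eq hH
  · refine Real.continuousOn_log.mono ?_
    rintro _ ⟨t, -, rfl⟩
    exact (Real.exp_pos t).ne'

theorem conj_diagonal_eq_exp {P : Matrix n n ℂ} (hP : P ∈ Matrix.unitaryGroup n ℂ) {d : n → ℝ}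
    (hd : ∀ i, 0 < d i) : P * Matrix.diagonal (fun i => (d i : ℂ)) * star P =
      NormedSpace.exp (P * Matrix.diagonal (fun i => (Real.log (d i) : ℂ)) * star P) := by
  rw [Matrix.exp_unitary_conj hP, Matrix.exp_diagonal]
  congr 3
  ext i
  rw [Pi.coe_exp, ← Complex.exp_eq_exp_ℂ, ← Complex.ofReal_exp, Real.exp_log (hd i)]

theorem conj_diagonal_isHermitian (P : Matrix n n ℂ) (d : n → ℝ) :
    (P * Matrix.diagonal (fun i => (d i : ℂ)) * star P).IsHermitian := by
  rw [Matrix.IsHermitian, Matrix.star_eq_conjTranspose]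
  simp only [Matrix.conjTranspose_mul, Matrix.conjTranspose_conjTranspose,
    Matrix.diagonal_conjTranspose, mul_assoc]
  congr 3
  ext i
  simp

theorem matLog_conj_diagonal {P : Matrix n n ℂ} (hP : P ∈ Matrix.unitaryGroup n ℂ) {d : n → ℝ}
    (hd : ∀ i, 0 < d i) : matLog (P * Matrix.diagonal (fun i => (d i : ℂ)) * star P) =
      P * Matrix.diagonal (fun i => (Real.log (d i) : ℂ)) * star P := by
  rw [conj_diagonal_eq_exp hP hd, matLog_exp (conj_diagonal_isHermitian P _)]

theorem conj_diagonal_posDef {P : Matrix n n ℂ} (hP : P ∈ Matrix.unitaryGroup n ℂ) {d : n → ℝ}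
    (hd : ∀ i, 0 < d i) : (P * Matrix.diagonal (fun i => (d i : ℂ)) * star P).PosDef := by
  rw [conj_diagonal_eq_exp hP hd]
  exact (conj_diagonal_isHermitian P _).exp_posDef

end Klein

/-! ### The free-fermion formula near a free state -/

theorem star_transpose_mul_mul_transpose_apply {V : Type*} [Fintype V] (U M : Matrix V V ℂ)
    (i l : V) :
    (star Uᵀ * M * Uᵀ) i l = star (U i) ⬝ᵥ (M *ᵥ U l) := by
  rw [mul_assoc, Matrix.mul_apply]
  simp only [dotProduct, Matrix.mulVec, Matrix.mul_apply, Matrix.star_apply,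
    Matrix.transpose_apply, Pi.star_apply]

section Formula

variable {V : Type*} [Fintype V] [LinearOrder V]

/-- The correlation matrix gives the correlations of superpositions of the modes. -/
theorem trace_mul_superposition (ρ : FockOp V) (x y : V → ℂ) :
    (ρ * ((∑ j, y j • annihilate j)ᴴ * ∑ k, x k • annihilate k)).trace =
      star y ⬝ᵥ (corrMatrix ρ *ᵥ x) := by
  rw [Matrix.conjTranspose_sum, Finset.sum_mul_sum]
  simp only [Matrix.conjTranspose_smul, Finset.mul_sum, Matrix.trace_sum, smul_mul_assoc,
    mul_smul_comm, Matrix.trace_smul, dotProduct, Matrix.mulVec, corrMatrix, Matrix.of_apply,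
    hop, Pi.star_apply, smul_eq_mul]
  refine Finset.sum_congr rfl fun j _ => Finset.sum_congr rfl fun k _ => ?_
  ring

theorem corrMatrix_isHermitian {ρ : FockOp V} (hρ : ρ.IsHermitian) :
    (corrMatrix ρ).IsHermitian := by
  ext i j
  have hh : (hop (j, i))ᴴ = hop (i, j) := by
    rw [hop, hop, Matrix.conjTranspose_mul, Matrix.conjTranspose_conjTranspose]
  rw [Matrix.conjTranspose_apply, corrMatrix, Matrix.of_apply, Matrix.of_apply,
    ← Matrix.trace_conjTranspose, Matrix.conjTranspose_mul, hρ.eq, hh, Matrix.trace_mul_comm]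

theorem corrMatrix_posSemidef {ρ : FockOp V} (hρ : ρ.PosSemidef) :
    (corrMatrix ρ).PosSemidef := by
  refine Matrix.PosSemidef.of_dotProduct_mulVec_nonneg
    (corrMatrix_isHermitian hρ.isHermitian) fun x => ?_
  rw [← trace_mul_superposition, ← mul_assoc, Matrix.trace_mul_comm, ← mul_assoc]
  exact (hρ.mul_mul_conjTranspose_same _).trace_nonneg

/-- The Pauli principle: occupation numbers are at most one. -/
theorem one_sub_corrMatrix_posSemidef {ρ : FockOp V} (hρ : ρ.PosSemidef) (ht : ρ.trace = 1) :
    (1 - corrMatrix ρ).PosSemidef := by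
  refine Matrix.PosSemidef.of_dotProduct_mulVec_nonneg
    (Matrix.isHermitian_one.sub (corrMatrix_isHermitian hρ.isHermitian)) fun x => ?_
  set b : FockOp V := ∑ k, x k • annihilate k with hb
  have hanti : b * bᴴ + bᴴ * b = (star x ⬝ᵥ x) • 1 := by
    rw [hb, Matrix.conjTranspose_sum, Finset.sum_mul_sum, Finset.sum_mul_sum,
      Finset.sum_comm (γ := V), ← Finset.sum_add_distrib, dotProduct, Finset.sum_smul]
    refine Finset.sum_congr rfl fun j _ => ?_
    rw [← Finset.sum_add_distrib, Finset.sum_eq_single j]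
    · rw [Matrix.conjTranspose_smul, smul_mul_smul_comm, smul_mul_smul_comm, mul_comm (x j),
        ← smul_add, isCAR_annihilate.anticomm_adj, if_pos rfl]
      rfl
    · intro k _ hk
      rw [Matrix.conjTranspose_smul, smul_mul_smul_comm, smul_mul_smul_comm, mul_comm (x k),
        ← smul_add, isCAR_annihilate.anticomm_adj, if_neg hk, smul_zero]
    · simp
  have h : star x ⬝ᵥ ((1 - corrMatrix ρ) *ᵥ x) = (ρ * (b * bᴴ)).trace := by
    rw [eq_sub_of_add_eq hanti, mul_sub, Matrix.trace_sub, trace_mul_superposition,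
      Matrix.sub_mulVec, dotProduct_sub, Matrix.one_mulVec, mul_smul_comm, mul_one,
      Matrix.trace_smul, ht, smul_eq_mul, mul_one]
  rw [h, ← mul_assoc, Matrix.trace_mul_comm, ← mul_assoc]
  exact (hρ.conjTranspose_mul_mul_same _).trace_nonneg

theorem trace_freeExp_pos (U : Matrix V V ℂ) (s : V → ℝ) : 0 < (freeExp U s).trace :=
  (freeExp_posDef U s).trace_pos

theorem trace_freeExp {U : Matrix V V ℂ} (hU : U ∈ Matrix.unitaryGroup V ℂ) (s : V → ℝ) :
    (freeExp U s).trace = ((∏ i, (1 + Real.exp (-s i)) : ℝ) : ℂ) := by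
  rw [freeExp_eq, (isCAR_rotatedMode hU).trace_exp_numberSum]
  congr 1
  rw [Fintype.card_finset, Finset.prod_div_distrib, Finset.prod_const, Finset.card_univ]
  push_cast
  field_simp

theorem transpose_mem_unitaryGroup {U : Matrix V V ℂ} (hU : U ∈ Matrix.unitaryGroup V ℂ) :
    Uᵀ ∈ Matrix.unitaryGroup V ℂ := by
  rw [Matrix.mem_unitaryGroup_iff, Matrix.star_eq_conjTranspose]
  have := congrArg Matrix.transpose (Matrix.mem_unitaryGroup_iff'.1 hU)
  rwa [Matrix.transpose_mul, Matrix.transpose_one, Matrix.star_eq_conjTranspose] at this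

/-- The correlation matrix of a free state is diagonal in the basis of its modes, with the
Fermi-Dirac occupation numbers. -/
theorem corrMatrix_normalizeTrace_freeExp {U : Matrix V V ℂ} (hU : U ∈ Matrix.unitaryGroup V ℂ)
    (s : V → ℝ) : corrMatrix (normalizeTrace (freeExp U s)) =
      Uᵀ * Matrix.diagonal (fun i => (((1 + Real.exp (s i))⁻¹ : ℝ) : ℂ)) * star Uᵀ := by
  have hP := transpose_mem_unitaryGroup hU
  have h : star Uᵀ * corrMatrix (normalizeTrace (freeExp U s)) * Uᵀ =
      Matrix.diagonal (fun i => (((1 + Real.exp (s i))⁻¹ : ℝ) : ℂ)) := by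
    ext i l
    have hne := (trace_freeExp_pos U s).ne'
    have ht := (isCAR_rotatedMode hU).trace_exp_numberSum_mul s i l
    rw [star_transpose_mul_mul_transpose_apply, ← trace_mul_superposition]
    change (normalizeTrace (freeExp U s) * ((rotatedMode U i)ᴴ * rotatedMode U l)).trace = _
    rw [normalizeTrace, smul_mul_assoc, Matrix.trace_smul, smul_eq_mul, freeExp_eq, ht,
      ← freeExp_eq, Matrix.diagonal_apply]
    split_ifs
    · field_simp
    · simp
  rw [← h]
  have h1 := Matrix.mem_unitaryGroup_iff.1 hP
  calc corrMatrix (normalizeTrace (freeExp U s))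
      = (Uᵀ * star Uᵀ) * corrMatrix (normalizeTrace (freeExp U s)) * (Uᵀ * star Uᵀ) := by
        rw [h1, one_mul, mul_one]
    _ = _ := by simp only [mul_assoc]

theorem normalizeTrace_freeExp_posDef (U : Matrix V V ℂ) (s : V → ℝ) :
    (normalizeTrace (freeExp U s)).PosDef :=
  (freeExp_posDef U s).smul (RCLike.inv_pos_of_pos (trace_freeExp_pos U s))

/-- The logarithms of a free state and of its correlation matrix have the same expectation value in
every state, so that the two sides of the free-fermion formula have the same linear part. -/
theorem trace_mul_matLog_freeExp {U : Matrix V V ℂ} (hU : U ∈ Matrix.unitaryGroup V ℂ)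
    (s : V → ℝ) {σ : FockOp V} (hσ : σ.trace = 1) :
    (σ * matLog (normalizeTrace (freeExp U s))).trace =
      ((1 - corrMatrix σ) * matLog (1 - corrMatrix (normalizeTrace (freeExp U s))) +
        corrMatrix σ * matLog (corrMatrix (normalizeTrace (freeExp U s)))).trace := by
  have hP := transpose_mem_unitaryGroup hU
  set P := Uᵀ with hPdef
  have hPP : P * star P = 1 := Matrix.mem_unitaryGroup_iff.1 hP
  have hPP' : star P * P = 1 := Matrix.mem_unitaryGroup_iff'.1 hP
  set m : V → ℝ := fun i => (1 + Real.exp (s i))⁻¹ with hm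
  have hm0 : ∀ i, 0 < m i := fun i => by positivity
  have hm1e : ∀ i, 1 - m i = (1 + Real.exp (-s i))⁻¹ := fun i => by
    have := Real.exp_pos (s i)
    simp only [hm, Real.exp_neg]
    field_simp
    ring
  have hm1 : ∀ i, 0 < 1 - m i := fun i => by rw [hm1e]; positivity
  have hlogm : ∀ i, Real.log (m i) = -s i + Real.log (1 - m i) := fun i => by
    have : m i = Real.exp (-s i) * (1 - m i) := by
      rw [hm1e]
      have := Real.exp_pos (s i)
      simp only [hm, Real.exp_neg]
      field_simp
      ring
    conv_lhs => rw [this]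
    rw [Real.log_mul (Real.exp_pos _).ne' (hm1 i).ne', Real.log_exp]
  have hcorr := corrMatrix_normalizeTrace_freeExp hU s
  have hcorr1 : 1 - corrMatrix (normalizeTrace (freeExp U s)) =
      P * Matrix.diagonal (fun i => ((1 - m i : ℝ) : ℂ)) * star P := by
    have hd : Matrix.diagonal (fun i => ((1 - m i : ℝ) : ℂ)) =
        1 - Matrix.diagonal (fun i => ((m i : ℝ) : ℂ)) := by
      rw [← Matrix.diagonal_one, Matrix.diagonal_sub]
      congr 1; ext i; push_cast; rfl
    rw [hcorr, hd, mul_sub, sub_mul, mul_one, hPP]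
  have hL1 := matLog_conj_diagonal hP hm1
  have hL0 := matLog_conj_diagonal hP hm0
  have hsplit : P * Matrix.diagonal (fun i => (Real.log (m i) : ℂ)) * star P =
      P * Matrix.diagonal (fun i => (Real.log (1 - m i) : ℂ)) * star P -
      P * Matrix.diagonal (fun i => (s i : ℂ)) * star P := by
    rw [← sub_mul, ← mul_sub, Matrix.diagonal_sub]
    congr 3; ext i; rw [hlogm]; push_cast; ring
  have hrhs : ((1 - corrMatrix σ) * matLog (1 - corrMatrix (normalizeTrace (freeExp U s))) +
        corrMatrix σ * matLog (corrMatrix (normalizeTrace (freeExp U s)))).trace =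
      ∑ i, (Real.log (1 - m i) : ℂ) -
        ∑ i, (s i : ℂ) * (σ * ((rotatedMode U i)ᴴ * rotatedMode U i)).trace := by
    rw [hcorr1, hcorr, hL1, hL0, hsplit]
    set L := P * Matrix.diagonal (fun i => (Real.log (1 - m i) : ℂ)) * star P with hL
    have e1 : ((1 - corrMatrix σ) * L + corrMatrix σ *
        (L - P * Matrix.diagonal (fun i => (s i : ℂ)) * star P)) =
        L - corrMatrix σ * (P * Matrix.diagonal (fun i => (s i : ℂ)) * star P) := by
      noncomm_ring
    rw [e1, Matrix.trace_sub]
    congr 1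
    · rw [hL, Matrix.trace_mul_comm, ← mul_assoc, hPP', one_mul, Matrix.trace_diagonal]
    · rw [← mul_assoc, Matrix.trace_mul_comm, ← mul_assoc, ← mul_assoc, Matrix.trace]
      refine Finset.sum_congr rfl fun i _ => ?_
      rw [Matrix.diag_apply, Matrix.mul_diagonal, mul_comm, hPdef,
        star_transpose_mul_mul_transpose_apply, ← trace_mul_superposition]
      rfl
  set Z : ℝ := ∏ i, (1 + Real.exp (-s i)) with hZ
  have hZpos : 0 < Z := Finset.prod_pos fun i _ => by positivity
  have hH : (numberSum (rotatedMode U) s +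
      ((-Real.log Z : ℝ) : ℂ) • (1 : FockOp V)).IsHermitian := by
    refine (numberSum_isHermitian _ _).add ?_
    rw [Matrix.IsHermitian, Matrix.conjTranspose_smul, Matrix.conjTranspose_one]
    simp
  have hσ0 : normalizeTrace (freeExp U s) =
      NormedSpace.exp (numberSum (rotatedMode U) s + ((-Real.log Z : ℝ) : ℂ) • (1 : FockOp V)) := by
    rw [Matrix.exp_add_of_commute _ _ ((Commute.one_right _).smul_right _), ← freeExp_eq,
      normalizeTrace, trace_freeExp hU, ← hZ]
    have : NormedSpace.exp (((-Real.log Z : ℝ) : ℂ) • (1 : FockOp V)) = ((Z : ℂ)⁻¹) • 1 := by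
      rw [← Matrix.diagonal_one, ← Matrix.diagonal_smul, Matrix.exp_diagonal,
        ← Matrix.diagonal_smul]
      congr 1; ext S
      rw [Pi.coe_exp, ← Complex.exp_eq_exp_ℂ]
      simp only [Pi.smul_apply, smul_eq_mul, mul_one]
      rw [← Complex.ofReal_exp, Real.exp_neg, Real.exp_log hZpos]
      push_cast; rfl
    rw [this, mul_smul_comm, mul_one]
  rw [hrhs, hσ0, matLog_exp hH, mul_add, Matrix.trace_add, mul_smul_comm, mul_one,
    Matrix.trace_smul, hσ, smul_eq_mul, mul_one, numberSum, mul_neg, Matrix.trace_neg,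
    Finset.mul_sum, Matrix.trace_sum]
  have hlogZ : -Real.log Z = ∑ i, Real.log (1 - m i) := by
    rw [hZ, Real.log_prod (fun i _ => by positivity), ← Finset.sum_neg_distrib]
    refine Finset.sum_congr rfl fun i _ => ?_
    rw [hm1e, Real.log_inv]
  rw [hlogZ]
  simp only [mul_smul_comm, Matrix.trace_smul, smul_eq_mul]
  push_cast
  ring

theorem corrMatrix_sub_apply (σ τ : FockOp V) (i j : V) :
    (corrMatrix σ - corrMatrix τ) i j = ((σ - τ) * hop (i, j)).trace := by
  rw [Matrix.sub_apply, corrMatrix, corrMatrix, Matrix.of_apply, Matrix.of_apply, sub_mul,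
    Matrix.trace_sub]

/-- Both sides of the free-fermion formula agree up to second order in the distance from a free
state `σ₀`: their difference is, by the agreement of the linear parts, a combination of the relative
entropies of `σ` and `σ₀`, of their correlation matrices `M` and `M₀`, and of `1 - M` and
`1 - M₀`. -/
theorem exists_entropy_bound {U : Matrix V V ℂ} (hU : U ∈ Matrix.unitaryGroup V ℂ) (s : V → ℝ) :
    ∃ C : ℝ, 0 ≤ C ∧ ∀ (σ : FockOp V) (r : ℝ), σ.PosSemidef → σ.trace = 1 →
      (∀ S S', ‖(σ - normalizeTrace (freeExp U s)) S S'‖ ≤ r) →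
      |vnEntropy σ - freeFermionEntropy (corrMatrix σ)| ≤ C * r ^ 2 := by
  set σ₀ := normalizeTrace (freeExp U s) with hσ₀
  have hP := transpose_mem_unitaryGroup hU
  have hpd0 : (corrMatrix σ₀).PosDef := by
    rw [corrMatrix_normalizeTrace_freeExp hU s]
    exact conj_diagonal_posDef hP fun i => by positivity
  have hpd1 : (1 - corrMatrix σ₀).PosDef := by
    have hPP : Uᵀ * star Uᵀ = 1 := Matrix.mem_unitaryGroup_iff.1 hP
    have hd : 1 - corrMatrix σ₀ =
        Uᵀ * Matrix.diagonal (fun i => ((1 - (1 + Real.exp (s i))⁻¹ : ℝ) : ℂ)) * star Uᵀ := by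
      have hd : Matrix.diagonal (fun i => ((1 - (1 + Real.exp (s i))⁻¹ : ℝ) : ℂ)) =
          1 - Matrix.diagonal (fun i => (((1 + Real.exp (s i))⁻¹ : ℝ) : ℂ)) := by
        rw [← Matrix.diagonal_one, Matrix.diagonal_sub]
        congr 1; ext i; push_cast; rfl
      rw [corrMatrix_normalizeTrace_freeExp hU s, hd, mul_sub, sub_mul, mul_one, hPP]
    rw [hd]
    refine conj_diagonal_posDef hP fun i => sub_pos.2 (inv_lt_one_of_one_lt₀ ?_)
    linarith [Real.exp_pos (s i)]
  obtain ⟨c₁, hc₁, h₁⟩ := exists_relative_entropy_bound (normalizeTrace_freeExp_posDef U s)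
  obtain ⟨c₂, hc₂, h₂⟩ := exists_relative_entropy_bound hpd0
  obtain ⟨c₃, hc₃, h₃⟩ := exists_relative_entropy_bound hpd1
  set κ : ℝ := ∑ p : V × V, ∑ S : Finset V, ∑ S' : Finset V, ‖hop p S' S‖ with hκ
  have hκ0 : 0 ≤ κ := by positivity
  set N : ℝ := (Fintype.card (Finset V) : ℝ) ^ 2
  set N' : ℝ := (Fintype.card V : ℝ) ^ 2
  refine ⟨c₁ * N + (c₂ + c₃) * (N' * κ ^ 2), by positivity, fun σ r hσ ht hr => ?_⟩
  have hr0 : 0 ≤ r := (norm_nonneg _).trans (hr ∅ ∅)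
  have hM : ∀ i j, ‖(corrMatrix σ - corrMatrix σ₀) i j‖ ≤ κ * r := by
    intro i j
    rw [corrMatrix_sub_apply, Matrix.trace]
    calc ‖∑ S, ((σ - σ₀) * hop (i, j)) S S‖
        ≤ ∑ S, ∑ S', ‖hop (i, j) S' S‖ * r := by
          refine norm_sum_le_of_le _ fun S _ => ?_
          rw [Matrix.mul_apply]
          refine norm_sum_le_of_le _ fun S' _ => ?_
          rw [norm_mul, mul_comm]
          exact mul_le_mul_of_nonneg_left (hr S S') (norm_nonneg _)
      _ = (∑ S, ∑ S', ‖hop (i, j) S' S‖) * r := by simp only [Finset.sum_mul]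
      _ ≤ κ * r := by
          refine mul_le_mul_of_nonneg_right ?_ hr0
          exact Finset.single_le_sum
            (f := fun p : V × V => ∑ S : Finset V, ∑ S' : Finset V, ‖hop p S' S‖)
            (fun p _ => by positivity) (Finset.mem_univ (i, j))
  have hsum : ∀ {n : Type _} [Fintype n] (D : Matrix n n ℂ) (q : ℝ), (∀ i j, ‖D i j‖ ≤ q) →
      ∑ i, ∑ j, ‖D i j‖ ^ 2 ≤ (Fintype.card n : ℝ) ^ 2 * q ^ 2 := by
    intro n _ D q hD
    calc ∑ i, ∑ j, ‖D i j‖ ^ 2 ≤ ∑ _i : n, ∑ _j : n, q ^ 2 :=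
          Finset.sum_le_sum fun i _ => Finset.sum_le_sum fun j _ =>
            pow_le_pow_left₀ (norm_nonneg _) (hD i j) 2
      _ = _ := by simp; ring
  have b₁ := (h₁ σ hσ).trans (mul_le_mul_of_nonneg_left (hsum _ r hr) hc₁)
  have b₂ := (h₂ _ (corrMatrix_posSemidef hσ)).trans
    (mul_le_mul_of_nonneg_left (hsum _ (κ * r) hM) hc₂)
  have b₃ := (h₃ _ (one_sub_corrMatrix_posSemidef hσ ht)).trans
    (mul_le_mul_of_nonneg_left (hsum _ (κ * r) fun i j => by
      rw [sub_sub_sub_cancel_left, ← neg_sub, Matrix.neg_apply, norm_neg]; exact hM i j) hc₃)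
  have hlin := congrArg Complex.re (trace_mul_matLog_freeExp hU s ht)
  rw [← hσ₀, Matrix.trace_add, Complex.add_re] at hlin
  have ht0 : σ₀.trace = 1 := by
    rw [hσ₀, normalizeTrace, Matrix.trace_smul, smul_eq_mul,
      inv_mul_cancel₀ (trace_freeExp_pos U s).ne']
  rw [Matrix.trace_sub, ht, ht0, sub_self, Complex.zero_re, sub_zero] at b₁
  -- the trace differences in the bounds for `M` and for `1 - M` cancel each other
  rw [Matrix.trace_sub, Complex.sub_re] at b₂
  rw [sub_sub_sub_cancel_left, Matrix.trace_sub, Complex.sub_re] at b₃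
  rw [vnEntropy, freeFermionEntropy, Matrix.trace_add, Complex.add_re]
  rw [abs_le] at b₁ b₂ b₃ ⊢
  constructor <;> nlinarith [b₁.1, b₁.2, b₂.1, b₂.2, b₃.1, b₃.2]

end Formula

/-! ### Gaussian averages of quadratic polynomials -/

section Gaussian

open MeasureTheory

theorem integrable_pow_mul_exp_neg_sq_div {η : ℝ} (hη : 0 < η) (m : ℕ) :
    Integrable fun x : ℝ => x ^ m * Real.exp (-x ^ 2 / η) := by
  have h := integrable_rpow_mul_exp_neg_mul_sq (inv_pos.2 hη) (s := m)
    (lt_of_lt_of_le (by norm_num) (Nat.cast_nonneg m))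
  refine h.congr (Filter.Eventually.of_forall fun x => ?_)
  simp only [Real.rpow_natCast]
  congr 2
  field_simp

theorem integral_mul_exp_neg_sq_div (η : ℝ) : ∫ x : ℝ, x * Real.exp (-x ^ 2 / η) = 0 := by
  have h := integral_neg_eq_self (fun x : ℝ => x * Real.exp (-x ^ 2 / η)) volume
  simp only [neg_mul, even_two, Even.neg_pow, integral_neg] at h
  linarith

theorem integral_sq_mul_exp_neg_sq_div {η : ℝ} (hη : 0 < η) :
    ∫ x : ℝ, x ^ 2 * Real.exp (-x ^ 2 / η) = η / 2 * ∫ x : ℝ, Real.exp (-x ^ 2 / η) := by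
  have hv : ∀ x : ℝ, HasDerivAt (fun x => -(η / 2) * Real.exp (-x ^ 2 / η))
      (x * Real.exp (-x ^ 2 / η)) x := by
    intro x
    have h1 : HasDerivAt (fun x : ℝ => -x ^ 2 / η) (-(2 * x) / η) x := by
      simpa using ((hasDerivAt_pow 2 x).fun_neg.div_const η)
    refine (h1.exp.const_mul (-(η / 2))).congr_deriv ?_
    field_simp
  have i0 : Integrable fun x : ℝ => Real.exp (-x ^ 2 / η) := by
    simpa using integrable_pow_mul_exp_neg_sq_div hη 0
  have i1 : Integrable fun x : ℝ => x * Real.exp (-x ^ 2 / η) := by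
    simpa using integrable_pow_mul_exp_neg_sq_div hη 1
  have i2 := integrable_pow_mul_exp_neg_sq_div hη 2
  have h := integral_mul_deriv_eq_deriv_mul_of_integrable (u := fun x : ℝ => x) (u' := fun _ => 1)
    (v := fun x => -(η / 2) * Real.exp (-x ^ 2 / η)) (v' := fun x => x * Real.exp (-x ^ 2 / η))
    (fun x _ => hasDerivAt_id x) (fun x _ => hv x)
    (i2.congr (Filter.Eventually.of_forall fun x => by simp only [Pi.mul_apply]; ring))
    ((i0.const_mul (-(η / 2))).congr (Filter.Eventually.of_forall fun x => by simp))
    ((i1.const_mul (-(η / 2))).congr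
      (Filter.Eventually.of_forall fun x => by simp only [Pi.mul_apply]; ring))
  have e : (fun x : ℝ => x ^ 2 * Real.exp (-x ^ 2 / η)) =
      fun x => x * (x * Real.exp (-x ^ 2 / η)) := by ext x; ring
  rw [e, h]
  simp only [one_mul, integral_const_mul]
  ring

variable {L k : ℕ}

/-- The unnormalized Gaussian weight `exp (- |y|² / η)`, for which each coordinate has variance
`η / 2`. -/
def gaussianWeight (η : ℝ) (y : Fin L → Fin k → ℝ) : ℝ :=
  ∏ l, ∏ a, Real.exp (-y l a ^ 2 / η)

theorem integrable_prod_prod {f : Fin L → Fin k → ℝ → ℝ} (hf : ∀ l a, Integrable (f l a)) :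
    Integrable fun y : Fin L → Fin k → ℝ => ∏ l, ∏ a, f l a (y l a) :=
  Integrable.fintype_prod (f := fun l (v : Fin k → ℝ) => ∏ a, f l a (v a))
    fun l => Integrable.fintype_prod fun a => hf l a

theorem integral_prod_prod (f : Fin L → Fin k → ℝ → ℝ) :
    ∫ y : Fin L → Fin k → ℝ, ∏ l, ∏ a, f l a (y l a) = ∏ l, ∏ a, ∫ x, f l a x := by
  rw [integral_fintype_prod_volume_eq_prod (fun l (v : Fin k → ℝ) => ∏ a, f l a (v a))]
  refine Finset.prod_congr rfl fun l _ => ?_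
  rw [integral_fintype_prod_volume_eq_prod]

theorem prod_prod_ite {M : Type*} [CommMonoid M] (p : Fin L × Fin k) (c : M) :
    ∏ l, ∏ a, (if (l, a) = p then c else 1) = c := by
  rw [← Fintype.prod_prod_type' (f := fun l a => if (l, a) = p then c else 1)]
  simp

/-- A coordinate as a product over all coordinates, for the use of Fubini's theorem. -/
theorem prod_prod_ite_coord (p : Fin L × Fin k) (y : Fin L → Fin k → ℝ) :
    ∏ l, ∏ a, (if (l, a) = p then y l a else 1) = y p.1 p.2 := by
  rw [← prod_prod_ite p (y p.1 p.2)]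
  refine Finset.prod_congr rfl fun l _ => Finset.prod_congr rfl fun a _ => ?_
  split_ifs with hp
  · rw [← hp]
  · rfl

/-- The monomial `y_p y_q` against the Gaussian weight is a product of functions of one variable. -/
theorem mul_mul_gaussianWeight (η : ℝ) (p q : Fin L × Fin k) (y : Fin L → Fin k → ℝ) :
    y p.1 p.2 * y q.1 q.2 * gaussianWeight η y =
      ∏ l, ∏ a, (if (l, a) = p then y l a else 1) * (if (l, a) = q then y l a else 1) *
        Real.exp (-y l a ^ 2 / η) := by
  simp only [Finset.prod_mul_distrib, prod_prod_ite_coord, gaussianWeight]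

theorem mul_gaussianWeight (η : ℝ) (p : Fin L × Fin k) (y : Fin L → Fin k → ℝ) :
    y p.1 p.2 * gaussianWeight η y =
      ∏ l, ∏ a, (if (l, a) = p then y l a else 1) * Real.exp (-y l a ^ 2 / η) := by
  simp only [Finset.prod_mul_distrib, prod_prod_ite_coord, gaussianWeight]

theorem integrable_gaussianWeight {η : ℝ} (hη : 0 < η) :
    Integrable (gaussianWeight η : (Fin L → Fin k → ℝ) → ℝ) :=
  integrable_prod_prod (f := fun _ _ x => Real.exp (-x ^ 2 / η)) fun _ _ => by
    simpa using integrable_pow_mul_exp_neg_sq_div hη 0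

theorem integrable_mul_gaussianWeight {η : ℝ} (hη : 0 < η) (p : Fin L × Fin k) :
    Integrable fun y : Fin L → Fin k → ℝ => y p.1 p.2 * gaussianWeight η y := by
  simp only [mul_gaussianWeight]
  refine integrable_prod_prod
    (f := fun l a x => (if (l, a) = p then x else 1) * Real.exp (-x ^ 2 / η)) fun l a => ?_
  split_ifs
  · simpa using integrable_pow_mul_exp_neg_sq_div hη 1
  · simpa using integrable_pow_mul_exp_neg_sq_div hη 0

theorem integrable_mul_mul_gaussianWeight {η : ℝ} (hη : 0 < η) (p q : Fin L × Fin k) :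
    Integrable fun y : Fin L → Fin k → ℝ => y p.1 p.2 * y q.1 q.2 * gaussianWeight η y := by
  simp only [mul_mul_gaussianWeight]
  refine integrable_prod_prod
    (f := fun l a x => (if (l, a) = p then x else 1) * (if (l, a) = q then x else 1) *
      Real.exp (-x ^ 2 / η)) fun l a => ?_
  split_ifs
  · simpa [pow_two] using integrable_pow_mul_exp_neg_sq_div hη 2
  · simpa using integrable_pow_mul_exp_neg_sq_div hη 1
  · simpa using integrable_pow_mul_exp_neg_sq_div hη 1
  · simpa using integrable_pow_mul_exp_neg_sq_div hη 0

theorem integral_gaussianWeight (η : ℝ) :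
    ∫ y : Fin L → Fin k → ℝ, gaussianWeight η y =
      ∏ _l : Fin L, ∏ _a : Fin k, ∫ x : ℝ, Real.exp (-x ^ 2 / η) :=
  integral_prod_prod fun _ _ x => Real.exp (-x ^ 2 / η)

theorem integral_gaussianWeight_ne_zero {η : ℝ} (hη : 0 < η) :
    ∫ y : Fin L → Fin k → ℝ, gaussianWeight η y ≠ 0 := by
  rw [integral_gaussianWeight]
  refine Finset.prod_ne_zero_iff.2 fun _ _ => Finset.prod_ne_zero_iff.2 fun _ _ => ?_
  have : (fun x : ℝ => Real.exp (-x ^ 2 / η)) = fun x => Real.exp (-η⁻¹ * x ^ 2) := by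
    ext x; congr 1; field_simp
  rw [this, integral_gaussian]
  positivity

theorem integral_mul_gaussianWeight (η : ℝ) (p : Fin L × Fin k) :
    ∫ y : Fin L → Fin k → ℝ, y p.1 p.2 * gaussianWeight η y = 0 := by
  simp only [mul_gaussianWeight]
  rw [integral_prod_prod
    (f := fun l a x => (if (l, a) = p then x else 1) * Real.exp (-x ^ 2 / η))]
  refine Finset.prod_eq_zero (Finset.mem_univ p.1) (Finset.prod_eq_zero (Finset.mem_univ p.2) ?_)
  simp only [if_true]
  exact integral_mul_exp_neg_sq_div η

/-- The covariance of the Gaussian weight. -/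
theorem integral_mul_mul_gaussianWeight {η : ℝ} (hη : 0 < η) (p q : Fin L × Fin k) :
    ∫ y : Fin L → Fin k → ℝ, y p.1 p.2 * y q.1 q.2 * gaussianWeight η y =
      if p = q then η / 2 * ∫ y : Fin L → Fin k → ℝ, gaussianWeight η y else 0 := by
  simp only [mul_mul_gaussianWeight]
  rw [integral_prod_prod
    (f := fun l a x => (if (l, a) = p then x else 1) * (if (l, a) = q then x else 1) *
      Real.exp (-x ^ 2 / η))]
  split_ifs with hpq
  · subst hpq
    rw [integral_gaussianWeight]
    conv_rhs => rw [← prod_prod_ite p (η / 2), ← Finset.prod_mul_distrib]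
    refine Finset.prod_congr rfl fun l _ => ?_
    rw [← Finset.prod_mul_distrib]
    refine Finset.prod_congr rfl fun a _ => ?_
    split_ifs
    · simp only [← pow_two]
      exact integral_sq_mul_exp_neg_sq_div hη
    · simp
  · refine Finset.prod_eq_zero (Finset.mem_univ p.1) (Finset.prod_eq_zero (Finset.mem_univ p.2) ?_)
    simp only [if_true, if_neg hpq, mul_one]
    exact integral_mul_exp_neg_sq_div η

/-- The normalized Gaussian average of a quadratic polynomial: the linear part averages to zero, and
the quadratic one to `η / 2` times its trace. -/
theorem gaussian_average {η : ℝ} (hη : 0 < η) (c₀ : ℂ) (c₁ : Fin L × Fin k → ℂ)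
    (c₂ : Fin L × Fin k → Fin L × Fin k → ℂ) :
    (∫ y : Fin L → Fin k → ℝ, (gaussianWeight η y : ℂ) *
      (c₀ + ∑ p, c₁ p * y p.1 p.2 + ∑ p, ∑ q, c₂ p q * (y p.1 p.2 * y q.1 q.2))) /
      ∫ y : Fin L → Fin k → ℝ, (gaussianWeight η y : ℂ) = c₀ + η / 2 * ∑ p, c₂ p p := by
  have e : ∀ y : Fin L → Fin k → ℝ, (gaussianWeight η y : ℂ) *
      (c₀ + ∑ p, c₁ p * y p.1 p.2 + ∑ p, ∑ q, c₂ p q * (y p.1 p.2 * y q.1 q.2)) =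
      c₀ * (gaussianWeight η y : ℂ) + ∑ p, c₁ p * ((y p.1 p.2 * gaussianWeight η y : ℝ) : ℂ) +
        ∑ p, ∑ q, c₂ p q * ((y p.1 p.2 * y q.1 q.2 * gaussianWeight η y : ℝ) : ℂ) := by
    intro y
    simp only [mul_add, Finset.mul_sum]
    push_cast
    congr 1
    · congr 1
      · ring
      · exact Finset.sum_congr rfl fun p _ => by ring
    · exact Finset.sum_congr rfl fun p _ => Finset.sum_congr rfl fun q _ => by ring
  have i0 : Integrable fun y : Fin L → Fin k → ℝ => c₀ * (gaussianWeight η y : ℂ) :=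
    (integrable_gaussianWeight hη).ofReal.const_mul _
  have i1 : ∀ p, Integrable fun y : Fin L → Fin k → ℝ =>
      c₁ p * ((y p.1 p.2 * gaussianWeight η y : ℝ) : ℂ) := fun p =>
    (integrable_mul_gaussianWeight hη p).ofReal.const_mul _
  have i2 : ∀ p q, Integrable fun y : Fin L → Fin k → ℝ =>
      c₂ p q * ((y p.1 p.2 * y q.1 q.2 * gaussianWeight η y : ℝ) : ℂ) := fun p q =>
    (integrable_mul_mul_gaussianWeight hη p q).ofReal.const_mul _
  have i1s := integrable_finsetSum Finset.univ fun p _ => i1 p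
  have i2s := fun p => integrable_finsetSum Finset.univ fun q _ => i2 p q
  have i2ss := integrable_finsetSum Finset.univ fun p _ => i2s p
  have i01 : Integrable fun y : Fin L → Fin k → ℝ => c₀ * (gaussianWeight η y : ℂ) +
      ∑ p, c₁ p * ((y p.1 p.2 * gaussianWeight η y : ℝ) : ℂ) := i0.add i1s
  simp only [e]
  rw [integral_add i01 i2ss, integral_add i0 i1s, integral_finsetSum _ fun p _ => i1 p,
    integral_finsetSum _ fun p _ => i2s p]
  simp only [integral_finsetSum _ fun q _ => i2 _ q, integral_const_mul, integral_complex_ofReal,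
    integral_mul_gaussianWeight, integral_mul_mul_gaussianWeight hη]
  have hne : ((∫ y : Fin L → Fin k → ℝ, gaussianWeight η y : ℝ) : ℂ) ≠ 0 := by
    exact_mod_cast integral_gaussianWeight_ne_zero hη
  simp only [apply_ite Complex.ofReal, Complex.ofReal_zero, mul_zero, Finset.sum_const_zero,
    add_zero, mul_ite, Finset.sum_ite_eq, Finset.mem_univ, if_true, Complex.ofReal_mul,
    Complex.ofReal_div, Complex.ofReal_ofNat]
  rw [← Finset.sum_mul, add_div, mul_div_cancel_right₀ _ hne, mul_comm (∑ p, c₂ p p), mul_assoc,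
    mul_comm _ (∑ p, c₂ p p), ← mul_assoc, mul_div_cancel_right₀ _ hne]

end Gaussian

/-! ### Second-order expansion of the integrand -/

section Smooth

/-- The time-ordered exponential of matrices which depend affinely on the sources `ψ`. -/
def slicedExp {n α : Type*} [Fintype n] [DecidableEq n] [Fintype α] {L : ℕ}
    (A : Fin L → Matrix n n ℂ) (X : Fin L → α → Matrix n n ℂ) (ψ : Fin L → α → ℂ) :
    Matrix n n ℂ :=
  (List.ofFn fun l => NormedSpace.exp (A l + ∑ q, ψ l q • X l q)).prod

theorem ContDiff.list_prod_map {E 𝔸 : Type*} [NormedAddCommGroup E] [NormedSpace ℂ E]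
    [NormedRing 𝔸] [NormedAlgebra ℂ 𝔸] {m : WithTop ℕ∞} (fs : List (E → 𝔸))
    (h : ∀ f ∈ fs, ContDiff ℂ m f) : ContDiff ℂ m fun x => (fs.map fun f => f x).prod := by
  induction fs with
  | nil => simpa using contDiff_const
  | cons f fs ih =>
    simp only [List.map_cons, List.prod_cons]
    exact (h f (by simp)).mul (ih fun g hg => h g (by simp [hg]))

theorem contDiff_slicedExp_apply {n α : Type*} [Fintype n] [DecidableEq n] [Fintype α] {L : ℕ}
    (A : Fin L → Matrix n n ℂ) (X : Fin L → α → Matrix n n ℂ) (i j : n) :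
    ContDiff ℂ 2 fun ψ => slicedExp A X ψ i j := by
  let := Matrix.linftyOpNormedRing (n := n) (α := ℂ)
  let := Matrix.linftyOpNormedAlgebra (n := n) (R := ℂ) (α := ℂ)
  let fs : List ((Fin L → α → ℂ) → Matrix n n ℂ) :=
    List.ofFn fun l ψ => NormedSpace.exp (A l + ∑ q, ψ l q • X l q)
  have hfs : ∀ f ∈ fs, ContDiff ℂ 2 f := by
    intro f hf
    obtain ⟨l, rfl⟩ := List.mem_ofFn.1 hf
    have hexp : ContDiff ℂ 2 (NormedSpace.exp : Matrix n n ℂ → Matrix n n ℂ) :=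
      contDiff_iff_contDiffAt.2 fun x => (NormedSpace.exp_analytic (𝕂 := ℂ) x).contDiffAt
    refine hexp.comp (contDiff_const.add (ContDiff.sum fun q _ => ?_))
    exact (contDiff_apply_apply ℂ ℂ l q).smul (contDiff_const (c := X l q))
  have h := ContDiff.list_prod_map fs hfs
  have e : (fun ψ => slicedExp A X ψ) = fun ψ => (fs.map fun f => f ψ).prod := by
    ext1 ψ
    rw [slicedExp, List.map_ofFn]
    rfl
  let ev : Matrix n n ℂ →ₗ[ℂ] ℂ :=
    { toFun := fun M => M i j, map_add' := fun _ _ => rfl, map_smul' := fun _ _ => rfl }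
  have hev : ContDiff ℂ 2 ev := (LinearMap.toContinuousLinearMap ev).contDiff
  exact hev.comp (e ▸ h)

/-- The Taylor polynomial of order two along a real line, in terms of Fréchet derivatives. -/
theorem taylorTwo_line {E : Type*} [NormedAddCommGroup E] [NormedSpace ℂ E] {g : E → ℂ}
    (hg : ContDiff ℂ 2 g) (φ : E) :
    taylorTwo (fun x : ℝ => g ((x : ℂ) • φ)) =
      g 0 + fderiv ℂ g 0 φ + fderiv ℂ (fderiv ℂ g) 0 φ φ / 2 := by
  have hline : ∀ x : ℝ, HasDerivAt (fun x : ℝ => (x : ℂ) • φ) φ x := by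
    intro x
    simpa using (Complex.ofRealCLM.hasDerivAt (x := x)).smul_const φ
  have h1 : ∀ x : ℝ, HasDerivAt (fun x : ℝ => g ((x : ℂ) • φ)) (fderiv ℂ g ((x : ℂ) • φ) φ) x := by
    intro x
    have hd := (hg.differentiable (by norm_num)).differentiableAt (x := (x : ℂ) • φ)
    exact (hd.hasFDerivAt.restrictScalars ℝ).comp_hasDerivAt x (hline x)
  have hg1 : ContDiff ℂ 1 (fderiv ℂ g) := hg.fderiv_right (by norm_num)
  have h2 : ∀ x : ℝ, HasDerivAt (fun x : ℝ => fderiv ℂ g ((x : ℂ) • φ) φ)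
      (fderiv ℂ (fderiv ℂ g) ((x : ℂ) • φ) φ φ) x := by
    intro x
    have hd := (hg1.differentiable (by norm_num)).differentiableAt (x := (x : ℂ) • φ)
    have hc := (hd.hasFDerivAt.clm_apply (hasFDerivAt_const φ ((x : ℂ) • φ))).restrictScalars ℝ
    refine (hc.comp_hasDerivAt x (hline x)).congr_deriv ?_
    simp
  have hd1 : deriv (fun x : ℝ => g ((x : ℂ) • φ)) = fun x : ℝ => fderiv ℂ g ((x : ℂ) • φ) φ :=
    funext fun x => (h1 x).deriv
  rw [taylorTwo, iteratedDeriv_succ, iteratedDeriv_one, hd1, (h2 0).deriv]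
  simp

theorem bilinear_sum_smul {E ι : Type*} [NormedAddCommGroup E] [NormedSpace ℂ E] [Fintype ι]
    (H : E →L[ℂ] E →L[ℂ] ℂ) (c : ι → ℂ) (e : ι → E) :
    H (∑ p, c p • e p) (∑ q, c q • e q) = ∑ p, ∑ q, (c p * c q) * H (e p) (e q) := by
  have h : H (∑ p, c p • e p) = ∑ p, c p • H (e p) := by simp only [map_sum, map_smul]
  rw [h]
  simp only [map_sum, map_smul, smul_eq_mul, sum_apply, smul_apply,
    Finset.mul_sum]
  rw [Finset.sum_comm]
  exact Finset.sum_congr rfl fun p _ => Finset.sum_congr rfl fun q _ => by ring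

end Smooth

section Decoupling

theorem exp_sub_smul_one {n : Type*} [Fintype n] [DecidableEq n] (B : Matrix n n ℂ) (c : ℂ) :
    NormedSpace.exp (B - c • 1) = Complex.exp (-c) • NormedSpace.exp B := by
  rw [sub_eq_add_neg, ← neg_smul, Matrix.exp_add_of_commute _ _
    ((Commute.one_right _).smul_right _)]
  have : NormedSpace.exp ((-c) • (1 : Matrix n n ℂ)) = Complex.exp (-c) • 1 := by
    rw [← Matrix.diagonal_one, ← Matrix.diagonal_smul, Matrix.exp_diagonal,
      ← Matrix.diagonal_smul]
    congr 1; ext S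
    rw [Pi.coe_exp, ← Complex.exp_eq_exp_ℂ]
    simp
  rw [this, mul_smul_comm, mul_one]

theorem prod_ofFn_smul {n : Type*} [Fintype n] [DecidableEq n] {L : ℕ} (c : Fin L → ℂ)
    (F : Fin L → Matrix n n ℂ) :
    (List.ofFn fun l => c l • F l).prod = (∏ l, c l) • (List.ofFn F).prod := by
  induction L with
  | zero => simp
  | succ L ih =>
    rw [List.ofFn_succ, List.prod_cons, ih, List.ofFn_succ, List.prod_cons, Fin.prod_univ_succ,
      smul_mul_smul_comm]

variable {V : Type*} (Q : QuarticSystem V)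

namespace QuarticSystem

/-- The symmetric coupling matrix of one slice of the bosonic field. -/
def coupling (w : ℂ) (L : ℕ) : Matrix (V × V) (V × V) ℂ := (w / L / 2) • (Q.lam + Q.lamᵀ)

theorem coupling_comm (w : ℂ) (L : ℕ) (p q : V × V) :
    Q.coupling w L p q = Q.coupling w L q p := by
  simp [coupling, add_comm]

variable [Fintype V]

theorem bosonAction_eq (w : ℂ) {L : ℕ} (φ : Fin L → V × V → ℂ) :
    Q.bosonAction w φ = ∑ l, φ l ⬝ᵥ (Q.coupling w L *ᵥ φ l) := by
  rw [bosonAction, Finset.mul_sum]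
  refine Finset.sum_congr rfl fun l _ => ?_
  have h : ∑ p, ∑ q, Q.lam p q * φ l p * φ l q = ∑ p, ∑ q, Q.lam q p * φ l p * φ l q := by
    rw [Finset.sum_comm]
    exact Finset.sum_congr rfl fun p _ => Finset.sum_congr rfl fun q _ => by ring
  have h2 : φ l ⬝ᵥ (Q.coupling w L *ᵥ φ l) = w / L / 2 *
      (∑ p, ∑ q, Q.lam p q * φ l p * φ l q + ∑ p, ∑ q, Q.lam q p * φ l p * φ l q) := by
    simp only [dotProduct, Matrix.mulVec, coupling, Matrix.smul_apply, Matrix.add_apply,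
      Matrix.transpose_apply, smul_eq_mul, ← Finset.sum_add_distrib, Finset.mul_sum]
    exact Finset.sum_congr rfl fun p _ => Finset.sum_congr rfl fun q _ => by ring
  rw [h2, ← h]
  ring

theorem IsContour.transpose_mul_coupling_mul {Q : QuarticSystem V} {w : ℂ} {L k : ℕ}
    {T : Matrix (V × V) (Fin k) ℂ} (hT : Q.IsContour w L T) : Tᵀ * Q.coupling w L * T = 1 := hT.1

theorem IsContour.coupling_mul_mul_coupling {Q : QuarticSystem V} {w : ℂ} {L k : ℕ}
    {T : Matrix (V × V) (Fin k) ℂ} (hT : Q.IsContour w L T) :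
    Q.coupling w L * (T * Tᵀ) * Q.coupling w L = Q.coupling w L := hT.2

/-- On the contour the weight of the boson is `exp (- |y|²)`. -/
theorem IsContour.bosonAction_contourField {Q : QuarticSystem V} {w : ℂ} {L k : ℕ}
    {T : Matrix (V × V) (Fin k) ℂ} (hT : Q.IsContour w L T) (y : Fin L → Fin k → ℝ) :
    Q.bosonAction w (contourField T y) = ((∑ l, ∑ a, y l a ^ 2 : ℝ) : ℂ) := by
  rw [bosonAction_eq]
  push_cast
  refine Finset.sum_congr rfl fun l _ => ?_
  rw [contourField, Matrix.mulVec_mulVec, ← Matrix.vecMul_transpose, ← Matrix.dotProduct_mulVec,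
    Matrix.mulVec_mulVec, ← Matrix.mul_assoc, hT.transpose_mul_coupling_mul, Matrix.one_mulVec,
    dotProduct]
  exact Finset.sum_congr rfl fun a _ => by ring

variable [LinearOrder V]

/-- The decoupled operator at a shifted field: apart from the quadratic term of the boson, it
depends on the shift only through its image under the coupling matrix. -/
theorem smul_decoupled_add (w : ℂ) (L : ℕ) (φ₀ φ : V × V → ℂ) :
    -(w / L) • Q.decoupled (φ₀ + φ) = -(w / L) • Q.decoupled φ₀ +
      ∑ q, (Q.coupling w L *ᵥ φ) q • ((2 : ℂ) • (hop q - φ₀ q • (1 : FockOp V))) -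
      (φ ⬝ᵥ (Q.coupling w L *ᵥ φ)) • 1 := by
  have hsrc : ∑ q, (Q.coupling w L *ᵥ φ) q • ((2 : ℂ) • (hop q - φ₀ q • (1 : FockOp V))) =
      (w / L) • ((∑ p, ∑ q, Q.lam p q • φ p • (hop q - φ₀ q • (1 : FockOp V))) +
        ∑ p, ∑ q, Q.lam p q • φ q • (hop p - φ₀ p • (1 : FockOp V))) := by
    rw [Finset.sum_comm (s := Finset.univ) (t := Finset.univ)
      (f := fun p q => Q.lam p q • φ p • (hop q - φ₀ q • (1 : FockOp V))),
      ← Finset.sum_add_distrib, Finset.smul_sum]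
    refine Finset.sum_congr rfl fun q _ => ?_
    rw [← Finset.sum_add_distrib, Finset.smul_sum]
    simp only [smul_smul, ← add_smul, ← Finset.sum_smul]
    congr 1
    simp only [Matrix.mulVec, dotProduct, coupling, Matrix.smul_apply, Matrix.add_apply,
      Matrix.transpose_apply, smul_eq_mul, Finset.sum_mul]
    exact Finset.sum_congr rfl fun p _ => by ring
  have hquad : φ ⬝ᵥ (Q.coupling w L *ᵥ φ) = (w / L) * ∑ p, ∑ q, Q.lam p q * (φ p * φ q) := by
    have := Q.bosonAction_eq (w / L) (L := 1) fun _ => φ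
    simp only [bosonAction, Finset.univ_unique, Finset.sum_singleton, Nat.cast_one, div_one]
      at this
    have hc : Q.coupling (w / L) 1 = Q.coupling w L := by simp [coupling]
    rw [← hc, ← this]
    simp only [mul_assoc]
  have hmain : Q.decoupled (φ₀ + φ) = Q.decoupled φ₀ -
      ((∑ p, ∑ q, Q.lam p q • φ p • (hop q - φ₀ q • (1 : FockOp V))) +
        ∑ p, ∑ q, Q.lam p q • φ q • (hop p - φ₀ p • (1 : FockOp V))) +
      (∑ p, ∑ q, Q.lam p q * (φ p * φ q)) • 1 := by
    simp only [decoupled, Finset.sum_smul]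
    rw [sub_sub, sub_add, sub_right_inj]
    rw [← Finset.sum_add_distrib, ← Finset.sum_add_distrib, ← Finset.sum_sub_distrib]
    refine Finset.sum_congr rfl fun p _ => ?_
    rw [← Finset.sum_add_distrib, ← Finset.sum_add_distrib, ← Finset.sum_sub_distrib]
    refine Finset.sum_congr rfl fun q _ => ?_
    simp only [Pi.add_apply]
    module
  rw [hsrc, hquad, hmain]
  module

/-- The fermionic factor of the integrand, relative to the weight of the boson, depends on the
fluctuation only through its image under the coupling matrix. -/
theorem exp_bosonAction_smul_hsIntegrand (w : ℂ) {L : ℕ} (φ₀ φ : Fin L → V × V → ℂ) :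
    Complex.exp (Q.bosonAction w φ) • Q.hsIntegrand w (φ₀ + φ) =
      slicedExp (fun l => -(w / L) • Q.decoupled (φ₀ l))
        (fun l q => (2 : ℂ) • (hop q - φ₀ l q • (1 : FockOp V)))
        (fun l => Q.coupling w L *ᵥ φ l) := by
  have h : ∀ l, NormedSpace.exp (-(w / L) • Q.decoupled ((φ₀ + φ) l)) =
      Complex.exp (-(φ l ⬝ᵥ (Q.coupling w L *ᵥ φ l))) • NormedSpace.exp
        (-(w / L) • Q.decoupled (φ₀ l) + ∑ q, (Q.coupling w L *ᵥ φ l) q •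
          ((2 : ℂ) • (hop q - φ₀ l q • (1 : FockOp V)))) := fun l => by
    rw [Pi.add_apply, smul_decoupled_add, exp_sub_smul_one]
  rw [hsIntegrand]
  simp only [h]
  rw [prod_ofFn_smul, ← Complex.exp_sum, Finset.sum_neg_distrib, ← bosonAction_eq, smul_smul,
    ← Complex.exp_add, add_neg_cancel, Complex.exp_zero, one_smul]
  rfl

/-- The second derivative of the fermionic factor with respect to the sources of two channels in
one time slice. -/
def sourceHessian (w : ℂ) {L : ℕ} (φ₀ : Fin L → V × V → ℂ) (l : Fin L) (p q : V × V)
    (S S' : Finset V) : ℂ :=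
  fderiv ℂ (fderiv ℂ fun ψ => slicedExp (fun l => -(w / L) • Q.decoupled (φ₀ l))
        (fun l q => (2 : ℂ) • (hop q - φ₀ l q • (1 : FockOp V))) ψ S S') 0
    (Pi.single l (Pi.single p 1)) (Pi.single l (Pi.single q 1))

/-- The integral over the Gaussian fluctuations is the saddle point operator plus a correction of
first order in the strength, in which the contour enters only through the covariance of the sources,
that is, through the coupling matrix. -/
theorem IsContour.gaussianIntegral_apply {Q : QuarticSystem V} {w : ℂ} {L k : ℕ}
    {T : Matrix (V × V) (Fin k) ℂ} (hT : Q.IsContour w L T) (φ₀ : Fin L → V × V → ℂ) {η : ℝ}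
    (hη : 0 < η) (S S' : Finset V) :
    Q.gaussianIntegral w T φ₀ η S S' = Q.hsIntegrand w φ₀ S S' +
      η * ((1 / 4) * ∑ l, ∑ p, ∑ q, Q.coupling w L p q * Q.sourceHessian w φ₀ l p q S S') := by
  set Λ := Q.coupling w L with hΛ
  set g : (Fin L → V × V → ℂ) → ℂ := fun ψ =>
    slicedExp (fun l => -(w / L) • Q.decoupled (φ₀ l))
        (fun l q => (2 : ℂ) • (hop q - φ₀ l q • (1 : FockOp V))) ψ S S' with hgdef
  have hg : ContDiff ℂ 2 g := contDiff_slicedExp_apply _ _ S S'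
  set D := fderiv ℂ g 0
  set H := fderiv ℂ (fderiv ℂ g) 0
  -- the sources that belong to the coordinate directions of the contour
  let e : Fin L × Fin k → Fin L → V × V → ℂ := fun p => Pi.single p.1 ((Λ * T).col p.2)
  have hsrc : ∀ y : Fin L → Fin k → ℝ, (fun l => Λ *ᵥ contourField T y l) =
      ∑ p, ((y p.1 p.2 : ℝ) : ℂ) • e p := by
    intro y
    ext l q
    simp only [e, contourField, Matrix.mulVec_mulVec, Finset.sum_apply, Pi.smul_apply,
      Fintype.sum_prod_type, smul_eq_mul]
    rw [Finset.sum_eq_single l]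
    · simp only [Pi.single_eq_same, Matrix.mulVec, dotProduct, Matrix.col_apply]
      exact Finset.sum_congr rfl fun a _ => by ring
    · intro l' _ hl'
      refine Finset.sum_eq_zero fun a _ => ?_
      rw [Pi.single_eq_of_ne hl'.symm]
      simp
    · simp
  have hferm : ∀ (y : Fin L → Fin k → ℝ) (x : ℝ),
      (Complex.exp (Q.bosonAction w (x • contourField T y)) •
        Q.hsIntegrand w (φ₀ + x • contourField T y)) S S' =
      g ((x : ℂ) • ∑ p, ((y p.1 p.2 : ℝ) : ℂ) • e p) := by
    intro y x
    rw [exp_bosonAction_smul_hsIntegrand, ← hsrc, hgdef]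
    congr 2
    ext l q
    have : (x • contourField T y) l = (x : ℂ) • contourField T y l := by
      ext q; simp
    rw [this, Matrix.mulVec_smul]
    rfl
  have htay : ∀ y : Fin L → Fin k → ℝ,
      taylorTwo (fun x => (Complex.exp (Q.bosonAction w (x • contourField T y)) •
        Q.hsIntegrand w (φ₀ + x • contourField T y)) S S') =
      g 0 + ∑ p, D (e p) * (y p.1 p.2 : ℝ) +
        ∑ p, ∑ q, (H (e p) (e q) / 2) * ((y p.1 p.2 : ℝ) * (y q.1 q.2 : ℝ)) := by
    intro y
    simp only [hferm]
    rw [taylorTwo_line hg]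
    congr 1
    · congr 1
      rw [map_sum]
      exact Finset.sum_congr rfl fun p _ => by rw [map_smul, smul_eq_mul, mul_comm]
    · rw [bilinear_sum_smul, Finset.sum_div]
      refine Finset.sum_congr rfl fun p _ => ?_
      rw [Finset.sum_div]
      exact Finset.sum_congr rfl fun q _ => by ring
  have hweight : ∀ y : Fin L → Fin k → ℝ,
      Complex.exp (-Q.bosonAction w (contourField T y) / η) = (gaussianWeight η y : ℂ) := by
    intro y
    rw [hT.bosonAction_contourField, gaussianWeight]
    simp only [← Real.exp_sum]
    push_cast
    congr 1
    simp only [neg_div, Finset.sum_div, Finset.sum_neg_distrib]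
  have hg0 : g 0 = Q.hsIntegrand w φ₀ S S' := by
    have h := Q.exp_bosonAction_smul_hsIntegrand w φ₀ 0
    have h0 : Q.bosonAction w (0 : Fin L → V × V → ℂ) = 0 := by simp [bosonAction]
    rw [h0, Complex.exp_zero, one_smul, add_zero] at h
    rw [h, hgdef]
    congr 2
    ext l q
    simp
  have hHcol : ∀ l : Fin L, ∑ a, H (e (l, a)) (e (l, a)) =
      ∑ p, ∑ q, Λ p q * Q.sourceHessian w φ₀ l p q S S' := by
    intro l
    have hsingle : ∀ v : V × V → ℂ, (Pi.single l v : Fin L → V × V → ℂ) =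
        ∑ p, v p • (Pi.single l (Pi.single p 1) : Fin L → V × V → ℂ) := by
      intro v
      ext l' q
      simp only [Finset.sum_apply, Pi.smul_apply, smul_eq_mul]
      by_cases hl : l' = l
      · subst hl
        simp [Pi.single_apply]
      · simp [Pi.single_eq_of_ne hl]
    -- the second contour condition: the covariance of the sources is the coupling matrix
    have hcov : ∀ p q, ∑ a, (Λ * T) p a * (Λ * T) q a = Λ p q := by
      intro p q
      have h1 : (Λ * T * (Λ * T)ᵀ) p q = Λ p q := by
        have hsymm : Λᵀ = Λ := by ext p q; exact Q.coupling_comm w L q p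
        rw [Matrix.transpose_mul, hsymm, Matrix.mul_assoc, ← Matrix.mul_assoc T,
          ← Matrix.mul_assoc,
          hT.coupling_mul_mul_coupling]
      rw [← h1, Matrix.mul_apply]
      rfl
    have hterm : ∀ a, H (e (l, a)) (e (l, a)) =
        ∑ p, ∑ q, ((Λ * T) p a * (Λ * T) q a) * Q.sourceHessian w φ₀ l p q S S' := by
      intro a
      simp only [e]
      rw [hsingle, bilinear_sum_smul]
      rfl
    simp only [hterm]
    rw [Finset.sum_comm]
    refine Finset.sum_congr rfl fun p _ => ?_
    rw [Finset.sum_comm]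
    refine Finset.sum_congr rfl fun q _ => ?_
    rw [← Finset.sum_mul, hcov]
  rw [gaussianIntegral, Matrix.of_apply]
  simp only [htay, hweight]
  rw [gaussian_average hη, hg0, Fintype.sum_prod_type]
  simp only [← Finset.sum_div, hHcol]
  ring

end QuarticSystem

end Decoupling

/-! ### Adjoints and charge conservation of the decoupled integrals -/

section Adjoint

theorem List.reverse_ofFn_eq {α : Type*} {L : ℕ} (f : Fin L → α) :
    (List.ofFn f).reverse = List.ofFn fun l => f l.rev := by
  refine List.ext_getElem (by simp) fun i h1 h2 => ?_
  simp only [List.getElem_reverse, List.getElem_ofFn, List.length_ofFn]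
  congr 1
  ext
  simp [Fin.val_rev]
  omega

theorem Commute.matrix_exp_left {n : Type*} [Fintype n] [DecidableEq n] {X N : Matrix n n ℂ}
    (h : Commute X N) : Commute (NormedSpace.exp X) N := by
  let := Matrix.linftyOpNormedRing (n := n) (α := ℂ)
  let := Matrix.linftyOpNormedAlgebra (n := n) (R := ℚ) (α := ℂ)
  exact Commute.exp_left h

theorem taylorTwo_star (f : ℝ → ℂ) :
    taylorTwo (fun x => star (f x)) = star (taylorTwo f) := by
  have h : ∀ g : ℝ → ℂ, deriv (fun x => star (g x)) = fun x => star (deriv g x) :=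
    fun g => funext fun x => deriv.star
  simp only [taylorTwo, iteratedDeriv_succ, iteratedDeriv_zero, h]
  simp

open MeasureTheory in
theorem integral_comp_rev {L k : ℕ} (F : (Fin L → Fin k → ℝ) → ℂ) :
    ∫ y : Fin L → Fin k → ℝ, F (fun l => y l.rev) = ∫ y, F y := by
  rw [← (volume_measurePreserving_piCongrLeft (fun _ : Fin L => Fin k → ℝ)
    Fin.revPerm).integral_comp' F]
  congr 1
  ext y
  congr 1
  ext1 l
  have h := MeasurableEquiv.piCongrLeft_apply_apply (Fin.revPerm (n := L))
    (β := fun _ => Fin k → ℝ) y l.rev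
  rw [Fin.revPerm_apply, Fin.rev_rev] at h
  exact h.symm

variable {V : Type*}

/-- The adjoint of a field on the contour lies on the adjoint contour, with the slices in reverse
order. -/
theorem contourField_adjContour {L k : ℕ} (T : Matrix (V × V) (Fin k) ℂ) (y : Fin L → Fin k → ℝ) :
    contourField (adjContour T) (fun l => y l.rev) = adjField (contourField T y) := by
  ext l p
  simp [contourField, adjField, adjContour, Matrix.mulVec, dotProduct]

theorem adjField_smul {L : ℕ} (x : ℝ) (φ : Fin L → V × V → ℂ) :
    adjField (x • φ) = x • adjField φ := by
  ext l p
  simp [adjField]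

theorem adjField_add {L : ℕ} (φ ψ : Fin L → V × V → ℂ) :
    adjField (φ + ψ) = adjField φ + adjField ψ := by
  ext l p
  simp [adjField]

theorem adjField_static {φ : V × V → ℂ} (h : ∀ i j, star (φ (i, j)) = φ (j, i)) (L : ℕ) :
    adjField (fun _ : Fin L => φ) = fun _ => φ := by
  ext l ⟨i, j⟩
  exact h j i

theorem sum_swap {M : Type*} [AddCommMonoid M] [Fintype V] (f : V × V → M) :
    ∑ p : V × V, f p.swap = ∑ p, f p :=
  (Equiv.prodComm V V).sum_comp f

theorem map_star_mul {l m n : Type*} [Fintype m] (X : Matrix l m ℂ) (Y : Matrix m n ℂ) :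
    (X * Y).map star = X.map star * Y.map star :=
  Matrix.map_mul (f := starRingEnd ℂ)

namespace QuarticSystem

variable (Q : QuarticSystem V)

theorem star_lam (p q : V × V) : star (Q.lam p q) = Q.lam q.swap p.swap :=
  Q.lam_herm p.1 p.2 q.1 q.2

theorem star_coupling (w : ℂ) (L : ℕ) (p q : V × V) :
    star (Q.coupling w L p q) = Q.coupling (star w) L p.swap q.swap := by
  simp only [coupling, Matrix.smul_apply, Matrix.add_apply, Matrix.transpose_apply, smul_eq_mul,
    star_mul', star_add, star_lam, star_div₀]
  simp [add_comm]

variable [Fintype V]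

theorem star_bosonAction (w : ℂ) {L : ℕ} (φ : Fin L → V × V → ℂ) :
    star (Q.bosonAction w φ) = Q.bosonAction (star w) (adjField φ) := by
  rw [bosonAction, bosonAction, star_mul', star_div₀, star_natCast, star_sum]
  congr 1
  rw [← Equiv.sum_comp Fin.revPerm]
  refine Finset.sum_congr rfl fun l _ => ?_
  rw [star_sum, ← sum_swap fun p => ∑ q, Q.lam p q * adjField φ _ p * adjField φ _ q,
    Finset.sum_congr rfl fun p _ => star_sum _ _, Finset.sum_comm]
  refine Finset.sum_congr rfl fun p _ => ?_
  rw [← sum_swap]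
  refine Finset.sum_congr rfl fun q _ => ?_
  rw [star_mul', star_mul', star_lam, Prod.swap_swap, adjField, adjField, Prod.swap_swap]
  simp only [Fin.revPerm_apply]
  ring

/-- The adjoint contour is a contour for the backward evolution. -/
theorem IsContour.adjContour {Q : QuarticSystem V} {w : ℂ} {L k : ℕ}
    {T : Matrix (V × V) (Fin k) ℂ} (hT : Q.IsContour w L T) :
    Q.IsContour (star w) L (adjContour T) := by
  have hC : Q.coupling (star w) L =
      ((Q.coupling w L).map star).submatrix Prod.swap Prod.swap := by
    ext p q
    rw [Matrix.submatrix_apply, Matrix.map_apply, star_coupling, Prod.swap_swap, Prod.swap_swap]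
  have hA : _root_.adjContour T = (T.map star).submatrix Prod.swap id := rfl
  have hbij : Function.Bijective (Prod.swap : V × V → V × V) := (Equiv.prodComm V V).bijective
  have hAt : (_root_.adjContour T)ᵀ = (Tᵀ.map star).submatrix id Prod.swap := rfl
  have h1 := congrArg (fun M => M.map star) hT.transpose_mul_coupling_mul
  have h2 := congrArg (fun M => M.map star) hT.coupling_mul_mul_coupling
  simp only [map_star_mul] at h1 h2
  refine ⟨?_, ?_⟩
  · change (_root_.adjContour T)ᵀ * Q.coupling (star w) L * _root_.adjContour T = 1
    rw [hAt, hC, hA, ← Matrix.submatrix_mul _ _ _ _ _ hbij, ← Matrix.submatrix_mul _ _ _ _ _ hbij,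
      h1, Matrix.submatrix_id_id]
    exact Matrix.map_one star (star_zero ℂ) (star_one ℂ)
  · change Q.coupling (star w) L * (_root_.adjContour T * (_root_.adjContour T)ᵀ) *
      Q.coupling (star w) L = Q.coupling (star w) L
    rw [hAt, hC, hA, ← Matrix.submatrix_mul _ _ _ _ _ Function.bijective_id,
      ← Matrix.submatrix_mul _ _ _ _ _ hbij, ← Matrix.submatrix_mul _ _ _ _ _ hbij, h2]

variable [LinearOrder V]

theorem hop_conjTranspose (p : V × V) : (hop p)ᴴ = hop p.swap := by
  rw [hop, hop, Matrix.conjTranspose_mul, Matrix.conjTranspose_conjTranspose]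
  rfl

theorem conjTranspose_decoupled (φ : V × V → ℂ) :
    (Q.decoupled φ)ᴴ = Q.decoupled fun p => star (φ p.swap) := by
  rw [decoupled, decoupled, Matrix.conjTranspose_sub, Matrix.conjTranspose_sum,
    Matrix.conjTranspose_sum]
  congr 1
  · rw [← sum_swap]
    refine Finset.sum_congr rfl fun p _ => ?_
    rw [Matrix.conjTranspose_smul, Q.eps_herm, hop_conjTranspose, Prod.swap_swap]
    rfl
  · rw [← sum_swap fun p => ∑ q, Q.lam p q • _,
      Finset.sum_congr rfl fun p _ => Matrix.conjTranspose_sum _ _, Finset.sum_comm]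
    refine Finset.sum_congr rfl fun p _ => ?_
    rw [← sum_swap]
    refine Finset.sum_congr rfl fun q _ => ?_
    rw [Matrix.conjTranspose_smul, star_lam, Matrix.conjTranspose_sub, Matrix.conjTranspose_add,
      Matrix.conjTranspose_smul, Matrix.conjTranspose_smul, Matrix.conjTranspose_smul,
      Matrix.conjTranspose_one, hop_conjTranspose, hop_conjTranspose]
    simp only [Prod.swap_swap, star_mul']
    rw [add_comm, mul_comm (star (φ p))]

theorem conjTranspose_hsIntegrand (w : ℂ) {L : ℕ} (φ : Fin L → V × V → ℂ) :
    (Q.hsIntegrand w φ)ᴴ = Q.hsIntegrand (star w) (adjField φ) := by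
  rw [hsIntegrand, Matrix.conjTranspose_list_prod, List.map_ofFn, List.reverse_ofFn_eq, hsIntegrand]
  congr 2
  ext1 l
  rw [Function.comp_apply, ← Matrix.exp_conjTranspose, Matrix.conjTranspose_smul,
    conjTranspose_decoupled, star_neg, star_div₀, star_natCast]
  rfl

/-- The integral along the adjoint contour around the adjoint field is the adjoint operator. -/
theorem gaussianIntegral_adj (w : ℂ) {L k : ℕ} (T : Matrix (V × V) (Fin k) ℂ)
    (φ₀ : Fin L → V × V → ℂ) (η : ℝ) :
    Q.gaussianIntegral (star w) (_root_.adjContour T) (adjField φ₀) η =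
      (Q.gaussianIntegral w T φ₀ η)ᴴ := by
  ext S S'
  rw [Matrix.conjTranspose_apply, gaussianIntegral, gaussianIntegral, Matrix.of_apply,
    Matrix.of_apply, star_div₀]
  have hw : ∀ y : Fin L → Fin k → ℝ,
      Complex.exp
          (-Q.bosonAction (star w) (contourField (_root_.adjContour T) fun l => y l.rev) / η) =
        star (Complex.exp (-Q.bosonAction w (contourField T y) / η)) := by
    intro y
    rw [contourField_adjContour, ← star_bosonAction]
    simp only [RCLike.star_def]
    rw [← Complex.exp_conj]
    simp
  have hf : ∀ (y : Fin L → Fin k → ℝ) (x : ℝ),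
      (Complex.exp (Q.bosonAction (star w)
          (x • contourField (_root_.adjContour T) fun l => y l.rev)) •
        Q.hsIntegrand (star w)
          (adjField φ₀ + x • contourField (_root_.adjContour T) fun l => y l.rev)) S S' =
      star ((Complex.exp (Q.bosonAction w (x • contourField T y)) •
        Q.hsIntegrand w (φ₀ + x • contourField T y)) S' S) := by
    intro y x
    rw [contourField_adjContour, ← adjField_smul, ← adjField_add, ← conjTranspose_hsIntegrand,
      ← star_bosonAction, Matrix.smul_apply, Matrix.smul_apply, Matrix.conjTranspose_apply,
      smul_eq_mul, smul_eq_mul, star_mul']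
    simp only [RCLike.star_def]
    rw [← Complex.exp_conj]
  have hstar : ∀ F : (Fin L → Fin k → ℝ) → ℂ, star (∫ y, F y) = ∫ y, star (F y) :=
    fun F => integral_conj.symm
  rw [hstar, hstar, ← integral_comp_rev, ← integral_comp_rev (fun y =>
    Complex.exp (-Q.bosonAction (star w) (contourField (_root_.adjContour T) y) / η))]
  simp only [hw, hf, taylorTwo_star, star_mul']

theorem commute_decoupled_totalNumber (φ : V × V → ℂ) :
    Commute (Q.decoupled φ) (totalNumber V) := by
  have hc : ∀ p : V × V, Commute (hop p) (totalNumber V) := commute_hop_totalNumber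
  refine Commute.sub_left (Commute.sum_left _ _ _ fun p _ => (hc p).smul_left _)
    (Commute.sum_left _ _ _ fun p _ => Commute.sum_left _ _ _ fun q _ => ?_)
  exact ((((hc q).smul_left _).add_left ((hc p).smul_left _)).sub_left
    ((Commute.one_left _).smul_left _)).smul_left _

theorem commute_hsIntegrand_totalNumber (w : ℂ) {L : ℕ} (φ : Fin L → V × V → ℂ) :
    Commute (Q.hsIntegrand w φ) (totalNumber V) := by
  refine Commute.list_prod_left _ _ fun X hX => ?_
  obtain ⟨l, rfl⟩ := List.mem_ofFn.1 hX
  exact Commute.matrix_exp_left ((Q.commute_decoupled_totalNumber _).smul_left _)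

/-- The Gaussian integral conserves the charge, for any `η` and any contour: the matrix elements
between different charges vanish already in the integrand. -/
theorem commute_gaussianIntegral_totalNumber (w : ℂ) {L k : ℕ} (T : Matrix (V × V) (Fin k) ℂ)
    (φ₀ : Fin L → V × V → ℂ) (η : ℝ) :
    Commute (Q.gaussianIntegral w T φ₀ η) (totalNumber V) := by
  rw [commute_totalNumber_iff]
  intro S S' hS
  have hz : ∀ φ : Fin L → V × V → ℂ, Q.hsIntegrand w φ S S' = 0 := fun φ =>
    commute_totalNumber_iff.1 (Q.commute_hsIntegrand_totalNumber w φ) S S' hS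
  have ht : taylorTwo (fun _ => (0 : ℂ)) = 0 := by
    simp [taylorTwo]
  rw [gaussianIntegral, Matrix.of_apply]
  simp only [Matrix.smul_apply, hz, smul_zero, ht, mul_zero, MeasureTheory.integral_zero, zero_div]

end QuarticSystem

end Adjoint

/-! ### Saddle point operators are free -/

section Saddle

variable {V : Type*} [Fintype V]

namespace QuarticSystem

variable (Q : QuarticSystem V)

/-- The single-particle Hamiltonian of the decoupled operator. -/
def oneBody (φ : V × V → ℂ) : Matrix V V ℂ :=
  Matrix.of fun i j => Q.eps i j - ∑ p, (Q.lam p (i, j) + Q.lam (i, j) p) * φ p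

theorem conjTranspose_oneBody (φ : V × V → ℂ) :
    (Q.oneBody φ)ᴴ = Q.oneBody fun p => star (φ p.swap) := by
  ext i j
  rw [Matrix.conjTranspose_apply, oneBody, oneBody, Matrix.of_apply, Matrix.of_apply, star_sub,
    Q.eps_herm, star_sum]
  congr 1
  rw [← sum_swap]
  refine Finset.sum_congr rfl fun p _ => ?_
  rw [star_mul', star_add, star_lam, star_lam, Prod.swap_swap, add_comm]
  rfl

variable [LinearOrder V]

/-- The decoupled operator is quadratic in the modes, up to a constant. -/
theorem decoupled_eq_oneBody (φ : V × V → ℂ) :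
    Q.decoupled φ = (∑ j, ∑ k, Q.oneBody φ j k • ((annihilate j)ᴴ * annihilate k)) +
      (∑ p, ∑ q, Q.lam p q * (φ p * φ q)) • (1 : FockOp V) := by
  have h1 : (∑ j, ∑ k, Q.oneBody φ j k • ((annihilate j)ᴴ * annihilate k) : FockOp V) =
      ∑ q : V × V, (Q.eps q.1 q.2 - ∑ p, (Q.lam p q + Q.lam q p) * φ p) • hop q := by
    rw [Fintype.sum_prod_type]
    rfl
  have h2 : ∑ p, ∑ q, (Q.lam q p * φ q) • (hop p : FockOp V) =
      ∑ p, ∑ q, (Q.lam p q * φ p) • (hop q : FockOp V) := Finset.sum_comm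
  simp only [h1, sub_smul, Finset.sum_sub_distrib, Finset.sum_smul, add_mul, add_smul,
    Finset.sum_add_distrib, decoupled, smul_sub, smul_add, smul_smul]
  rw [h2]
  abel

theorem annihilate_commutator_decoupled (c : ℂ) (φ : V × V → ℂ) (i : V) :
    annihilate i * (c • Q.decoupled φ) - (c • Q.decoupled φ) * annihilate i =
      ∑ j, (c • Q.oneBody φ) i j • (annihilate j : FockOp V) := by
  have h := isCAR_annihilate.commutator_sum (Q.oneBody φ) i
  simp only [Matrix.smul_apply, smul_eq_mul, mul_smul, ← Finset.smul_sum]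
  rw [← h, decoupled_eq_oneBody, mul_smul_comm, smul_mul_assoc, ← smul_sub, mul_add, add_mul,
    mul_smul_comm, smul_mul_assoc, mul_one, one_mul, add_sub_add_right_eq_sub]

theorem implements_exp_decoupled (c : ℂ) (φ : V × V → ℂ) :
    Implements annihilate (NormedSpace.exp (c • Q.decoupled φ))
      (NormedSpace.exp (c • Q.oneBody φ)) :=
  Implements.exp (Q.annihilate_commutator_decoupled c φ)

theorem isUnit_hsIntegrand (w : ℂ) {L : ℕ} (φ : Fin L → V × V → ℂ) :
    IsUnit (Q.hsIntegrand w φ) := by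
  refine List.prod_isUnit fun X hX => ?_
  obtain ⟨l, rfl⟩ := List.mem_ofFn.1 hX
  exact Matrix.isUnit_exp _

/-- The operator at an arbitrary field acts linearly on the modes, and its adjoint acts through the
adjoint matrix. -/
theorem exists_implements_hsIntegrand (w : ℂ) {L : ℕ} (φ : Fin L → V × V → ℂ) :
    ∃ K : Matrix V V ℂ, IsUnit K ∧ Implements annihilate (Q.hsIntegrand w φ) K ∧
      Implements annihilate (Q.hsIntegrand w φ)ᴴ Kᴴ := by
  have h : ∀ l : List (FockOp V), (∀ X ∈ l, ∃ K : Matrix V V ℂ, IsUnit K ∧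
      Implements annihilate X K ∧ Implements annihilate Xᴴ Kᴴ) → ∃ K : Matrix V V ℂ, IsUnit K ∧
      Implements annihilate l.prod K ∧ Implements annihilate l.prodᴴ Kᴴ := by
    intro l
    induction l with
    | nil =>
      intro _
      refine ⟨1, isUnit_one, ?_, ?_⟩
      · simpa using Implements.one (annihilate : V → FockOp V)
      · simpa using Implements.one (annihilate : V → FockOp V)
    | cons X l ih =>
      intro hl
      obtain ⟨K, hK, h1, h2⟩ := hl X (by simp)
      obtain ⟨K', hK', h1', h2'⟩ := ih fun Y hY => hl Y (by simp [hY])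
      refine ⟨K * K', hK.mul hK', ?_, ?_⟩
      · rw [List.prod_cons]; exact h1.mul h1'
      · rw [List.prod_cons, Matrix.conjTranspose_mul, Matrix.conjTranspose_mul]
        exact h2'.mul h2
  refine h _ fun X hX => ?_
  obtain ⟨l, rfl⟩ := List.mem_ofFn.1 hX
  refine ⟨_, Matrix.isUnit_exp _, Q.implements_exp_decoupled _ _, ?_⟩
  rw [← Matrix.exp_conjTranspose, ← Matrix.exp_conjTranspose, Matrix.conjTranspose_smul,
    Matrix.conjTranspose_smul, conjTranspose_decoupled, conjTranspose_oneBody]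
  exact Q.implements_exp_decoupled _ _

theorem hsIntegrand_static (w : ℂ) (L : ℕ) (φ : V × V → ℂ) :
    Q.hsIntegrand w (fun _ : Fin L => φ) =
      NormedSpace.exp (-(w / L) • Q.decoupled φ) ^ L := by
  rw [hsIntegrand, List.ofFn_const, List.prod_replicate]

/-- At a static Hermitian field the integrand for a real weight is a positive free operator. -/
theorem hsIntegrand_static_posDef (β : ℝ) (L : ℕ) {φ : V × V → ℂ}
    (hφ : ∀ i j, star (φ (i, j)) = φ (j, i)) :
    (Q.hsIntegrand β (fun _ : Fin L => φ)).PosDef ∧ ∃ K : Matrix V V ℂ, K.PosDef ∧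
      Implements annihilate (Q.hsIntegrand β (fun _ : Fin L => φ)) K := by
  have hφ' : (fun p => star (φ p.swap)) = φ := funext fun p => hφ p.2 p.1
  have hc : star (-((β : ℂ) / L)) = -((β : ℂ) / L) := by simp
  have hpow : ∀ {n : Type _} [Fintype n] [DecidableEq n] (H : Matrix n n ℂ), H.IsHermitian →
      (NormedSpace.exp (-((β : ℂ) / L) • H) ^ L).PosDef := by
    intro n _ _ H hH
    rw [← Matrix.exp_nsmul]
    refine Matrix.IsHermitian.exp_posDef ?_
    rw [Matrix.IsHermitian, Matrix.conjTranspose_nsmul, Matrix.conjTranspose_smul, hH.eq, hc]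
  rw [hsIntegrand_static]
  refine ⟨hpow _ ?_, _, hpow _ ?_, (Q.implements_exp_decoupled _ φ).pow L⟩
  · rw [Matrix.IsHermitian, conjTranspose_decoupled, hφ']
  · rw [Matrix.IsHermitian, conjTranspose_oneBody, hφ']

theorem gaussianIntegral_static_isHermitian {β : ℝ} {L k : ℕ} {T : Matrix (V × V) (Fin k) ℂ}
    (hT : Q.IsContour β L T) {φ : V × V → ℂ} (hφ : ∀ i j, star (φ (i, j)) = φ (j, i)) {η : ℝ}
    (hη : 0 < η) : (Q.gaussianIntegral β T (fun _ : Fin L => φ) η).IsHermitian := by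
  have hβ : star (β : ℂ) = β := by simp
  have hT' : Q.IsContour β L (_root_.adjContour T) := by
    have := hT.adjContour
    rwa [hβ] at this
  have h := Q.gaussianIntegral_adj β T (fun _ : Fin L => φ) η
  rw [hβ, adjField_static hφ] at h
  -- the average does not depend on the contour, in particular not on taking its adjoint
  rw [Matrix.IsHermitian, ← h]
  ext S S'
  rw [hT.gaussianIntegral_apply _ hη, hT'.gaussianIntegral_apply _ hη]

/-- Gaussian fluctuations change the saddle point operator exactly linearly in their strength. -/
theorem IsContour.exists_gaussianIntegral_eq {Q : QuarticSystem V} {w : ℂ} {L k : ℕ}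
    {T : Matrix (V × V) (Fin k) ℂ} (hT : Q.IsContour w L T) (φ₀ : Fin L → V × V → ℂ) :
    ∃ R : FockOp V, ∀ η : ℝ, 0 < η →
      Q.gaussianIntegral w T φ₀ η = Q.hsIntegrand w φ₀ + (η : ℂ) • R := by
  refine ⟨Matrix.of fun S S' => (1 / 4) * ∑ l, ∑ p, ∑ q,
    Q.coupling w L p q * Q.sourceHessian w φ₀ l p q S S', fun η hη => ?_⟩
  ext S S'
  rw [hT.gaussianIntegral_apply φ₀ hη]
  rfl

end QuarticSystem

end Saddle

/-! ### The two families of states -/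

section Families

variable {V : Type*} [Fintype V] [LinearOrder V]

/-- What the free-fermion formula needs to know about a family of states `E η / Tr (E η)`: it is a
perturbation of first order of a positive charge-conserving operator `E₀`, which acts on the modes
like the exponential of a one-body operator. -/
structure IsFluctuationFamily (E₀ : FockOp V) (E : ℝ → FockOp V) : Prop where
  posDef : E₀.PosDef
  implements : ∃ K : Matrix V V ℂ, K.PosDef ∧ Implements annihilate E₀ K
  commute_zero : Commute E₀ (totalNumber V)
  commute : ∀ η, Commute (E η) (totalNumber V)
  isHermitian : ∀ η, 0 < η → (E η).IsHermitian
  expansion : ∃ R₁ R₂ R₃ : FockOp V, ∀ η : ℝ, 0 < η →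
    E η - E₀ = (η : ℂ) • (R₁ + (η : ℂ) • R₂ + (η ^ 2 : ℂ) • R₃)

theorem IsThermalFluctuationState.exists_family {Γ₀ : FockOp V} {ρ : ℝ → FockOp V}
    (h : IsThermalFluctuationState Γ₀ ρ) : ∃ E₀ E, IsFluctuationFamily E₀ E ∧
      Γ₀ = normalizeTrace E₀ ∧ ∀ η, ρ η = normalizeTrace (E η) := by
  obtain ⟨Q, β, L, k, T, φ₀, -, -, hT, hφ, -, -, hΓ, hρ⟩ := h
  obtain ⟨hpd, hK⟩ := Q.hsIntegrand_static_posDef β L hφ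
  obtain ⟨R, hR⟩ := hT.exists_gaussianIntegral_eq fun _ => φ₀
  refine ⟨_, _, ⟨hpd, hK, Q.commute_hsIntegrand_totalNumber _ _,
    fun η => Q.commute_gaussianIntegral_totalNumber _ _ _ η,
    fun η hη => Q.gaussianIntegral_static_isHermitian hT hφ hη, R, 0, 0, fun η hη => ?_⟩, hΓ, hρ⟩
  rw [hR η hη]
  simp

theorem IsEvolvedFluctuationState.exists_family {Γ₀ : FockOp V} {ρ : ℝ → FockOp V}
    (h : IsEvolvedFluctuationState Γ₀ ρ) : ∃ E₀ E, IsFluctuationFamily E₀ E ∧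
      Γ₀ = normalizeTrace E₀ ∧ ∀ η, ρ η = normalizeTrace (E η) := by
  obtain ⟨Q, Q₀, t, L, L₀, k, k₀, T, T₀, φ₁, φ₃, -, -, hT, hT₀, hφ, -, -, hΓ, hρ⟩ := h
  have hw : star (Complex.I * t) = -(Complex.I * t) := by simp
  -- the results on static fields are for the weight `(1 : ℝ)`, coerced
  have hone : ((1 : ℝ) : ℂ) = 1 := Complex.ofReal_one
  have hT' : Q.IsContour (-(Complex.I * t)) L (adjContour T) := by
    have := hT.adjContour
    rwa [hw] at this
  have hadj : Q.hsIntegrand (-(Complex.I * t)) (adjField φ₁) =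
      (Q.hsIntegrand (Complex.I * t) φ₁)ᴴ := by rw [Q.conjTranspose_hsIntegrand, hw]
  have hgadj : ∀ η, Q.gaussianIntegral (-(Complex.I * t)) (adjContour T) (adjField φ₁) η =
      (Q.gaussianIntegral (Complex.I * t) T φ₁ η)ᴴ := fun η => by
    rw [← Q.gaussianIntegral_adj, hw]
  obtain ⟨hpd, K₃, hK₃, hI₃⟩ := Q₀.hsIntegrand_static_posDef 1 L₀ hφ
  obtain ⟨K, hKu, hI, hI'⟩ := Q.exists_implements_hsIntegrand (Complex.I * t) φ₁
  obtain ⟨R, hR⟩ := hT.exists_gaussianIntegral_eq φ₁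
  obtain ⟨R', hR'⟩ := hT'.exists_gaussianIntegral_eq (adjField φ₁)
  obtain ⟨R₀, hR₀⟩ := hT₀.exists_gaussianIntegral_eq fun _ => φ₃
  rw [← hone] at hT₀
  refine ⟨_, _, ⟨?_, ⟨K * K₃ * Kᴴ, ?_, ?_⟩, ?_, fun η => ?_, fun η hη => ?_, ?_⟩, hΓ, hρ⟩
  · dsimp only
    rw [hadj]
    rw [hone] at hpd
    exact (Matrix.IsUnit.posDef_star_right_conjugate_iff (Q.isUnit_hsIntegrand _ _)).2 hpd
  · exact (Matrix.IsUnit.posDef_star_right_conjugate_iff hKu).2 hK₃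
  · dsimp only
    rw [hadj]
    rw [hone] at hI₃
    exact (hI.mul hI₃).mul hI'
  · exact ((Q.commute_hsIntegrand_totalNumber _ _).mul_left
      (Q₀.commute_hsIntegrand_totalNumber _ _)).mul_left (Q.commute_hsIntegrand_totalNumber _ _)
  · exact ((Q.commute_gaussianIntegral_totalNumber _ _ _ _).mul_left
      (Q₀.commute_gaussianIntegral_totalNumber _ _ _ _)).mul_left
      (Q.commute_gaussianIntegral_totalNumber _ _ _ _)
  · have h3 := Q₀.gaussianIntegral_static_isHermitian hT₀ hφ hη
    rw [hone] at h3
    rw [hgadj, Matrix.IsHermitian]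
    simp only [Matrix.conjTranspose_mul, Matrix.conjTranspose_conjTranspose, h3.eq, mul_assoc]
  · dsimp only
    set W := Q.hsIntegrand (Complex.I * t) φ₁
    set W' := Q.hsIntegrand (-(Complex.I * t)) (adjField φ₁)
    set W₀ := Q₀.hsIntegrand 1 fun _ : Fin L₀ => φ₃
    refine ⟨R * W₀ * W' + W * R₀ * W' + W * W₀ * R', R * R₀ * W' + R * W₀ * R' + W * R₀ * R',
      R * R₀ * R', fun η hη => ?_⟩
    rw [hR η hη, hR' η hη, hR₀ η hη]
    simp only [add_mul, mul_add, smul_mul_assoc, mul_smul_comm, smul_add, smul_smul, mul_assoc]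
    module

end Families

/-! ### States near a free state -/

section Perturbation

theorem Matrix.IsHermitian.posSemidef_sub_smul_one {n : Type*} [Fintype n] [DecidableEq n]
    {X : Matrix n n ℂ}
    (hX : X.IsHermitian) {c : ℝ} (hc : ∀ i, c ≤ hX.eigenvalues i) :
    (X - (c : ℂ) • (1 : Matrix n n ℂ)).PosSemidef := by
  have h : X - (c : ℂ) • (1 : Matrix n n ℂ) = (hX.eigenvectorUnitary : Matrix n n ℂ) *
      Matrix.diagonal (fun i => ((hX.eigenvalues i - c : ℝ) : ℂ)) *
      (hX.eigenvectorUnitary : Matrix n n ℂ)ᴴ := by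
    have hd : Matrix.diagonal (fun i => ((hX.eigenvalues i - c : ℝ) : ℂ)) =
        Matrix.diagonal (fun i => (hX.eigenvalues i : ℂ)) - (c : ℂ) • 1 := by
      rw [← Matrix.diagonal_one, ← Matrix.diagonal_smul, Matrix.diagonal_sub]
      congr 1; ext i; simp
    have hU : (hX.eigenvectorUnitary : Matrix n n ℂ) *
        (hX.eigenvectorUnitary : Matrix n n ℂ)ᴴ = 1 :=
      Matrix.mem_unitaryGroup_iff.1 hX.eigenvectorUnitary.2
    have hs := hX.spectral_theorem
    rw [Unitary.conjStarAlgAut_apply, Matrix.star_eq_conjTranspose] at hs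
    rw [hd, mul_sub, sub_mul, mul_smul_comm, smul_mul_assoc, mul_one, hU]
    congr 1
  rw [h]
  exact (Matrix.PosSemidef.diagonal fun i => by
    simpa using hc i).mul_mul_conjTranspose_same _

/-- Positive definiteness is stable under small Hermitian perturbations. -/
theorem Matrix.PosDef.exists_perturbation {n : Type*} [Fintype n] [DecidableEq n] [Nonempty n]
    {X : Matrix n n ℂ} (hX : X.PosDef) :
    ∃ ε : ℝ, 0 < ε ∧ ∀ Y : Matrix n n ℂ, Y.IsHermitian → (∀ i j, ‖(Y - X) i j‖ ≤ ε) →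
      Y.PosDef := by
  obtain ⟨i₀, hi₀⟩ := Finite.exists_min hX.isHermitian.eigenvalues
  set c := hX.isHermitian.eigenvalues i₀ with hc
  have hcpos : 0 < c := hX.eigenvalues_pos i₀
  set N : ℝ := (Fintype.card n : ℝ) with hN
  have hNpos : 0 < N := by rw [hN]; exact_mod_cast Fintype.card_pos
  -- a matrix with entries at most `c / (2 * N)` has operator norm at most `c / 2`
  refine ⟨c / (2 * N), by positivity, fun Y hY hYX => ?_⟩
  set D := Y - X with hD
  have hDh : D.IsHermitian := hY.sub hX.isHermitian
  have hsplit : Y = ((c : ℂ) • (1 : Matrix n n ℂ) + D) + (X - (c : ℂ) • (1 : Matrix n n ℂ)) := by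
    rw [hD]; abel
  have hch : ((c : ℂ) • (1 : Matrix n n ℂ) + D).IsHermitian := by
    refine Matrix.IsHermitian.add ?_ hDh
    rw [Matrix.IsHermitian, Matrix.conjTranspose_smul, Matrix.conjTranspose_one]
    simp
  rw [hsplit]
  refine Matrix.PosDef.add_posSemidef ?_ (hX.isHermitian.posSemidef_sub_smul_one hi₀)
  refine Matrix.PosDef.of_dotProduct_mulVec_pos hch fun x hx => ?_
  have hform : star x ⬝ᵥ (((c : ℂ) • (1 : Matrix n n ℂ) + D) *ᵥ x) =
      ((c * ∑ i, ‖x i‖ ^ 2 : ℝ) : ℂ) + star x ⬝ᵥ (D *ᵥ x) := by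
    rw [Matrix.add_mulVec, dotProduct_add, Matrix.smul_mulVec, Matrix.one_mulVec, dotProduct_smul]
    congr 1
    rw [smul_eq_mul, dotProduct, Complex.ofReal_mul, Complex.ofReal_sum]
    congr 1
    refine Finset.sum_congr rfl fun i _ => ?_
    rw [Pi.star_apply, RCLike.star_def, mul_comm, Complex.mul_conj, Complex.normSq_eq_norm_sq]
  have hbound : ‖star x ⬝ᵥ (D *ᵥ x)‖ ≤ c / 2 * ∑ i, ‖x i‖ ^ 2 := by
    calc ‖star x ⬝ᵥ (D *ᵥ x)‖ ≤ ∑ i, ∑ j, ‖x i‖ * (c / (2 * N) * ‖x j‖) := by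
          refine norm_sum_le_of_le _ fun i _ => ?_
          rw [norm_mul, Pi.star_apply, norm_star, ← Finset.mul_sum]
          refine mul_le_mul_of_nonneg_left ?_ (norm_nonneg _)
          refine norm_sum_le_of_le _ fun j _ => ?_
          rw [norm_mul]
          exact mul_le_mul_of_nonneg_right (hYX i j) (norm_nonneg _)
      _ = c / (2 * N) * (∑ i, ‖x i‖) ^ 2 := by
          rw [pow_two, Finset.sum_mul_sum, Finset.mul_sum]
          refine Finset.sum_congr rfl fun i _ => ?_
          rw [Finset.mul_sum]
          exact Finset.sum_congr rfl fun j _ => by ring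
      _ ≤ c / (2 * N) * (N * ∑ i, ‖x i‖ ^ 2) := by
          refine mul_le_mul_of_nonneg_left ?_ (by positivity)
          have := sq_sum_le_card_mul_sum_sq (s := (Finset.univ : Finset n)) (f := fun i => ‖x i‖)
          rwa [Finset.card_univ] at this
      _ = c / 2 * ∑ i, ‖x i‖ ^ 2 := by field_simp
  have hxpos : 0 < ∑ i, ‖x i‖ ^ 2 := by
    obtain ⟨i, hi⟩ := Function.ne_iff.1 hx
    exact Finset.sum_pos' (fun i _ => by positivity)
      ⟨i, Finset.mem_univ i, by have := norm_pos_iff.2 hi; positivity⟩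
  have him : (star x ⬝ᵥ (((c : ℂ) • (1 : Matrix n n ℂ) + D) *ᵥ x)).im = 0 :=
    hch.im_star_dotProduct_mulVec_self x
  rw [Complex.pos_iff]
  refine ⟨?_, him.symm⟩
  rw [hform, Complex.add_re, Complex.ofReal_re]
  have := (abs_le.1 ((Complex.abs_re_le_norm _).trans hbound)).1
  nlinarith [mul_pos hcpos hxpos]

variable {V : Type*} [Fintype V] [LinearOrder V]

/-- Quantitative free-fermion formula for Hermitian perturbations of a free state. The bound `δ`
keeps the perturbed operator positive and its trace at least half of the unperturbed one. -/
theorem exists_freeExp_perturbation_bound {U : Matrix V V ℂ} (hU : U ∈ Matrix.unitaryGroup V ℂ)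
    (s : V → ℝ) : ∃ C δ : ℝ, 0 < δ ∧ ∀ (G : FockOp V) (r : ℝ), r ≤ δ → (∀ S S', ‖G S S'‖ ≤ r) →
      (freeExp U s * (1 + G)).IsHermitian →
      (normalizeTrace (freeExp U s * (1 + G))).PosDef ∧
      (normalizeTrace (freeExp U s * (1 + G))).trace = 1 ∧
      |vnEntropy (normalizeTrace (freeExp U s * (1 + G))) -
        freeFermionEntropy (corrMatrix (normalizeTrace (freeExp U s * (1 + G))))| ≤ C * r ^ 2 := by
  obtain ⟨C₀, hC₀, hbound⟩ := exists_entropy_bound hU s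
  obtain ⟨ε, hε, hpert⟩ := (freeExp_posDef U s).exists_perturbation
  set X := freeExp U s with hX
  set Z : ℝ := ∏ i, (1 + Real.exp (-s i)) with hZ
  have hZpos : 0 < Z := Finset.prod_pos fun i _ => by positivity
  have hXtr : X.trace = (Z : ℂ) := trace_freeExp hU s
  set b : ℝ := ∑ S, ∑ S', ‖X S S'‖ with hb
  have hb0 : 0 ≤ b := by positivity
  set N : ℝ := (Fintype.card (Finset V) : ℝ) with hN
  set δ : ℝ := min (ε / (b + 1)) (Z / (2 * (N * b + 1))) with hδ
  refine ⟨C₀ * (2 / Z * (b + N * b * (b / Z))) ^ 2, δ, by positivity,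
    fun G r hr hG hherm => ?_⟩
  have hr0 : 0 ≤ r := (norm_nonneg _).trans (hG ∅ ∅)
  set Y := X * (1 + G) with hY
  have hYX : Y - X = X * G := by rw [hY, mul_add, mul_one, add_sub_cancel_left]
  have hXG : ∀ S S', ‖(X * G) S S'‖ ≤ b * r := by
    intro S S'
    rw [Matrix.mul_apply]
    calc ‖∑ T, X S T * G T S'‖ ≤ ∑ T, ‖X S T‖ * r := norm_sum_le_of_le _ fun T _ => by
          rw [norm_mul]
          exact mul_le_mul_of_nonneg_left (hG T S') (norm_nonneg _)
      _ = (∑ T, ‖X S T‖) * r := by rw [Finset.sum_mul]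
      _ ≤ b * r := mul_le_mul_of_nonneg_right (Finset.single_le_sum
          (f := fun S => ∑ T, ‖X S T‖) (fun S _ => by positivity) (Finset.mem_univ S)) hr0
  have hXb : ∀ S S', ‖X S S'‖ ≤ b := fun S S' =>
    (Finset.single_le_sum (f := fun T => ‖X S T‖) (fun T _ => norm_nonneg _)
      (Finset.mem_univ S')).trans (Finset.single_le_sum
        (f := fun S => ∑ T, ‖X S T‖) (fun S _ => by positivity) (Finset.mem_univ S))
  have hbr : b * r ≤ ε := by
    have h1 : r ≤ ε / (b + 1) := hr.trans (min_le_left _ _)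
    rw [le_div_iff₀ (by positivity)] at h1
    nlinarith
  have hYpd : Y.PosDef := hpert Y hherm fun S S' => by rw [hYX]; exact (hXG S S').trans hbr
  have htXG : ‖(X * G).trace‖ ≤ N * b * r := by
    calc ‖(X * G).trace‖ ≤ ∑ _S : Finset V, b * r := norm_sum_le_of_le _ fun S _ => hXG S S
      _ = N * b * r := by rw [Finset.sum_const, Finset.card_univ, nsmul_eq_mul, mul_assoc]
  have hNbr : N * b * r ≤ Z / 2 := by
    have h1 : r ≤ Z / (2 * (N * b + 1)) := hr.trans (min_le_right _ _)
    rw [le_div_iff₀ (by positivity)] at h1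
    nlinarith
  have htY : Y.trace = Z + (X * G).trace := by
    rw [← hXtr, ← Matrix.trace_add, ← hYX, add_sub_cancel]
  have htYn : Z / 2 ≤ ‖Y.trace‖ := by
    have h1 := norm_sub_norm_le (Z : ℂ) (-(X * G).trace)
    rw [sub_neg_eq_add, ← htY, norm_neg, Complex.norm_real, Real.norm_of_nonneg hZpos.le] at h1
    linarith
  have hYtpos : 0 < Y.trace := hYpd.trace_pos
  have hpd : (normalizeTrace Y).PosDef := hYpd.smul (RCLike.inv_pos_of_pos hYtpos)
  have htr : (normalizeTrace Y).trace = 1 := by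
    rw [normalizeTrace, Matrix.trace_smul, smul_eq_mul, inv_mul_cancel₀ hYtpos.ne']
  refine ⟨hpd, htr, ?_⟩
  have hZne : (Z : ℂ) ≠ 0 := by exact_mod_cast hZpos.ne'
  have hdiff : ∀ S S', ‖(normalizeTrace Y - normalizeTrace X) S S'‖ ≤
      2 / Z * (b + N * b * (b / Z)) * r := by
    intro S S'
    have e : (normalizeTrace Y - normalizeTrace X) S S' =
        Y.trace⁻¹ * ((X * G) S S' - (X * G).trace * ((Z : ℂ)⁻¹ * X S S')) := by
      have hYS : Y S S' = X S S' + (X * G) S S' := by rw [← hYX]; simp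
      rw [Matrix.sub_apply, normalizeTrace, normalizeTrace, Matrix.smul_apply, Matrix.smul_apply,
        hXtr, hYS, smul_eq_mul, smul_eq_mul]
      have hne := hYtpos.ne'
      rw [htY] at hne ⊢
      field_simp
      ring
    rw [e, norm_mul, norm_inv]
    have h1 : ‖Y.trace‖⁻¹ ≤ 2 / Z := by
      rw [← inv_div]
      exact inv_anti₀ (by positivity) htYn
    have h2 : ‖(X * G) S S' - (X * G).trace * ((Z : ℂ)⁻¹ * X S S')‖ ≤
        b * r + N * b * r * (b / Z) := by
      refine (norm_sub_le _ _).trans (add_le_add (hXG S S') ?_)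
      rw [norm_mul, norm_mul, norm_inv, Complex.norm_real, Real.norm_of_nonneg hZpos.le]
      refine mul_le_mul htXG ?_ (by positivity) (by positivity)
      rw [inv_mul_eq_div]
      exact div_le_div_of_nonneg_right (hXb S S') hZpos.le
    calc _ ≤ 2 / Z * (b * r + N * b * r * (b / Z)) :=
          mul_le_mul h1 h2 (norm_nonneg _) (by positivity)
      _ = _ := by ring
  have hfin := hbound (normalizeTrace Y) _ hpd.posSemidef htr hdiff
  rw [mul_pow] at hfin
  linarith

end Perturbation

/-! ### Entropy of the region -/

section TraceOut

variable {A B : Type*} [Fintype B]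

theorem traceOut_sub (X Y : FockOp (A ⊕ₗ B)) : traceOut (X - Y) = traceOut X - traceOut Y := by
  ext S S'
  simp [traceOut]

theorem traceOut_smul (c : ℂ) (X : FockOp (A ⊕ₗ B)) : traceOut (c • X) = c • traceOut X := by
  ext S S'
  simp [traceOut, Finset.mul_sum]

theorem traceOut_add (X Y : FockOp (A ⊕ₗ B)) : traceOut (X + Y) = traceOut X + traceOut Y := by
  ext S S'
  simp [traceOut, Finset.sum_add_distrib]

theorem traceOut_isHermitian {X : FockOp (A ⊕ₗ B)} (hX : X.IsHermitian) :
    (traceOut X).IsHermitian := by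
  ext S S'
  simp only [Matrix.conjTranspose_apply, traceOut, Matrix.of_apply, star_sum, hX.apply]

theorem normalizeTrace_smul {n : Type*} [Fintype n] {c : ℂ} (hc : c ≠ 0) (X : Matrix n n ℂ) :
    normalizeTrace (c • X) = normalizeTrace X := by
  rw [normalizeTrace, normalizeTrace, Matrix.trace_smul, smul_smul, smul_eq_mul, mul_inv,
    mul_right_comm, inv_mul_cancel₀ hc, one_mul]

theorem trace_traceOut [Fintype A] [LinearOrder A] [LinearOrder B]
    (X : FockOp (A ⊕ₗ B)) : (traceOut X).trace = X.trace := by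
  simp only [Matrix.trace, Matrix.diag_apply, sum_joinOcc, traceOut, Matrix.of_apply]

theorem traceOut_normalizeTrace [Fintype A] [LinearOrder A] [LinearOrder B]
    (X : FockOp (A ⊕ₗ B)) :
    traceOut (normalizeTrace X) = normalizeTrace (traceOut X) := by
  rw [normalizeTrace, normalizeTrace, traceOut_smul, trace_traceOut]

end TraceOut

end

theorem theorem2 {A B : Type*} [Fintype A] [LinearOrder A] [Fintype B] [LinearOrder B]
    (Γ₀ : FockOp (A ⊕ₗ B)) :
    ∃ (U : Matrix A A ℂ) (s : A → ℝ) (C δ : ℝ), U ∈ Matrix.unitaryGroup A ℂ ∧ 0 < δ ∧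
      ∀ ρ : ℝ → FockOp (A ⊕ₗ B),
        IsThermalFluctuationState Γ₀ ρ ∨ IsEvolvedFluctuationState Γ₀ ρ →
        ∃ G' : ℝ → FockOp A,
          (∀ η, Commute (G' η) (totalNumber A)) ∧
          (∀ S S', (fun η => G' η S S') =O[nhdsWithin 0 (Set.Ioi 0)] fun η : ℝ => η) ∧
          (∀ η, 0 < η → traceOut (ρ η) = normalizeTrace (freeExp U s * (1 + G' η))) ∧
          (∀ η r, 0 < η → r ≤ δ → (∀ S S', ‖G' η S S'‖ ≤ r) →
            (traceOut (ρ η)).PosDef ∧ (traceOut (ρ η)).trace = 1 ∧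
            |vnEntropy (traceOut (ρ η)) - freeFermionEntropy (corrMatrix (traceOut (ρ η)))|
              ≤ C * r ^ 2) ∧
          (fun η => vnEntropy (traceOut (ρ η)) -
              freeFermionEntropy (corrMatrix (traceOut (ρ η))))
            =O[nhdsWithin 0 (Set.Ioi 0)] fun η : ℝ => η ^ 2 := by
  have hfam : ∀ ρ : ℝ → FockOp (A ⊕ₗ B),
      IsThermalFluctuationState Γ₀ ρ ∨ IsEvolvedFluctuationState Γ₀ ρ →
      ∃ E₀ E, IsFluctuationFamily E₀ E ∧ Γ₀ = normalizeTrace E₀ ∧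
        ∀ η, ρ η = normalizeTrace (E η) := fun ρ h =>
    h.elim (fun h => h.exists_family) (fun h => h.exists_family)
  by_cases hex : ∃ ρ : ℝ → FockOp (A ⊕ₗ B),
      IsThermalFluctuationState Γ₀ ρ ∨ IsEvolvedFluctuationState Γ₀ ρ
  swap
  -- no family has this density matrix at its saddle point, and nothing is claimed
  · exact ⟨1, 0, 0, 1, one_mem _, one_pos, fun ρ hρ => absurd ⟨ρ, hρ⟩ hex⟩
  -- the basis and the numbers `s i` are those of the reduced state of `Γ₀`; any one family
  -- serves to show that this state is free
  obtain ⟨U, hU, s, z, hz, hΓ⟩ : ∃ U ∈ Matrix.unitaryGroup A ℂ, ∃ (s : A → ℝ) (z : ℝ), 0 < z ∧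
      traceOut Γ₀ = (z : ℂ) • freeExp U s := by
    obtain ⟨ρ, hρ⟩ := hex
    obtain ⟨E₀, E, hE, hΓ, -⟩ := hfam ρ hρ
    obtain ⟨K, hK, hI⟩ := hE.implements
    have htr : 0 < E₀.trace := hE.posDef.trace_pos
    have hpd : Γ₀.PosDef := by
      rw [hΓ]; exact hE.posDef.smul (RCLike.inv_pos_of_pos htr)
    have hc : Commute Γ₀ (totalNumber (A ⊕ₗ B)) := by
      rw [hΓ]; exact hE.commute_zero.smul_left _
    have hI' : Implements annihilate Γ₀ K := by rw [hΓ]; exact hI.smul _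
    obtain ⟨K', hK', hI''⟩ := exists_implements_traceOut hc hK hI'
    exact hI''.exists_eq_smul_freeExp (traceOut_posDef hpd) hK'
  obtain ⟨C, δ, hδ, hbound⟩ := exists_freeExp_perturbation_bound hU s
  refine ⟨U, s, C, δ, hU, hδ, fun ρ hρ => ?_⟩
  obtain ⟨E₀, E, hE, hΓ₀, hρE⟩ := hfam ρ hρ
  obtain ⟨R₁, R₂, R₃, hR⟩ := hE.expansion
  set X := freeExp U s with hX
  have hXpd : X.PosDef := freeExp_posDef U s
  have hXi : X * X⁻¹ = 1 :=
    Matrix.mul_nonsing_inv _ ((Matrix.isUnit_iff_isUnit_det _).1 hXpd.isUnit)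
  have htr : 0 < E₀.trace := hE.posDef.trace_pos
  -- the scale `c` of the unnormalized operator of this family relative to `exp (- ∑ sᵢ nᵢ)`
  obtain ⟨c, hc, hE₀X⟩ : ∃ c : ℝ, 0 < c ∧ traceOut E₀ = (c : ℂ) • X := by
    refine ⟨E₀.trace.re * z, mul_pos (Complex.pos_iff.1 htr).1 hz, ?_⟩
    have h1 : E₀ = E₀.trace • Γ₀ := by
      rw [hΓ₀, normalizeTrace, smul_smul, mul_inv_cancel₀ htr.ne', one_smul]
    rw [h1, traceOut_smul, hΓ, smul_smul, ← h1, Complex.ofReal_mul,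
      ← Complex.eq_re_of_ofReal_le htr.le]
  have hcne : (c : ℂ) ≠ 0 := by exact_mod_cast hc.ne'
  -- the correction; for `η ≤ 0` the integrals carry no meaning, and the value `0` is a choice
  let G : ℝ → FockOp A := fun η =>
    if 0 < η then (c : ℂ)⁻¹ • (X⁻¹ * traceOut (E η - E₀)) else 0
  have hXG : ∀ η, 0 < η → X * (1 + G η) = (c : ℂ)⁻¹ • traceOut (E η) := by
    intro η hη
    simp only [G, if_pos hη]
    rw [mul_add, mul_one, mul_smul_comm, ← mul_assoc, hXi, one_mul, traceOut_sub, hE₀X, smul_sub,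
      smul_smul, inv_mul_cancel₀ hcne, one_smul, add_sub_cancel]
  have hstate : ∀ η, 0 < η → traceOut (ρ η) = normalizeTrace (X * (1 + G η)) := by
    intro η hη
    rw [hXG η hη, normalizeTrace_smul (inv_ne_zero hcne), hρE, traceOut_normalizeTrace]
  have hherm : ∀ η, 0 < η → (X * (1 + G η)).IsHermitian := by
    intro η hη
    rw [hXG η hη, Matrix.IsHermitian, Matrix.conjTranspose_smul,
      (traceOut_isHermitian (hE.isHermitian η hη)).eq]
    simp
  have hcomm : ∀ η, Commute (G η) (totalNumber A) := by
    intro η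
    simp only [G]
    split_ifs with hη
    · have hXc : Commute X (totalNumber A) := by
        have h1 : X = (c : ℂ)⁻¹ • traceOut E₀ := by
          rw [hE₀X, smul_smul, inv_mul_cancel₀ hcne, one_smul]
        rw [h1]
        exact (traceOut_commute_totalNumber hE.commute_zero).smul_left _
      have hXic : Commute X⁻¹ (totalNumber A) := by
        have hXi' : X⁻¹ * X = 1 :=
          Matrix.nonsing_inv_mul _ ((Matrix.isUnit_iff_isUnit_det _).1 hXpd.isUnit)
        have h2 : Commute (⟨X, X⁻¹, hXi, hXi'⟩ : (FockOp A)ˣ).inv (totalNumber A) :=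
          Commute.units_inv_left (u := (⟨X, X⁻¹, hXi, hXi'⟩ : (FockOp A)ˣ)) hXc
        exact h2
      exact (hXic.mul_left (traceOut_commute_totalNumber
        ((hE.commute η).sub_left hE.commute_zero))).smul_left _
    · exact Commute.zero_left _
  have hest : ∀ η r, 0 < η → r ≤ δ → (∀ S S', ‖G η S S'‖ ≤ r) →
      (traceOut (ρ η)).PosDef ∧ (traceOut (ρ η)).trace = 1 ∧
      |vnEntropy (traceOut (ρ η)) - freeFermionEntropy (corrMatrix (traceOut (ρ η)))|
        ≤ C * r ^ 2 := by
    intro η r hη hr hG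
    rw [hstate η hη]
    exact hbound (G η) r hr hG (hherm η hη)
  -- a common linear bound for the matrix elements of the correction
  obtain ⟨κ, hκ, hGκ⟩ : ∃ κ : ℝ, 0 < κ ∧ ∀ η, 0 < η → η ≤ 1 → ∀ S S', ‖G η S S'‖ ≤ κ * η := by
    let P : FockOp (A ⊕ₗ B) → FockOp A := fun R => (c : ℂ)⁻¹ • (X⁻¹ * traceOut R)
    let m : FockOp A → ℝ := fun R => ∑ S, ∑ S', ‖R S S'‖
    have hm0 : ∀ R, 0 ≤ m R := fun R => by positivity
    have hm : ∀ R S S', ‖R S S'‖ ≤ m R := fun R S S' =>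
      (Finset.single_le_sum (f := fun T => ‖R S T‖) (fun T _ => norm_nonneg _)
        (Finset.mem_univ S')).trans (Finset.single_le_sum
          (f := fun S => ∑ T, ‖R S T‖) (fun S _ => by positivity) (Finset.mem_univ S))
    refine ⟨m (P R₁) + m (P R₂) + m (P R₃) + 1, by have := hm0; positivity,
      fun η hη hη1 S S' => ?_⟩
    have e : G η = (η : ℂ) • (P R₁ + (η : ℂ) • P R₂ + (η ^ 2 : ℂ) • P R₃) := by
      simp only [G, if_pos hη, hR η hη, P, traceOut_smul, traceOut_add, mul_smul_comm, mul_add,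
        smul_add]
      module
    rw [e, Matrix.smul_apply, norm_smul, Complex.norm_real, Real.norm_of_nonneg hη.le, mul_comm]
    refine mul_le_mul_of_nonneg_right ?_ hη.le
    rw [Matrix.add_apply, Matrix.add_apply, Matrix.smul_apply, Matrix.smul_apply]
    refine (norm_add₃_le).trans ?_
    rw [norm_smul, norm_smul, norm_pow, Complex.norm_real, Real.norm_of_nonneg hη.le]
    have h1 := hm (P R₁) S S'
    have h2 : η * ‖P R₂ S S'‖ ≤ m (P R₂) :=
      (mul_le_of_le_one_left (norm_nonneg _) hη1).trans (hm _ S S')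
    have h3 : η ^ 2 * ‖P R₃ S S'‖ ≤ m (P R₃) :=
      (mul_le_of_le_one_left (norm_nonneg _) (pow_le_one₀ hη.le hη1)).trans (hm _ S S')
    linarith
  have hev : ∀ a : ℝ, 0 < a → ∀ᶠ η in nhdsWithin (0 : ℝ) (Set.Ioi 0), 0 < η ∧ η ≤ a :=
    fun a ha => Ioc_mem_nhdsGT ha
  refine ⟨G, hcomm, fun S S' => ?_, hstate, hest, ?_⟩
  · refine Asymptotics.IsBigO.of_bound κ ?_
    filter_upwards [hev 1 one_pos] with η hη
    rw [Real.norm_of_nonneg hη.1.le]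
    exact hGκ η hη.1 hη.2 S S'
  · refine Asymptotics.IsBigO.of_bound (C * κ ^ 2) ?_
    filter_upwards [hev 1 one_pos, hev (δ / κ) (div_pos hδ hκ)] with η hη hη'
    have h := (hest η (κ * η) hη.1 (by rw [mul_comm]; exact (le_div_iff₀ hκ).1 hη'.2)
      (hGκ η hη.1 hη.2)).2.2
    rw [Real.norm_eq_abs, Real.norm_of_nonneg (by positivity)]
    linarith [mul_pow κ η 2, mul_assoc C (κ ^ 2) (η ^ 2)]
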